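/- Let $X$ be a connected coarse space (every $\{(x,y)\}$ is controlled) that is covered by countably many bounded sets, equipped with a $\sigma$-algebra containing all singletons and a measure $\mu$. For $E\subseteq X\times X$ put $E_x=\{y:(y,x)\in E\}$ and $E_U=\bigcup_{x\in U}E_x$; call $E$ measurable if $E_U$ is measurable for every measurable $U$. Assume that $\mu$ is uniformly bounded (for each controlled $E$ there is $C$ with $\mu(U)\le C$ for all measurable $U$ with $U\times U\subseteq E$) and that a gordo set exists, i.e. a symmetric measurable controlled set $E$ with $\inf_x\mu(E_x)>0$. Let $\mathbb C_{cs}[X]\subseteq B(L^2X)$ be the $*$-algebra of operators $T$ with controlled support: for some measurable controlled $E$, $\langle\xi,T\eta\rangle=\langle\xi,T(\eta|_{E_U})\rangle$ for all measurable $U$, all $\xi\in L^2X$ supported on $U$ and all $\eta\in L^2X$. Let $L^2_bX$ be the space of $L^2$-functions that vanish outside a bounded measurable set, and $LL^2X$ the space of functions that are square integrable on every bounded measurable set. An operator $T\in\mathbb C_{cs}[X]$ acts on $LL^2X$ as the dual of $T^*:L^2_bX\to L^2_bX$, that is, $\langle\xi,Tf\rangle=\langle T^*\xi,f\rangle$ for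 $\xi\in L^2_bX$; put $\Phi(T)=T(\mathbb 1_X)$. For $f\in L^\infty X$ let $M_f$ be the multiplication operator. A representation of $\mathbb C_{cs}[X]$ is a unital $*$-homomorphism $\rho:\mathbb C_{cs}[X]\to B(\mathcal H)$ for a Hilbert space $\mathcal H$. A vector $v\in\mathcal H$ is constant if $\rho(T)v=\rho(M_{\Phi(T)})v$ for all $T$ with $\Phi(T)$ bounded. The algebra $C^*_{\max}(X)$ is the completion of $\mathbb C_{cs}[X]$ in the norm $\sup_\rho\|\rho(T)\|$, and $\sigma_{\max}$ denotes the spectrum in it. For a gordo set $E$ let $\Delta^E\xi(x)=\int_{E_x}(\xi(x)-\xi(y))\,d\mu(y)$. A blocking collection is a family of pairwise disjoint measurable sets $A_i$ such that $\bigcup_iA_i\times A_i$ is controlled and $\inf_i\mu(A_i)>0$. The space $X$ is amenable if there is a positive unital linear map $\phi:L^\infty X\to\mathbb C$ with $\phi(f)=0$ whenever $f\in L^\infty X$ vanishes outside $\bigsqcup_iA_i$ and satisfies $\int_{A_i}f=0$ for all $i$, for some blocking collection $(A_i)$. The following are equivalent: (i) $X$ is amenable. (ii) There is a net $(\xi_\lambda)$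 of unit vectors in $L^2X$ such that $\|T\xi_\lambda-M_{\Phi(T)}\xi_\lambda\|\to0$ for all $T\in\mathbb C_{cs}[X]$ with $\Phi(T)$ bounded. (iii) For all $T\in\mathbb C_{cs}[X]$ with $\Phi(T)=0$ we have $0\in\sigma(T)$, the spectrum in $B(L^2X)$. (iv) For all gordo sets $E$ for which the formula above defines a bounded operator $\Delta^E$ on $L^2X$, which then lies in $\mathbb C_{cs}[X]$ (this is automatic if $E$ belongs to the product $\sigma$-algebra), we have $0\in\sigma_{\max}(\Delta^E)$. (v) There is a representation of $\mathbb C_{cs}[X]$ with a non-zero constant vector. (vi) There is a positive unital linear map $\phi:L^\infty X\to\mathbb C$ such that $\phi(Tf)=\phi(\overline{\Phi(T^*)}\,f)$ for all $T\in\mathbb C_{cs}[X]$ with $\Phi(T^*)$ bounded and all $f\in L^\infty X$ with $Tf\in L^\infty X$. -/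

import Mathlib

open MeasureTheory Filter Topology
open scoped ENNReal NNReal ComplexOrder

universe u

set_option linter.unusedSectionVars false

namespace CoarseAmenable

noncomputable section

/-! ### Coarse spaces -/

/-- The composition `E ∘ F = {(x,z) | ∃ y, (x,y) ∈ E ∧ (y,z) ∈ F}`. -/
def comp {X : Type*} (E F : Set (X × X)) : Set (X × X) :=
  {p | ∃ y, (p.1, y) ∈ E ∧ (y, p.2) ∈ F}

/-- The inverse of a subset of `X × X`. -/
def inv {X : Type*} (E : Set (X × X)) : Set (X × X) := {p | (p.2, p.1) ∈ E}

/-- The diagonal of `X × X`. -/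
def diag (X : Type*) : Set (X × X) := {p | p.1 = p.2}

/-- A coarse structure on `X`. -/
class CoarseSpace (X : Type*) where
  Controlled : Set (X × X) → Prop
  diag_mem : Controlled (diag X)
  subset_mem : ∀ E F, Controlled E → F ⊆ E → Controlled F
  inv_mem : ∀ E, Controlled E → Controlled (inv E)
  union_mem : ∀ E F, Controlled E → Controlled F → Controlled (E ∪ F)
  comp_mem : ∀ E F, Controlled E → Controlled F → Controlled (comp E F)

/-- `E_x = {y | (y,x) ∈ E}`. -/
def slice {X : Type*} (E : Set (X × X)) (x : X) : Set X := {y | (y, x) ∈ E}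

/-- `E_U = ⋃_{x ∈ U} E_x`. -/
def nhd {X : Type*} (E : Set (X × X)) (U : Set X) : Set X := {y | ∃ x ∈ U, (y, x) ∈ E}

section Coarse

variable {X : Type u} [CoarseSpace X]

open CoarseSpace

/-- A subset `U` is bounded if `U × U` is controlled. -/
def Bounded (U : Set X) : Prop := Controlled (U ×ˢ U)

/-- The coarse space is connected if all singletons `{(x,y)}` are controlled. -/
def Connected (X : Type u) [CoarseSpace X] : Prop := ∀ x y : X, Controlled {(x, y)}

/-- The set `E` is symmetric. -/
def Symm {X : Type*} (E : Set (X × X)) : Prop := inv E = E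

/-- A set `E ⊆ X × X` is measurable if `E_U` is measurable for all measurable `U`. -/
def MeasRel {X : Type*} [MeasurableSpace X] (E : Set (X × X)) : Prop :=
  ∀ U : Set X, MeasurableSet U → MeasurableSet (nhd E U)

variable [MeasurableSpace X]

/-- The measure `μ` is uniformly bounded: for every controlled `E` the `E`-bounded measurable sets
have uniformly bounded measure. -/
def UniformlyBounded (μ : Measure X) : Prop :=
  ∀ E : Set (X × X), Controlled E →
    ∃ C : ℝ≥0, ∀ U : Set X, MeasurableSet U → U ×ˢ U ⊆ E → μ U ≤ C

/-- A gordo set: a symmetric measurable controlled set `E` with `μ(E_x)` bounded away from zero. -/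
structure Gordo (μ : Measure X) (E : Set (X × X)) : Prop where
  controlled : Controlled E
  symm : Symm E
  meas : MeasRel E
  lower : ∃ ε : ℝ≥0, 0 < ε ∧ ∀ x : X, (ε : ℝ≥0∞) ≤ μ (slice E x)

/-- The standing assumptions on `(X, μ)`: the measure is uniformly bounded, a gordo set exists
(hence `X` has bounded geometry), and `X` is covered by countably many bounded sets. -/
structure Admissible (μ : Measure X) : Prop where
  uniformlyBounded : UniformlyBounded μ
  exists_gordo : ∃ E : Set (X × X), Gordo μ E
  countable_cover : ∃ B : ℕ → Set X, (∀ n, Bounded (B n)) ∧ ⋃ n, B n = Set.univ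

/-- A collection of measurable sets is blocking if its members are pairwise disjoint, `E`-bounded
for a common controlled set `E`, and bounded from below in measure. -/
def Blocking (μ : Measure X) (𝒜 : Set (Set X)) : Prop :=
  𝒜.PairwiseDisjoint id ∧ ∃ E : Set (X × X), Controlled E ∧ ∃ ε : ℝ≥0, 0 < ε ∧
    ∀ A ∈ 𝒜, MeasurableSet A ∧ A ×ˢ A ⊆ E ∧ (ε : ℝ≥0∞) ≤ μ A

/-- Positive unital linear functionals on `L^∞ X`. -/
def IsMean (μ : Measure X) (φ : Lp ℂ ∞ μ →ₗ[ℂ] ℂ) : Prop :=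
  (∀ f : Lp ℂ ∞ μ, (∀ᵐ x ∂μ, 0 ≤ f x) → 0 ≤ φ f) ∧ φ ((memLp_top_const (1 : ℂ)).toLp) = 1

/-- Amenability: there is a positive unital linear functional on `L^∞ X` that vanishes on every `f`
that is supported on the union of a blocking collection and has integral zero over each of its
members. -/
def Amenable (μ : Measure X) : Prop :=
  ∃ φ : Lp ℂ ∞ μ →ₗ[ℂ] ℂ, IsMean μ φ ∧
    ∀ 𝒜 : Set (Set X), Blocking μ 𝒜 → ∀ f : Lp ℂ ∞ μ,
      (∀ A ∈ 𝒜, ∫ x in A, f x ∂μ = 0) → (∀ᵐ x ∂μ, x ∉ ⋃₀ 𝒜 → f x = 0) → φ f = 0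

/-! ### Controlled and measurable sets: auxiliary facts -/

theorem symm_mem {E : Set (X × X)} (h : Symm E) {x y : X} (hxy : (x, y) ∈ E) : (y, x) ∈ E := by
  rw [← h]; exact hxy

theorem nhd_union {X : Type*} (E F : Set (X × X)) (U : Set X) :
    nhd (E ∪ F) U = nhd E U ∪ nhd F U := by
  ext y; constructor
  · rintro ⟨x, hx, h | h⟩
    · exact Or.inl ⟨x, hx, h⟩
    · exact Or.inr ⟨x, hx, h⟩
  · rintro (⟨x, hx, h⟩ | ⟨x, hx, h⟩)
    · exact ⟨x, hx, Or.inl h⟩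
    · exact ⟨x, hx, Or.inr h⟩

theorem nhd_comp {X : Type*} (E F : Set (X × X)) (U : Set X) :
    nhd (comp E F) U = nhd E (nhd F U) := by
  ext y; constructor
  · rintro ⟨x, hx, z, h1, h2⟩; exact ⟨z, ⟨x, hx, h2⟩, h1⟩
  · rintro ⟨z, ⟨x, hx, h2⟩, h1⟩; exact ⟨x, hx, z, h1, h2⟩

theorem nhd_diag {X : Type*} (U : Set X) : nhd (diag X) U = U := by
  ext y; constructor
  · rintro ⟨x, hx, h⟩
    have h' : y = x := h
    rwa [h']
  · intro h; exact ⟨y, h, rfl⟩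

theorem nhd_singleton {X : Type*} (E : Set (X × X)) (x : X) : nhd E {x} = slice E x := by
  ext y; simp [nhd, slice]

/-- Under the standing assumptions every controlled set is contained in a symmetric measurable
controlled set. -/
theorem Admissible.exists_symm [MeasurableSingletonClass X] {μ : Measure X} (h : Admissible μ)
    {E : Set (X × X)} (hE : Controlled E) :
    ∃ F : Set (X × X), Controlled F ∧ Symm F ∧ MeasRel F ∧ E ⊆ F := by
  obtain ⟨G, hG⟩ := h.exists_gordo
  obtain ⟨B, hB, hcov⟩ := h.countable_cover
  obtain ⟨ε, hε, hlow⟩ := hG.lower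
  have hsl : ∀ x, MeasurableSet (slice G x) := fun x => by
    rw [← nhd_singleton]; exact hG.meas _ (measurableSet_singleton x)
  -- a maximal set of points with pairwise disjoint slices
  obtain ⟨I, hI⟩ := zorn_subset {I : Set X | I.PairwiseDisjoint (slice G)} (by
    intro c hc hch
    refine ⟨⋃₀ c, ?_, fun s hs => Set.subset_sUnion_of_mem hs⟩
    exact (Set.pairwiseDisjoint_sUnion hch.directedOn).2 fun s hs => hc hs)
  have hdisj : I.PairwiseDisjoint (slice G) := hI.prop
  have hne : ∀ x, (slice G x).Nonempty := fun x => by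
    rw [Set.nonempty_iff_ne_empty]
    intro h0
    have := hlow x
    rw [h0, measure_empty] at this
    simp only [nonpos_iff_eq_zero, ENNReal.coe_eq_zero] at this
    exact hε.ne' this
  have hclose : ∀ x, ∃ i ∈ I, (x, i) ∈ comp G G := by
    intro x
    by_contra hcon
    push Not at hcon
    have hx : x ∉ I := fun hx => by
      obtain ⟨y, hy⟩ := hne x
      exact hcon x hx ⟨y, symm_mem hG.symm hy, hy⟩
    have hins : (insert x I).PairwiseDisjoint (slice G) := by
      refine hdisj.insert fun j hj _ => Set.disjoint_left.2 fun y hy hy' => ?_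
      exact hcon j hj ⟨y, symm_mem hG.symm hy, hy'⟩
    exact hx (hI.le_of_ge hins (Set.subset_insert x I) (Set.mem_insert x I))
  have hcount : I.Countable := by
    have hfin : ∀ n, (I ∩ B n).Finite := by
      intro n
      have hc : Controlled (comp G (comp (B n ×ˢ B n) G)) :=
        comp_mem _ _ hG.controlled (comp_mem _ _ (hB n) hG.controlled)
      obtain ⟨C, hC⟩ := h.uniformlyBounded _ hc
      by_contra hinf
      have hinf : (I ∩ B n).Infinite := hinf
      obtain ⟨N, hN⟩ := exists_nat_gt (C / ε)
      obtain ⟨s, hs, hcard⟩ := hinf.exists_subset_card_eq N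
      have hm : MeasurableSet (⋃ i ∈ s, slice G i) := s.measurableSet_biUnion fun i _ => hsl i
      have h1 := hC _ hm (by
        rintro ⟨a, b⟩ ⟨ha, hb⟩
        simp only [Set.mem_iUnion] at ha hb
        obtain ⟨i, hi, ha⟩ := ha
        obtain ⟨j, hj, hb⟩ := hb
        exact ⟨i, ha, j, ⟨(hs hi).2, (hs hj).2⟩, symm_mem hG.symm hb⟩)
      rw [measure_biUnion_finset (fun i hi j hj hij => hdisj (hs hi).1 (hs hj).1 hij)
        fun i _ => hsl i] at h1
      have h2 : (N : ℝ≥0∞) * ε ≤ ∑ i ∈ s, μ (slice G i) := by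
        calc (N : ℝ≥0∞) * ε = ∑ i ∈ s, (ε : ℝ≥0∞) := by simp [hcard]
          _ ≤ _ := Finset.sum_le_sum fun i _ => hlow i
      have h3 := h2.trans h1
      have h4 : (N : ℝ≥0) * ε ≤ C := by exact_mod_cast h3
      exact absurd ((div_lt_iff₀ hε).1 hN) (not_lt.2 h4)
    have : I = ⋃ n, I ∩ B n := by rw [← Set.inter_iUnion, hcov, Set.inter_univ]
    rw [this]
    exact Set.countable_iUnion fun n => (hfin n).countable
  set K : X → Set X := fun i => slice (comp G G) i with hK
  have hKm : ∀ i, MeasurableSet (K i) := fun i => by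
    have h1 : K i = nhd (comp G G) {i} := (nhd_singleton _ i).symm
    rw [h1, nhd_comp]
    exact hG.meas _ (hG.meas _ (measurableSet_singleton i))
  let S : Set (X × X) := E ∪ inv E
  let R : X → X → Prop := fun i j => ∃ a b, a ∈ K i ∧ b ∈ K j ∧ (a, b) ∈ S
  have hSc : Controlled S := union_mem _ _ hE (inv_mem _ hE)
  have hGG : ∀ {x y}, (x, y) ∈ comp G G → (y, x) ∈ comp G G := by
    rintro x y ⟨z, h1, h2⟩
    exact ⟨z, symm_mem hG.symm h2, symm_mem hG.symm h1⟩
  have hR : ∀ i j, R i j → R j i := by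
    rintro i j ⟨a, b, ha, hb, hab⟩
    exact ⟨b, a, hb, ha, hab.elim (fun h => Or.inr h) (fun h => Or.inl h)⟩
  refine ⟨{p | ∃ i ∈ I, ∃ j ∈ I, R i j ∧ p.1 ∈ K i ∧ p.2 ∈ K j}, ?_, ?_, ?_, ?_⟩
  · have hGc : Controlled (comp G G) := comp_mem _ _ hG.controlled hG.controlled
    have hGc' := comp_mem _ _ hGc hGc
    refine subset_mem _ _ (comp_mem _ _ hGc' (comp_mem _ _ hSc hGc')) ?_
    rintro ⟨x, y⟩ ⟨i, -, j, -, ⟨a, b, ha, hb, hab⟩, hx, hy⟩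
    exact ⟨a, ⟨i, hx, hGG ha⟩, b, hab, ⟨j, hb, hGG hy⟩⟩
  · ext ⟨x, y⟩
    constructor
    · rintro ⟨i, hi, j, hj, hij, hx, hy⟩; exact ⟨j, hj, i, hi, hR _ _ hij, hy, hx⟩
    · rintro ⟨i, hi, j, hj, hij, hx, hy⟩; exact ⟨j, hj, i, hi, hR _ _ hij, hy, hx⟩
  · intro U _
    have : nhd {p : X × X | ∃ i ∈ I, ∃ j ∈ I, R i j ∧ p.1 ∈ K i ∧ p.2 ∈ K j} U =
        ⋃ i ∈ {i ∈ I | ∃ j ∈ I, R i j ∧ (K j ∩ U).Nonempty}, K i := by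
      ext y
      simp only [Set.mem_iUnion]
      constructor
      · rintro ⟨x, hx, i, hi, j, hj, hij, hy, hxj⟩
        exact ⟨i, ⟨hi, j, hj, hij, x, hxj, hx⟩, hy⟩
      · rintro ⟨i, ⟨hi, j, hj, hij, x, hxj, hx⟩, hy⟩
        exact ⟨x, hx, i, hi, j, hj, hij, hy, hxj⟩
    rw [this]
    exact MeasurableSet.biUnion (hcount.mono fun i hi => hi.1) fun i _ => hKm i
  · rintro ⟨x, y⟩ hxy
    obtain ⟨i, hi, hxi⟩ := hclose x
    obtain ⟨j, hj, hyj⟩ := hclose y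
    exact ⟨i, hi, j, hj, ⟨x, y, hxi, hyj, Or.inl hxy⟩, hxi, hyj⟩

/-! ### Operators with controlled support -/

/-- The restriction of `η ∈ L² X` to a measurable set, extended by zero. -/
def cut {X : Type u} [MeasurableSpace X] {μ : Measure X} (U : Set X) (hU : MeasurableSet U)
    (η : Lp ℂ 2 μ) : Lp ℂ 2 μ :=
  ((Lp.memLp η).indicator hU).toLp

/-- `T` is supported on the measurable set `E`: for all measurable `U`, all `ξ` supported on `U`
and all `η` one has `⟨ξ, T η⟩ = ⟨ξ, T (η|_{E_U})⟩`. -/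
def SupportedOn {X : Type u} [MeasurableSpace X] {μ : Measure X} (E : Set (X × X))
    (hE : MeasRel E) (T : Lp ℂ 2 μ →L[ℂ] Lp ℂ 2 μ) : Prop :=
  ∀ (U : Set X) (hU : MeasurableSet U) (ξ η : Lp ℂ 2 μ), (∀ᵐ x ∂μ, x ∉ U → ξ x = 0) →
    inner ℂ ξ (T η) = inner ℂ ξ (T (cut (nhd E U) (hE U hU) η))

/-- `T` has controlled support. -/
def HasControlledSupport {μ : Measure X} (T : Lp ℂ 2 μ →L[ℂ] Lp ℂ 2 μ) : Prop :=
  ∃ (E : Set (X × X)) (hE : MeasRel E), Controlled E ∧ SupportedOn E hE T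

section Support

variable {μ : Measure X}

theorem coeFn_cut (U : Set X) (hU : MeasurableSet U) (η : Lp ℂ 2 μ) :
    cut U hU η =ᵐ[μ] U.indicator η := MemLp.coeFn_toLp _

theorem inner_eq_zero {U : Set X} {ξ η : Lp ℂ 2 μ} (h1 : ∀ᵐ x ∂μ, x ∉ U → ξ x = 0)
    (h2 : ∀ᵐ x ∂μ, x ∈ U → η x = 0) : inner ℂ ξ η = 0 := by
  rw [L2.inner_def]
  refine integral_eq_zero_of_ae ?_
  filter_upwards [h1, h2] with x hx1 hx2
  by_cases hx : x ∈ U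
  · simp [hx2 hx]
  · simp [hx1 hx]

theorem supportedOn_iff (E : Set (X × X)) (hE : MeasRel E) (T : Lp ℂ 2 μ →L[ℂ] Lp ℂ 2 μ) :
    SupportedOn E hE T ↔ ∀ U : Set X, MeasurableSet U → ∀ η : Lp ℂ 2 μ,
      (∀ᵐ x ∂μ, x ∈ nhd E U → η x = 0) → ∀ᵐ x ∂μ, x ∈ U → (T η) x = 0 := by
  constructor
  · intro h U hU η hη
    have hcut : cut (nhd E U) (hE U hU) η = 0 := by
      refine Lp.ext ?_
      filter_upwards [coeFn_cut (nhd E U) (hE U hU) η, hη, Lp.coeFn_zero ℂ 2 μ] with x h1 h2 h3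
      rw [h1, h3]
      by_cases hx : x ∈ nhd E U
      · simp [Set.indicator_of_mem hx, h2 hx]
      · simp [Set.indicator_of_notMem hx]
    have hsupp : ∀ᵐ x ∂μ, x ∉ U → (cut U hU (T η)) x = 0 := by
      filter_upwards [coeFn_cut U hU (T η)] with x h1 hx
      rw [h1, Set.indicator_of_notMem hx]
    have h0 := h U hU (cut U hU (T η)) η hsupp
    rw [hcut, map_zero, inner_zero_right] at h0
    have h1 : inner ℂ (cut U hU (T η)) (T η - cut U hU (T η)) = 0 := by
      refine inner_eq_zero hsupp ?_
      filter_upwards [Lp.coeFn_sub (T η) (cut U hU (T η)), coeFn_cut U hU (T η)] with x h1 h2 hx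
      rw [h1, Pi.sub_apply, h2, Set.indicator_of_mem hx, sub_self]
    rw [inner_sub_right, h0, zero_sub, neg_eq_zero, inner_self_eq_zero] at h1
    filter_upwards [coeFn_cut U hU (T η), Lp.coeFn_zero ℂ 2 μ] with x h2 h3 hx
    rw [h1, h3, Set.indicator_of_mem hx] at h2
    exact h2.symm
  · intro h U hU ξ η hξ
    rw [← sub_eq_zero, ← inner_sub_right, ← map_sub]
    refine inner_eq_zero hξ (h U hU _ ?_)
    filter_upwards [Lp.coeFn_sub η (cut (nhd E U) (hE U hU) η),
      coeFn_cut (nhd E U) (hE U hU) η] with x h1 h2 hx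
    rw [h1, Pi.sub_apply, h2, Set.indicator_of_mem hx, sub_self]

theorem SupportedOn.mono {E F : Set (X × X)} {hE : MeasRel E} (hF : MeasRel F) (hEF : E ⊆ F)
    {T : Lp ℂ 2 μ →L[ℂ] Lp ℂ 2 μ} (h : SupportedOn E hE T) : SupportedOn F hF T := by
  rw [supportedOn_iff] at h ⊢
  intro U hU η hη
  refine h U hU η ?_
  filter_upwards [hη] with x hx
  rintro ⟨y, hy, hxy⟩
  exact hx ⟨y, hy, hEF hxy⟩

theorem HasControlledSupport.add {S T : Lp ℂ 2 μ →L[ℂ] Lp ℂ 2 μ} (hS : HasControlledSupport S)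
    (hT : HasControlledSupport T) : HasControlledSupport (S + T) := by
  obtain ⟨E, hE, hEc, hS⟩ := hS
  obtain ⟨F, hF, hFc, hT⟩ := hT
  have hm : MeasRel (E ∪ F) := fun U hU => by
    rw [nhd_union]; exact (hE U hU).union (hF U hU)
  refine ⟨E ∪ F, hm, union_mem _ _ hEc hFc, ?_⟩
  have h1 := hS.mono hm Set.subset_union_left
  have h2 := hT.mono hm Set.subset_union_right
  intro U hU ξ η hξ
  simp only [_root_.add_apply, inner_add_right]
  rw [h1 U hU ξ η hξ, h2 U hU ξ η hξ]

theorem HasControlledSupport.mul {S T : Lp ℂ 2 μ →L[ℂ] Lp ℂ 2 μ} (hS : HasControlledSupport S)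
    (hT : HasControlledSupport T) : HasControlledSupport (S * T) := by
  obtain ⟨E, hE, hEc, hS⟩ := hS
  obtain ⟨F, hF, hFc, hT⟩ := hT
  have hm : MeasRel (comp F E) := fun U hU => by
    rw [nhd_comp]; exact hF _ (hE U hU)
  refine ⟨comp F E, hm, comp_mem _ _ hFc hEc, ?_⟩
  rw [supportedOn_iff] at hS hT ⊢
  intro U hU η hη
  rw [nhd_comp] at hη
  exact hS U hU _ (hT _ (hE U hU) η hη)

/-- The operator of multiplication by a bounded function. -/
def mulOp (μ : Measure X) (f : Lp ℂ ∞ μ) : Lp ℂ 2 μ →L[ℂ] Lp ℂ 2 μ :=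
  (ContinuousLinearMap.lsmul ℂ ℂ).holderL μ ∞ 2 2 f

theorem mulOp_apply (f : Lp ℂ ∞ μ) (ξ : Lp ℂ 2 μ) : mulOp μ f ξ =ᵐ[μ] fun x => f x * ξ x :=
  (ContinuousLinearMap.lsmul ℂ ℂ).coeFn_holder (r := 2) f ξ

theorem measRel_diag : MeasRel (diag X) := fun U hU => by rwa [nhd_diag]

theorem hasControlledSupport_mulOp (f : Lp ℂ ∞ μ) : HasControlledSupport (mulOp μ f) := by
  refine ⟨diag X, measRel_diag, diag_mem, ?_⟩
  rw [supportedOn_iff]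
  intro U hU η hη
  rw [nhd_diag] at hη
  filter_upwards [hη, mulOp_apply f η] with x h1 h2 hx
  rw [h2, h1 hx, mul_zero]

theorem hasControlledSupport_algebraMap (c : ℂ) :
    HasControlledSupport (algebraMap ℂ (Lp ℂ 2 μ →L[ℂ] Lp ℂ 2 μ) c) := by
  refine ⟨diag X, measRel_diag, diag_mem, ?_⟩
  rw [supportedOn_iff]
  intro U hU η hη
  rw [nhd_diag] at hη
  have h0 : algebraMap ℂ (Lp ℂ 2 μ →L[ℂ] Lp ℂ 2 μ) c η = c • η := by
    rw [Algebra.algebraMap_eq_smul_one]; rfl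
  rw [h0]
  filter_upwards [hη, Lp.coeFn_smul c η] with x h1 h2 hx
  rw [h2, Pi.smul_apply, h1 hx, smul_zero]

theorem HasControlledSupport.star [MeasurableSingletonClass X] (h : Admissible μ)
    {T : Lp ℂ 2 μ →L[ℂ] Lp ℂ 2 μ} (hT : HasControlledSupport T) :
    HasControlledSupport (star T) := by
  obtain ⟨E, hE, hEc, hT⟩ := hT
  obtain ⟨F, hFc, hFs, hFm, hEF⟩ := h.exists_symm hEc
  refine ⟨F, hFm, hFc, ?_⟩
  have hT := hT.mono hFm hEF
  rw [supportedOn_iff] at hT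
  intro U hU ξ η hξ
  rw [ContinuousLinearMap.star_eq_adjoint, ContinuousLinearMap.adjoint_inner_right,
    ContinuousLinearMap.adjoint_inner_right, ← sub_eq_zero, ← inner_sub_right]
  have hV : MeasurableSet (nhd F U)ᶜ := (hFm U hU).compl
  have h1 : ∀ᵐ x ∂μ, x ∈ (nhd F U)ᶜ → (T ξ) x = 0 := by
    refine hT _ hV ξ ?_
    filter_upwards [hξ] with x hx
    rintro ⟨y, hy, hxy⟩
    exact hx fun hxU => hy ⟨x, hxU, symm_mem hFs hxy⟩
  refine inner_eq_zero (U := nhd F U) h1 ?_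
  filter_upwards [Lp.coeFn_sub η (cut (nhd F U) (hFm U hU) η),
    coeFn_cut (nhd F U) (hFm U hU) η] with x h1 h2 hx
  rw [h1, Pi.sub_apply, h2, Set.indicator_of_mem hx, sub_self]

end Support

/-- The unital `*`-algebra `ℂ_cs[X]` of the operators on `L² X` with controlled support. -/
def Ccs [MeasurableSingletonClass X] {μ : Measure X} (h : Admissible μ) :
    StarSubalgebra ℂ (Lp ℂ 2 μ →L[ℂ] Lp ℂ 2 μ) where
  carrier := {T | HasControlledSupport T}
  mul_mem' hS hT := HasControlledSupport.mul hS hT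
  add_mem' hS hT := HasControlledSupport.add hS hT
  algebraMap_mem' c := hasControlledSupport_algebraMap c
  star_mem' hT := HasControlledSupport.star h hT

/-- Multiplication by a bounded function, as an element of `ℂ_cs[X]`. -/
def mulCs [MeasurableSingletonClass X] {μ : Measure X} (h : Admissible μ) (f : Lp ℂ ∞ μ) :
    Ccs h := ⟨mulOp μ f, hasControlledSupport_mulOp f⟩

/-! ### The action on locally square integrable functions and the map `Φ` -/

/-- The function `f` belongs to `LL² X`: it is square integrable on all bounded measurable sets. -/
def LocL2 (μ : Measure X) (f : X → ℂ) : Prop :=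
  AEStronglyMeasurable f μ ∧
    ∀ U : Set X, MeasurableSet U → Bounded U → MemLp f 2 (μ.restrict U)

/-- The element `ξ` belongs to `L²_b X`: it vanishes outside a bounded measurable set. -/
def BddSupport {μ : Measure X} (ξ : Lp ℂ 2 μ) : Prop :=
  ∃ U : Set X, MeasurableSet U ∧ Bounded U ∧ ∀ᵐ x ∂μ, x ∉ U → ξ x = 0

/-- `T f = g` for `f, g ∈ LL² X`, where `T ∈ ℂ_cs[X]` acts on `LL² X`, the dual of `L²_b X`, as the
dual of `T* : L²_b X → L²_b X`; that is, `⟨ξ, g⟩ = ⟨T* ξ, f⟩` for all `ξ ∈ L²_b X`. -/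
def LocMapsTo [MeasurableSingletonClass X] {μ : Measure X} {h : Admissible μ} (T : Ccs h)
    (f g : X → ℂ) : Prop :=
  LocL2 μ f ∧ LocL2 μ g ∧ ∀ ξ : Lp ℂ 2 μ, BddSupport ξ →
    ∫ x, inner ℂ (ξ x) (g x) ∂μ =
      ∫ x, inner ℂ ((star (T : Lp ℂ 2 μ →L[ℂ] Lp ℂ 2 μ) ξ) x) (f x) ∂μ

/-- `Φ(T) = g`, where `Φ(T) = T(1) ∈ LL² X`. -/
def PhiEq [MeasurableSingletonClass X] {μ : Measure X} {h : Admissible μ} (T : Ccs h)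
    (g : X → ℂ) : Prop := LocMapsTo T (fun _ => 1) g

/-- The operator `T` is the Laplacian `Δ^E`:
`(Δ^E ξ)(x) = ∫_{E_x} (ξ(x) - ξ(y)) dμ(y)` for all `ξ ∈ L² X` and almost all `x`. -/
def IsLaplacian {μ : Measure X} (E : Set (X × X)) (T : Lp ℂ 2 μ →L[ℂ] Lp ℂ 2 μ) : Prop :=
  ∀ ξ : Lp ℂ 2 μ, ∀ᵐ x ∂μ, (T ξ) x = ∫ y in slice E x, (ξ x - ξ y) ∂μ

end Coarse

/-! ### Representations and the maximal C*-algebra of a `*`-algebra -/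

section Max

variable (A : Type u) [Ring A] [StarRing A] [Algebra ℂ A]

/-- A representation: a Hilbert space with a unital `*`-homomorphism into its bounded operators.
No continuity of the homomorphism is required. -/
structure Rep where
  H : Type u
  [group : NormedAddCommGroup H]
  [innerProduct : InnerProductSpace ℂ H]
  [complete : CompleteSpace H]
  ρ : A →⋆ₐ[ℂ] (H →L[ℂ] H)

attribute [instance] Rep.group Rep.innerProduct Rep.complete

variable {A}

/-- The maximal norm `sup ‖ρ(a)‖` over all representations `ρ`, with values in `[0, ∞]`. -/
def maxNorm (a : A) : ℝ≥0∞ := ⨆ r : Rep A, ‖r.ρ a‖ₑ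

/-! Algebraic facts about the maximal norm. -/

theorem maxNorm_zero : maxNorm (0 : A) = 0 := by simp [maxNorm]

theorem maxNorm_neg (a : A) : maxNorm (-a) = maxNorm a := by simp [maxNorm]

theorem maxNorm_add (a b : A) : maxNorm (a + b) ≤ maxNorm a + maxNorm b := by
  refine iSup_le fun r => ?_
  rw [map_add]
  exact (enorm_add_le _ _).trans
    (add_le_add (le_iSup (fun r : Rep A => ‖r.ρ a‖ₑ) r) (le_iSup (fun r : Rep A => ‖r.ρ b‖ₑ) r))

theorem maxNorm_mul (a b : A) : maxNorm (a * b) ≤ maxNorm a * maxNorm b := by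
  refine iSup_le fun r => ?_
  rw [map_mul]
  have h : ‖r.ρ a * r.ρ b‖ₑ ≤ ‖r.ρ a‖ₑ * ‖r.ρ b‖ₑ := by
    rw [← ofReal_norm, ← ofReal_norm, ← ofReal_norm, ← ENNReal.ofReal_mul (norm_nonneg _)]
    exact ENNReal.ofReal_le_ofReal (norm_mul_le _ _)
  exact h.trans
    (mul_le_mul' (le_iSup (fun r : Rep A => ‖r.ρ a‖ₑ) r) (le_iSup (fun r : Rep A => ‖r.ρ b‖ₑ) r))

theorem maxNorm_smul_le (c : ℂ) (a : A) : maxNorm (c • a) ≤ ‖c‖ₑ * maxNorm a := by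
  refine iSup_le fun r => ?_
  rw [map_smul, enorm_smul]
  exact mul_le_mul' le_rfl (le_iSup (fun r : Rep A => ‖r.ρ a‖ₑ) r)

theorem maxNorm_algebraMap (c : ℂ) : maxNorm (algebraMap ℂ A c) < ∞ := by
  refine lt_of_le_of_lt (iSup_le fun r => ?_) (enorm_lt_top (x := c))
  rw [AlgHomClass.commutes, Algebra.algebraMap_eq_smul_one, enorm_smul]
  have h : ‖(1 : r.H →L[ℂ] r.H)‖ₑ ≤ 1 := by
    rw [← ofReal_norm, ← ENNReal.ofReal_one]
    exact ENNReal.ofReal_le_ofReal ContinuousLinearMap.norm_id_le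
  calc ‖c‖ₑ * ‖(1 : r.H →L[ℂ] r.H)‖ₑ ≤ ‖c‖ₑ * 1 := mul_le_mul' le_rfl h
    _ = ‖c‖ₑ := mul_one _

variable (A) in
/-- The subalgebra of the elements of finite maximal norm. For `A = ℂ_cs[X]` under the standing
assumptions every element has finite maximal norm. -/
def finiteMax : Subalgebra ℂ A where
  carrier := {a | maxNorm a < ∞}
  mul_mem' ha hb := lt_of_le_of_lt (maxNorm_mul _ _) (ENNReal.mul_lt_top ha hb)
  add_mem' ha hb := lt_of_le_of_lt (maxNorm_add _ _) (ENNReal.add_lt_top.2 ⟨ha, hb⟩)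
  algebraMap_mem' c := maxNorm_algebraMap c

variable (A) in
/-- The algebra `finiteMax A`, as a type that carries the maximal norm. -/
def MaxPre : Type u := finiteMax A

instance : Ring (MaxPre A) := inferInstanceAs (Ring (finiteMax A))

instance : Algebra ℂ (MaxPre A) := inferInstanceAs (Algebra ℂ (finiteMax A))

instance : SeminormedRing (MaxPre A) :=
  { (inferInstance : Ring (MaxPre A)),
    AddGroupSeminorm.toSeminormedAddCommGroup
      ({ toFun := fun a => (maxNorm (Subtype.val a : A)).toReal
         map_zero' := by
          show (maxNorm (0 : A)).toReal = 0
          rw [maxNorm_zero]; rfl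
         add_le' := fun a b => by
          rw [← ENNReal.toReal_add (LT.lt.ne a.2) (LT.lt.ne b.2)]
          exact ENNReal.toReal_mono (ENNReal.add_lt_top.2 ⟨a.2, b.2⟩).ne (maxNorm_add _ _)
         neg' := fun a => by
          show (maxNorm (-(Subtype.val a : A))).toReal = _
          rw [maxNorm_neg] } : AddGroupSeminorm (MaxPre A)) with
    norm_mul_le := fun a b => by
      show (maxNorm ((Subtype.val a : A) * Subtype.val b)).toReal ≤
        (maxNorm (Subtype.val a : A)).toReal * (maxNorm (Subtype.val b : A)).toReal
      rw [← ENNReal.toReal_mul]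
      exact ENNReal.toReal_mono (ENNReal.mul_lt_top a.2 b.2).ne (maxNorm_mul _ _) }

theorem MaxPre.norm_def (a : MaxPre A) : ‖a‖ = (maxNorm (Subtype.val a : A)).toReal := rfl

instance : NormedSpace ℂ (MaxPre A) where
  norm_smul_le c a := by
    rw [MaxPre.norm_def, MaxPre.norm_def, ← toReal_enorm, ← ENNReal.toReal_mul]
    exact ENNReal.toReal_mono (ENNReal.mul_lt_top enorm_lt_top a.2).ne (maxNorm_smul_le _ _)

variable (A) in
/-- The maximal C*-algebra: the completion with respect to the maximal norm. Only its structure of a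
normed ring and a complex algebra is needed to speak of spectra. -/
abbrev MaxCStar : Type u := UniformSpace.Completion (MaxPre A)

/-- The canonical map into the maximal C*-algebra. -/
def toMaxCStar (a : A) (ha : maxNorm a < ∞) : MaxCStar A :=
  UniformSpace.Completion.coe' (α := MaxPre A) (⟨a, ha⟩ : finiteMax A)

/-- The spectrum `σ_max(a)` of `a` in the maximal C*-algebra. -/
def maxSpectrum (a : A) : Set ℂ :=
  {z | ∃ ha : maxNorm a < ∞, z ∈ spectrum ℂ (toMaxCStar a ha)}

end Max

section Constant

variable {X : Type u} [CoarseSpace X] [MeasurableSpace X] [MeasurableSingletonClass X]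

/-- The vector `v` is a constant vector of the representation `r` of `ℂ_cs[X]`: `T v = M_{Φ(T)} v`
for all `T ∈ ℂ_cs[X]` for which `Φ(T)` is bounded. -/
def ConstantVector {μ : Measure X} {h : Admissible μ} (r : Rep (Ccs h)) (v : r.H) : Prop :=
  ∀ (T : Ccs h) (f : Lp ℂ ∞ μ), PhiEq T f → r.ρ T v = r.ρ (mulCs h f) v

end Constant

end

end CoarseAmenable

/-! The implications run (i) ⇒ (ii) ⇒ (v) ⇒ (vi) ⇒ (i), with (ii) ⇔ (iii) and (v) ⇒ (iv) ⇒ (i)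
attached. If Φ(T) = f is bounded, then Φ(T - M_f) = 0, so most of the work concerns operators that
kill the constants; these form a left ideal, hence contain T*T and finite sums of such products.

The geometry is discretized. A maximal family of disjoint slices of a gordo set yields a countable
measurable partition of X into uniformly bounded blocks of mass bounded below
(`Admissible.exists_blockMap`). By uniform boundedness of the measure, a controlled set makes the
blocks into a graph of bounded degree, and finitely many colors separate any two blocks with a
common neighbour (`BlockMap.exists_coloring`).

(i) ⇒ (ii) is a Hahn-Banach argument. Convex combinations of normalized block indicators are
probability densities, whose differences along edges lie in ℓ¹. If 0 is in the closure of these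
difference vectors, some density has small variation. Its square root is a unit vector ξ of L², and
since T kills constants, Tξ on a block sees only the variation of ξ over the neighbouring blocks;
thus ‖Tξ‖² is bounded by a constant times the variation of the density (`Amenable.exists_norm_lt`).
Otherwise a functional separates the difference vectors from 0. It is a bounded edge function whose
normalized divergence is at least u > 0 on every block. The coloring splits this divergence into
finitely many functions, each with integral zero over the members of a blocking collection of stars,
so an invariant mean kills it, a contradiction (`Amenable.not_le_edgeVec`).

(iv) ⇒ (i) has to cope with arbitrary representations, to which positivity in B(L²X) need not pass.
It does pass for operators supported on a controlled equivalence relation, because the square root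
has the same support and so lies in the algebra (`exists_star_mul_self_of_supportedOn`). Hence
Laplacians of blocking collections are positive in every representation. A vector of small energy
for a large enough Laplacian has small energy for each of finitely many blocking collections. A
function with integral zero over the blocks is a sum of a left and a right multiple of their
Laplacian (`Blocking.exists_mulOp_eq`), so the vector functional nearly kills it, and an ultralimit
of such functionals is the mean. The same square roots, together with the coloring, show that the
maximal norm is finite (`Ccs.maxNorm_lt_top`).

The rest is soft: (ii) ⇒ (v) is the GNS construction for a limit of vector states, (v) ⇒ (vi) takes
the vector functional of a constant vector, (v) ⇒ (iv) holds because a Laplacian kills constant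
vectors, and (vi) ⇒ (i) tests invariance on the integral operator of a blocking collection. -/

namespace CoarseAmenable

noncomputable section

open CoarseSpace

/-! ### Partition of the space into blocks, and the bounded-degree graph of blocks -/

section Blocks

variable {X : Type u} [CoarseSpace X] [MeasurableSpace X] {μ : Measure X}

/-- A measurable partition of `X`, indexed by natural numbers, into uniformly bounded blocks whose
measure is bounded from below. -/
structure BlockMap (μ : Measure X) (b : X → ℕ) : Prop where
  meas : Measurable b
  controlled : Controlled {p : X × X | b p.1 = b p.2}
  lower : ∃ ε : ℝ≥0, 0 < ε ∧ ∀ x, (ε : ℝ≥0∞) ≤ μ (b ⁻¹' {b x})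

theorem mem_comp_symm {G : Set (X × X)} (hs : Symm G) {x y : X}
    (hxy : (x, y) ∈ comp G G) : (y, x) ∈ comp G G := by
  obtain ⟨z, h1, h2⟩ := hxy
  exact ⟨z, symm_mem hs h2, symm_mem hs h1⟩

/-- A maximal family of points whose slices of a gordo set are pairwise disjoint. -/
theorem Admissible.exists_separated [MeasurableSingletonClass X] (h : Admissible μ)
    {G : Set (X × X)} (hG : Gordo μ G) :
    ∃ I : Set X, I.Countable ∧ I.PairwiseDisjoint (slice G) ∧
      ∀ x, ∃ i ∈ I, (x, i) ∈ comp G G := by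
  obtain ⟨B, hB, hcov⟩ := h.countable_cover
  obtain ⟨ε, hε, hlow⟩ := hG.lower
  have hsl : ∀ x, MeasurableSet (slice G x) := fun x => by
    rw [← nhd_singleton]; exact hG.meas _ (measurableSet_singleton x)
  obtain ⟨I, hI⟩ := zorn_subset {I : Set X | I.PairwiseDisjoint (slice G)} (by
    intro c hc hch
    refine ⟨⋃₀ c, ?_, fun s hs => Set.subset_sUnion_of_mem hs⟩
    exact (Set.pairwiseDisjoint_sUnion hch.directedOn).2 fun s hs => hc hs)
  have hdisj : I.PairwiseDisjoint (slice G) := hI.prop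
  have hne : ∀ x, (slice G x).Nonempty := fun x => by
    rw [Set.nonempty_iff_ne_empty]
    intro h0
    have := hlow x
    rw [h0, measure_empty] at this
    simp only [nonpos_iff_eq_zero, ENNReal.coe_eq_zero] at this
    exact hε.ne' this
  refine ⟨I, ?_, hdisj, ?_⟩
  -- A packing bound: disjoint slices of mass at least ε centred in one bounded set have a union
  -- that is bounded for a fixed controlled set, so there are at most C / ε of them.
  · have hfin : ∀ n, (I ∩ B n).Finite := by
      intro n
      have hc : Controlled (comp G (comp (B n ×ˢ B n) G)) :=
        comp_mem _ _ hG.controlled (comp_mem _ _ (hB n) hG.controlled)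
      obtain ⟨C, hC⟩ := h.uniformlyBounded _ hc
      by_contra hinf
      have hinf : (I ∩ B n).Infinite := hinf
      obtain ⟨N, hN⟩ := exists_nat_gt (C / ε)
      obtain ⟨s, hs, hcard⟩ := hinf.exists_subset_card_eq N
      have hm : MeasurableSet (⋃ i ∈ s, slice G i) := s.measurableSet_biUnion fun i _ => hsl i
      have h1 := hC _ hm (by
        rintro ⟨a, b⟩ ⟨ha, hb⟩
        simp only [Set.mem_iUnion] at ha hb
        obtain ⟨i, hi, ha⟩ := ha
        obtain ⟨j, hj, hb⟩ := hb
        exact ⟨i, ha, j, ⟨(hs hi).2, (hs hj).2⟩, symm_mem hG.symm hb⟩)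
      rw [measure_biUnion_finset (fun i hi j hj hij => hdisj (hs hi).1 (hs hj).1 hij)
        fun i _ => hsl i] at h1
      have h2 : (N : ℝ≥0∞) * ε ≤ ∑ i ∈ s, μ (slice G i) := by
        calc (N : ℝ≥0∞) * ε = ∑ i ∈ s, (ε : ℝ≥0∞) := by simp [hcard]
          _ ≤ _ := Finset.sum_le_sum fun i _ => hlow i
      have h4 : (N : ℝ≥0) * ε ≤ C := by exact_mod_cast h2.trans h1
      exact absurd ((div_lt_iff₀ hε).1 hN) (not_lt.2 h4)
    have : I = ⋃ n, I ∩ B n := by rw [← Set.inter_iUnion, hcov, Set.inter_univ]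
    rw [this]
    exact Set.countable_iUnion fun n => (hfin n).countable
  · intro x
    by_contra hcon
    push Not at hcon
    have hx : x ∉ I := fun hx => by
      obtain ⟨y, hy⟩ := hne x
      exact hcon x hx ⟨y, symm_mem hG.symm hy, hy⟩
    have hins : (insert x I).PairwiseDisjoint (slice G) := by
      refine hdisj.insert fun j hj _ => Set.disjoint_left.2 fun y hy hy' => ?_
      exact hcon j hj ⟨y, symm_mem hG.symm hy, hy'⟩
    exact hx (hI.le_of_ge hins (Set.subset_insert x I) (Set.mem_insert x I))

/-- The slices around a separated family are the cores of the blocks, and every remaining point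
joins the first center (in the enumeration `e`) within `comp G G`. Since cores are disjoint and
never reassigned, each block contains a full slice, which gives the lower bound on its mass. -/
theorem Admissible.exists_blockMap [MeasurableSingletonClass X] (h : Admissible μ) :
    ∃ b : X → ℕ, BlockMap μ b := by
  classical
  obtain ⟨G, hG⟩ := h.exists_gordo
  obtain ⟨ε, hε, hlow⟩ := hG.lower
  obtain ⟨I, hIc, hdisj, hclose⟩ := h.exists_separated hG
  have := hIc.to_subtype
  obtain ⟨e, he⟩ := Countable.exists_injective_nat I
  have hsl : ∀ x, MeasurableSet (slice G x) := fun x => by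
    rw [← nhd_singleton]; exact hG.meas _ (measurableSet_singleton x)
  have hsl2 : ∀ x, MeasurableSet (slice (comp G G) x) := fun x => by
    rw [← nhd_singleton, nhd_comp]; exact hG.meas _ (hG.meas _ (measurableSet_singleton x))
  let p : X → ℕ → Prop := fun x n => ∃ i : I, e i = n ∧
    (x ∈ slice G i ∨ (x ∈ (⋃ j : I, slice G j)ᶜ ∩ slice (comp G G) i))
  have hp : ∀ x, ∃ n, p x n := fun x => by
    by_cases hx : x ∈ ⋃ j : I, slice G j
    · obtain ⟨i, hi⟩ := Set.mem_iUnion.1 hx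
      exact ⟨e i, i, rfl, Or.inl hi⟩
    · obtain ⟨i, hi, hxi⟩ := hclose x
      exact ⟨e ⟨i, hi⟩, ⟨i, hi⟩, rfl, Or.inr ⟨hx, hxi⟩⟩
  have hpm : ∀ n, MeasurableSet {x | p x n} := fun n => by
    have : {x | p x n} = ⋃ i : I, ⋃ _ : e i = n,
        (slice G i ∪ ((⋃ j : I, slice G j)ᶜ ∩ slice (comp G G) i)) := by
      ext x
      simp only [p, Set.mem_ofPred_eq, Set.mem_iUnion, exists_prop, Set.mem_union]
    rw [this]
    refine MeasurableSet.iUnion fun i => MeasurableSet.iUnion fun _ => (hsl i).union ?_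
    exact (MeasurableSet.iUnion fun j : I => hsl j).compl.inter (hsl2 i)
  have hb : ∀ x, ∃ i : I, e i = Nat.find (hp x) ∧
      (x ∈ slice G i ∨ (x ∈ (⋃ j : I, slice G j)ᶜ ∩ slice (comp G G) i)) :=
    fun x => Nat.find_spec (hp x)
  refine ⟨fun x => Nat.find (hp x), measurable_find hp hpm, ?_, ε, hε, fun x => ?_⟩
  · have hGG : Controlled (G ∪ comp G G) :=
      union_mem _ _ hG.controlled (comp_mem _ _ hG.controlled hG.controlled)
    refine subset_mem _ _ (comp_mem _ _ hGG hGG) ?_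
    rintro ⟨x, y⟩ hxy
    have hxy : Nat.find (hp x) = Nat.find (hp y) := hxy
    obtain ⟨i, hi, hxi⟩ := hb x
    obtain ⟨j, hj, hyj⟩ := hb y
    obtain rfl : i = j := he (by rw [hi, hj, hxy])
    refine ⟨i, ?_, ?_⟩
    · exact hxi.elim (fun h => Or.inl h) fun h => Or.inr h.2
    · exact hyj.elim (fun h => Or.inl (symm_mem hG.symm h))
        fun h => Or.inr (mem_comp_symm hG.symm h.2)
  · obtain ⟨i, hi, -⟩ := hb x
    refine (hlow i).trans (measure_mono fun y hy => ?_)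
    obtain ⟨j, hj, hyj⟩ := hb y
    have hij : i = j := by
      rcases hyj with h1 | h1
      · by_contra hne
        exact Set.disjoint_left.1 (hdisj i.2 j.2 fun h => hne (Subtype.ext h)) hy h1
      · exact absurd (Set.mem_iUnion.2 ⟨i, hy⟩) h1.1
    show Nat.find (hp y) = Nat.find (hp x)
    rw [← hi, ← hj, hij]

theorem Admissible.measure_lt_top (h : Admissible μ) {U : Set X} (hU : MeasurableSet U)
    (hb : Bounded U) : μ U < ∞ := by
  obtain ⟨C, hC⟩ := h.uniformlyBounded _ hb
  exact (hC U hU le_rfl).trans_lt ENNReal.coe_lt_top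

variable {b : X → ℕ}

theorem BlockMap.bounded_fiber (hb : BlockMap μ b) (n : ℕ) : Bounded (b ⁻¹' {n}) :=
  subset_mem _ _ hb.controlled fun p hp => by
    have h1 : b p.1 = n := hp.1
    have h2 : b p.2 = n := hp.2
    exact h1.trans h2.symm

theorem BlockMap.measurableSet_fiber (hb : BlockMap μ b) (s : Set ℕ) : MeasurableSet (b ⁻¹' s) :=
  hb.meas (MeasurableSet.of_discrete)

theorem BlockMap.sigmaFinite (h : Admissible μ) (hb : BlockMap μ b) : SigmaFinite μ := by
  refine ⟨⟨⟨fun n => b ⁻¹' {n}, fun _ => trivial,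
    fun n => h.measure_lt_top (hb.measurableSet_fiber _) (hb.bounded_fiber n), ?_⟩⟩⟩
  exact Set.eq_univ_of_forall fun x => Set.mem_iUnion.2 ⟨b x, rfl⟩

/-- The relation of adjacency of blocks that is induced by a subset of `X × X`. -/
def blockRel {X : Type*} (b : X → ℕ) (F : Set (X × X)) (i j : ℕ) : Prop :=
  ∃ x y, b x = i ∧ b y = j ∧ (x, y) ∈ F

theorem blockRel_symm {F : Set (X × X)} (hF : Symm F) {i j : ℕ}
    (hij : blockRel b F i j) : blockRel b F j i := by
  obtain ⟨x, y, hx, hy, hxy⟩ := hij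
  exact ⟨y, x, hy, hx, symm_mem hF hxy⟩

/-- The union of the products of adjacent blocks. -/
theorem BlockMap.controlled_blockRel (hb : BlockMap μ b) {F : Set (X × X)} (hF : Controlled F) :
    Controlled {p : X × X | blockRel b F (b p.1) (b p.2)} := by
  refine subset_mem _ _ (comp_mem _ _ hb.controlled (comp_mem _ _ hF hb.controlled)) ?_
  rintro ⟨x, y⟩ ⟨x', y', hx, hy, hxy⟩
  exact ⟨x', hx.symm, y', hxy, hy⟩

theorem BlockMap.measRel (hb : BlockMap μ b) (R : ℕ → ℕ → Prop) :
    MeasRel {p : X × X | R (b p.1) (b p.2)} := by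
  intro U _
  have : nhd {p : X × X | R (b p.1) (b p.2)} U = b ⁻¹' {i | ∃ x ∈ U, R i (b x)} := rfl
  rw [this]
  exact hb.measurableSet_fiber _

/-- A block is adjacent to a bounded number of blocks. -/
theorem BlockMap.exists_degree_bound (h : Admissible μ) (hb : BlockMap μ b) {F : Set (X × X)}
    (hF : Controlled F) :
    ∃ N : ℕ, ∀ (i : ℕ) (s : Finset ℕ), (∀ j ∈ s, blockRel b F i j) → s.card ≤ N := by
  obtain ⟨ε, hε, hlow⟩ := hb.lower
  have hF' := hb.controlled_blockRel hF
  obtain ⟨C, hC⟩ := h.uniformlyBounded _ (comp_mem _ _ (inv_mem _ hF') hF')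
  obtain ⟨N, hN⟩ := exists_nat_gt (C / ε)
  refine ⟨N, fun i s hs => ?_⟩
  have h1 : ∑ j ∈ s, μ (b ⁻¹' {j}) ≤ C := by
    rw [← measure_biUnion_finset (fun i _ j _ hij => ?_) fun j _ => hb.measurableSet_fiber _]
    · refine hC _ (s.measurableSet_biUnion fun j _ => hb.measurableSet_fiber _) ?_
      rintro ⟨x, y⟩ ⟨hx, hy⟩
      simp only [Set.mem_iUnion, Set.mem_preimage, Set.mem_singleton_iff, exists_prop,
        exists_eq_right'] at hx hy
      -- Any point `z` of block `i` links all neighbouring blocks, so their union is bounded for the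
      -- controlled set fixed above.
      obtain ⟨z, -, hz, -⟩ := hs _ hx
      refine ⟨z, ?_, ?_⟩
      · show blockRel b F (b z) (b x)
        rw [hz]; exact hs _ hx
      · show blockRel b F (b z) (b y)
        rw [hz]; exact hs _ hy
    · exact Disjoint.preimage _ (by simpa using hij)
  have h2 : (s.card : ℝ≥0∞) * ε ≤ C := by
    refine le_trans ?_ h1
    rw [← nsmul_eq_mul]
    refine Finset.card_nsmul_le_sum _ _ _ fun j hj => ?_
    obtain ⟨x, y, -, hy, -⟩ := hs j hj
    rw [← hy]; exact hlow y
  have h3 : (s.card : ℝ≥0) * ε ≤ C := by exact_mod_cast h2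
  have h4 : (s.card : ℝ≥0) < N := ((le_div_iff₀ hε).2 h3).trans_lt hN
  exact_mod_cast h4.le

end Blocks

/-! ### Greedy colorings -/

/-- The greedy coloring of a relation on the natural numbers. -/
def greedyColor (S : ℕ → ℕ → Prop) (n : ℕ) : ℕ :=
  sInf {k | ∀ m, ∀ _ : m < n, S n m → greedyColor S m ≠ k}
termination_by n

/-- At most N earlier neighbours forbid colors, so one of N + 1 colors is free. This also makes the
set in `greedyColor` nonempty, so its infimum is attained and does not fall back to the default
value 0. -/
theorem exists_coloring {S : ℕ → ℕ → Prop} (hS : ∀ i j, S i j → S j i) {N : ℕ}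
    (hN : ∀ (i : ℕ) (s : Finset ℕ), (∀ j ∈ s, S i j) → s.card ≤ N) :
    ∃ c : ℕ → ℕ, (∀ n, c n < N + 1) ∧ ∀ i j, S i j → c i = c j → i = j := by
  classical
  have key : ∀ n, ∃ k < N + 1, ∀ m, ∀ _ : m < n, S n m → greedyColor S m ≠ k := by
    intro n
    let s := (Finset.range n).filter (S n)
    have hs : (s.image (greedyColor S)).card < (Finset.range (N + 1)).card := by
      rw [Finset.card_range]
      exact Nat.lt_succ_of_le (Finset.card_image_le.trans
        (hN n s fun j hj => (Finset.mem_filter.1 hj).2))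
    obtain ⟨k, hk, hk'⟩ := Finset.exists_mem_notMem_of_card_lt_card hs
    refine ⟨k, Finset.mem_range.1 hk, fun m hm hnm h => hk' ?_⟩
    exact Finset.mem_image.2 ⟨m, Finset.mem_filter.2 ⟨Finset.mem_range.2 hm, hnm⟩, h⟩
  have hspec : ∀ n, ∀ m < n, S n m → greedyColor S m ≠ greedyColor S n := by
    intro n
    obtain ⟨k, -, hk⟩ := key n
    have := Nat.sInf_mem (s := {k | ∀ m, ∀ _ : m < n, S n m → greedyColor S m ≠ k}) ⟨k, hk⟩
    intro m hm hnm
    rw [greedyColor.eq_1 S n]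
    exact this m hm hnm
  refine ⟨greedyColor S, fun n => ?_, fun i j hij hc => ?_⟩
  · obtain ⟨k, hkN, hk⟩ := key n
    rw [greedyColor]
    exact (Nat.sInf_le (s := {k | ∀ m, ∀ _ : m < n, S n m → greedyColor S m ≠ k}) hk).trans_lt hkN
  · rcases lt_trichotomy i j with hlt | rfl | hlt
    · exact absurd hc (hspec j i hlt (hS _ _ hij))
    · rfl
    · exact absurd hc.symm (hspec i j hlt hij)

end

end CoarseAmenable

namespace CoarseAmenable

noncomputable section

open CoarseSpace

/-- The bounded operators on `L² X`. -/
abbrev Op {X : Type u} [MeasurableSpace X] (μ : Measure X) : Type u := Lp ℂ 2 μ →L[ℂ] Lp ℂ 2 μ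

/-! ### Square roots, and algebraic positivity in arbitrary representations -/

section Hilbert

variable {H : Type*} [NormedAddCommGroup H] [InnerProductSpace ℂ H] [CompleteSpace H]

/-- The commutation clause is what matters: support on an equivalence relation is a commutation
property by `supportedOn_iff_commute`, hence is inherited by the square root. -/
theorem exists_sqrt {S : H →L[ℂ] H} (hS : 0 ≤ S) :
    ∃ R : H →L[ℂ] H, S = star R * R ∧ ∀ B, Commute S B → Commute R B := by
  refine ⟨CFC.sqrt S, ?_, fun B hB => hB.cfcₙ_nnreal _⟩
  rw [(IsSelfAdjoint.of_nonneg (CFC.sqrt_nonneg S)).star_eq, CFC.sqrt_mul_sqrt_self _ hS]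

theorem star_mul_self_le_norm_sq (T : H →L[ℂ] H) :
    0 ≤ algebraMap ℂ (H →L[ℂ] H) ((‖T‖ ^ 2 : ℝ) : ℂ) - star T * T :=
  sub_nonneg.2 CStarAlgebra.star_mul_le_algebraMap_norm_sq

end Hilbert

section Rep

variable {A : Type u} [Ring A] [StarRing A] [Algebra ℂ A] (r : Rep A)

theorem Rep.map_mul_apply (S T : A) (v : r.H) : r.ρ (S * T) v = r.ρ S (r.ρ T v) := by
  rw [map_mul]; rfl

theorem Rep.map_one_apply (v : r.H) : r.ρ 1 v = v := by
  rw [map_one]; rfl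

theorem Rep.map_add_apply (S T : A) (v : r.H) : r.ρ (S + T) v = r.ρ S v + r.ρ T v := by
  rw [map_add]; rfl

theorem Rep.map_sub_apply (S T : A) (v : r.H) : r.ρ (S - T) v = r.ρ S v - r.ρ T v := by
  rw [map_sub]; rfl

theorem Rep.map_smul_apply (c : ℂ) (T : A) (v : r.H) : r.ρ (c • T) v = c • r.ρ T v := by
  rw [map_smul]; rfl

theorem Rep.map_algebraMap_apply (c : ℂ) (v : r.H) : r.ρ (algebraMap ℂ A c) v = c • v := by
  rw [Algebra.algebraMap_eq_smul_one, r.map_smul_apply, r.map_one_apply]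

theorem Rep.inner_map_star (T : A) (v w : r.H) :
    inner ℂ v (r.ρ (star T) w) = inner ℂ (r.ρ T v) w := by
  rw [map_star, ContinuousLinearMap.star_eq_adjoint, ContinuousLinearMap.adjoint_inner_right]

theorem Rep.re_inner_star_mul_self_nonneg (R : A) (v : r.H) :
    0 ≤ (inner ℂ v (r.ρ (star R * R) v)).re := by
  rw [r.map_mul_apply, r.inner_map_star]
  exact inner_self_nonneg (𝕜 := ℂ)

/-- Representations are not assumed continuous, so norm bounds need a certificate inside the
algebra. The identity c² - T*T = R*R is preserved by every *-homomorphism and gives ‖ρ(T)v‖² ≤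
c²‖v‖². -/
theorem Rep.norm_le_of_eq {T R : A} {c : ℝ} (hc : 0 ≤ c)
    (h : algebraMap ℂ A ((c ^ 2 : ℝ) : ℂ) - star T * T = star R * R) : ‖r.ρ T‖ ≤ c := by
  refine ContinuousLinearMap.opNorm_le_bound _ hc fun v => ?_
  have h1 := r.re_inner_star_mul_self_nonneg R v
  rw [← h, r.map_sub_apply, r.map_algebraMap_apply, r.map_mul_apply, inner_sub_right,
    r.inner_map_star, inner_smul_right, inner_self_eq_norm_sq_to_K,
    inner_self_eq_norm_sq_to_K] at h1
  have h2 : ‖r.ρ T v‖ ^ 2 ≤ (c * ‖v‖) ^ 2 := by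
    have h3 : ((((c ^ 2 : ℝ) : ℂ) * (‖v‖ : ℂ) ^ 2 - (‖r.ρ T v‖ : ℂ) ^ 2)).re =
        c ^ 2 * ‖v‖ ^ 2 - ‖r.ρ T v‖ ^ 2 := by
      norm_cast
    have h4 : 0 ≤ c ^ 2 * ‖v‖ ^ 2 - ‖r.ρ T v‖ ^ 2 := h3 ▸ h1
    rw [mul_pow]; linarith
  exact (abs_le_of_sq_le_sq' h2 (by positivity)).2

end Rep

/-! ### Multiplication operators -/

section Multiplication

variable {X : Type u} [CoarseSpace X] [MeasurableSpace X] {μ : Measure X}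

theorem op_ext {S T : Op μ} (h : ∀ ξ, S ξ =ᵐ[μ] T ξ) : S = T :=
  ContinuousLinearMap.ext fun ξ => Lp.ext (h ξ)

theorem inner_eq_integral (ξ η : Lp ℂ 2 μ) : inner ℂ ξ η = ∫ x, inner ℂ (ξ x) (η x) ∂μ :=
  L2.inner_def _ _

theorem mulOp_mul {f g k : Lp ℂ ∞ μ} (hk : k =ᵐ[μ] fun x => f x * g x) :
    mulOp μ f * mulOp μ g = mulOp μ k := by
  refine op_ext fun ξ => ?_
  show mulOp μ f (mulOp μ g ξ) =ᵐ[μ] _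
  filter_upwards [mulOp_apply f (mulOp μ g ξ), mulOp_apply g ξ, mulOp_apply k ξ, hk]
    with x h1 h2 h3 h4
  rw [h1, h2, h3, h4, mul_assoc]

theorem mulOp_add (f g : Lp ℂ ∞ μ) : mulOp μ (f + g) = mulOp μ f + mulOp μ g := by
  simp [mulOp]

theorem mulOp_smul (c : ℂ) (f : Lp ℂ ∞ μ) : mulOp μ (c • f) = c • mulOp μ f := by
  simp [mulOp]

theorem mulOp_zero : mulOp μ (0 : Lp ℂ ∞ μ) = 0 := by
  simp [mulOp]

theorem mulOp_eq_one {f : Lp ℂ ∞ μ} (hf : f =ᵐ[μ] fun _ => 1) : mulOp μ f = 1 := by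
  refine op_ext fun ξ => ?_
  filter_upwards [mulOp_apply f ξ, hf] with x h1 h2
  rw [h1, h2, one_mul]; rfl

theorem star_mulOp {f g : Lp ℂ ∞ μ} (hg : g =ᵐ[μ] fun x => star (f x)) :
    star (mulOp μ f) = mulOp μ g := by
  rw [ContinuousLinearMap.star_eq_adjoint]
  symm
  rw [ContinuousLinearMap.eq_adjoint_iff]
  intro ξ η
  rw [inner_eq_integral, inner_eq_integral]
  refine integral_congr_ae ?_
  filter_upwards [mulOp_apply f η, mulOp_apply g ξ, hg] with x h1 h2 h3
  rw [h1, h2, h3]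
  simp only [RCLike.inner_apply, map_mul, RCLike.star_def, RCLike.conj_conj]
  ring

/-- The indicator function of a measurable set, as an element of `L^∞ X`. -/
def ind (μ : Measure X) (U : Set X) (hU : MeasurableSet U) : Lp ℂ ∞ μ :=
  ((memLp_top_const (1 : ℂ)).indicator hU).toLp

theorem coeFn_ind (U : Set X) (hU : MeasurableSet U) :
    ind μ U hU =ᵐ[μ] U.indicator fun _ => (1 : ℂ) := MemLp.coeFn_toLp _

theorem mulOp_ind_apply (U : Set X) (hU : MeasurableSet U) (ξ : Lp ℂ 2 μ) :
    mulOp μ (ind μ U hU) ξ =ᵐ[μ] U.indicator ξ := by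
  filter_upwards [mulOp_apply (ind μ U hU) ξ, coeFn_ind U hU] with x h1 h2
  rw [h1, h2]
  by_cases hx : x ∈ U
  · simp [hx]
  · simp [hx]

theorem mulOp_ind_eq_self {U : Set X} (hU : MeasurableSet U) {ξ : Lp ℂ 2 μ}
    (hξ : ∀ᵐ x ∂μ, x ∉ U → ξ x = 0) : mulOp μ (ind μ U hU) ξ = ξ := by
  refine Lp.ext ?_
  filter_upwards [mulOp_ind_apply U hU ξ, hξ] with x h1 h2
  rw [h1]
  by_cases hx : x ∈ U
  · simp [hx]
  · simp [hx, h2 hx]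

theorem mulOp_ind_eq_zero {U : Set X} (hU : MeasurableSet U) {ξ : Lp ℂ 2 μ}
    (hξ : ∀ᵐ x ∂μ, x ∈ U → ξ x = 0) : mulOp μ (ind μ U hU) ξ = 0 := by
  refine Lp.ext ?_
  filter_upwards [mulOp_ind_apply U hU ξ, hξ, Lp.coeFn_zero ℂ 2 μ] with x h1 h2 h3
  rw [h1, h3]
  by_cases hx : x ∈ U
  · simp [hx, h2 hx]
  · simp [hx]

theorem star_mulOp_ind (U : Set X) (hU : MeasurableSet U) :
    star (mulOp μ (ind μ U hU)) = mulOp μ (ind μ U hU) := by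
  refine star_mulOp ?_
  filter_upwards [coeFn_ind (μ := μ) U hU] with x h1
  rw [h1]
  by_cases hx : x ∈ U
  · simp [hx]
  · simp [hx]

end Multiplication

/-! ### Supports of products and adjoints; operators supported on an equivalence relation -/

section Support

variable {X : Type u} [CoarseSpace X] [MeasurableSpace X] {μ : Measure X}

theorem SupportedOn.mul {E F : Set (X × X)} {hE : MeasRel E} {hF : MeasRel F} {S T : Op μ}
    (hS : SupportedOn E hE S) (hT : SupportedOn F hF T) (hFE : MeasRel (comp F E)) :
    SupportedOn (comp F E) hFE (S * T) := by
  rw [supportedOn_iff] at hS hT ⊢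
  intro U hU η hη
  rw [nhd_comp] at hη
  exact hS U hU _ (hT _ (hE U hU) η hη)

theorem SupportedOn.star {E : Set (X × X)} {hE : MeasRel E} {T : Op μ} (hT : SupportedOn E hE T)
    (hE' : MeasRel (inv E)) : SupportedOn (inv E) hE' (star T) := by
  rw [supportedOn_iff] at hT
  intro U hU ξ η hξ
  rw [ContinuousLinearMap.star_eq_adjoint, ContinuousLinearMap.adjoint_inner_right,
    ContinuousLinearMap.adjoint_inner_right, ← sub_eq_zero, ← inner_sub_right]
  have hV : MeasurableSet (nhd (inv E) U)ᶜ := (hE' U hU).compl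
  have h1 : ∀ᵐ x ∂μ, x ∈ (nhd (inv E) U)ᶜ → (T ξ) x = 0 := by
    refine hT _ hV ξ ?_
    filter_upwards [hξ] with x hx
    rintro ⟨y, hy, hxy⟩
    exact hx fun hxU => hy ⟨x, hxU, hxy⟩
  refine inner_eq_zero (U := nhd (inv E) U) h1 ?_
  filter_upwards [Lp.coeFn_sub η (cut (nhd (inv E) U) (hE' U hU) η),
    coeFn_cut (nhd (inv E) U) (hE' U hU) η] with x h1 h2 hx
  rw [h1, Pi.sub_apply, h2, Set.indicator_of_mem hx, sub_self]

theorem ae_eq_zero_of_mulOp_ind {U : Set X} (hU : MeasurableSet U) {ξ : Lp ℂ 2 μ}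
    (h : mulOp μ (ind μ U hU) ξ = 0) : ∀ᵐ x ∂μ, x ∈ U → ξ x = 0 := by
  filter_upwards [mulOp_ind_apply U hU ξ, Lp.coeFn_zero ℂ 2 μ] with x h1 h2 hx
  rw [h, h2, Set.indicator_of_mem hx] at h1
  exact h1.symm

/-- An operator is supported on a measurable equivalence relation if and only if it commutes with
the indicator functions of the saturated sets. -/
theorem supportedOn_iff_commute {E : Set (X × X)} (hE : MeasRel E) (hd : diag X ⊆ E)
    (hs : Symm E) (ht : comp E E ⊆ E) {T : Op μ} :
    SupportedOn E hE T ↔ ∀ (W : Set X) (hW : MeasurableSet W), nhd E W = W →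
      Commute T (mulOp μ (ind μ W hW)) := by
  rw [supportedOn_iff]
  constructor
  · intro hT W hW hEW
    have hEW' : nhd E Wᶜ = Wᶜ := by
      ext y
      constructor
      · rintro ⟨x, hx, hxy⟩ hy
        exact hx (hEW ▸ ⟨y, hy, symm_mem hs hxy⟩)
      · intro hy; exact ⟨y, hy, hd rfl⟩
    refine ContinuousLinearMap.ext fun ξ => ?_
    show T (mulOp μ (ind μ W hW) ξ) = mulOp μ (ind μ W hW) (T ξ)
    have h1 : mulOp μ (ind μ W hW) (T (mulOp μ (ind μ W hW) ξ)) =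
        T (mulOp μ (ind μ W hW) ξ) := by
      refine mulOp_ind_eq_self hW ?_
      refine hT Wᶜ hW.compl _ ?_
      rw [hEW']
      filter_upwards [mulOp_ind_apply W hW ξ] with x hx hxW
      rw [hx, Set.indicator_of_notMem hxW]
    have h2 : mulOp μ (ind μ W hW) (T (ξ - mulOp μ (ind μ W hW) ξ)) = 0 := by
      refine mulOp_ind_eq_zero hW (hT W hW _ ?_)
      rw [hEW]
      filter_upwards [mulOp_ind_apply W hW ξ, Lp.coeFn_sub ξ (mulOp μ (ind μ W hW) ξ)]
        with x h1 h2 hx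
      rw [h2, Pi.sub_apply, h1, Set.indicator_of_mem hx, sub_self]
    rw [map_sub, map_sub, sub_eq_zero] at h2
    rw [h2, h1]
  · intro hT U hU η hη
    have hW : nhd E (nhd E U) = nhd E U := by
      rw [← nhd_comp]
      ext y
      constructor
      · rintro ⟨x, hx, hxy⟩; exact ⟨x, hx, ht hxy⟩
      · rintro ⟨x, hx, hxy⟩; exact ⟨x, hx, x, hxy, hd rfl⟩
    have h1 : mulOp μ (ind μ _ (hE U hU)) (T η) = T (mulOp μ (ind μ _ (hE U hU)) η) :=
      (DFunLike.congr_fun (hT _ (hE U hU) hW).eq η).symm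
    rw [mulOp_ind_eq_zero _ hη, map_zero] at h1
    filter_upwards [ae_eq_zero_of_mulOp_ind _ h1] with x hx hxU
    exact hx ⟨x, hxU, hd rfl⟩

end Support

section Positivity

variable {X : Type u} [CoarseSpace X] [MeasurableSpace X] [MeasurableSingletonClass X]
  {μ : Measure X} {h : Admissible μ}

/-- The operators supported on a fixed controlled equivalence relation are a commutant, hence closed
under square roots. For them operator positivity becomes positivity within the *-algebra, which
every representation respects. -/
theorem exists_star_mul_self_of_supportedOn {E : Set (X × X)} {hE : MeasRel E} (hc : Controlled E)
    (hd : diag X ⊆ E) (hs : Symm E) (ht : comp E E ⊆ E) {S : Ccs h}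
    (hS : SupportedOn E hE (S : Op μ)) (hpos : 0 ≤ (S : Op μ)) :
    ∃ R : Ccs h, S = star R * R := by
  obtain ⟨R, hR, hcomm⟩ := exists_sqrt hpos
  have hsqrt : SupportedOn E hE R := by
    rw [supportedOn_iff_commute hE hd hs ht] at hS ⊢
    exact fun W hW hEW => hcomm _ (hS W hW hEW)
  exact ⟨⟨R, E, hE, hc, hsqrt⟩, Subtype.ext hR⟩

theorem Rep.norm_le_of_supportedOn {E : Set (X × X)} {hE : MeasRel E} (hc : Controlled E)
    (hd : diag X ⊆ E) (hs : Symm E) (ht : comp E E ⊆ E) {T : Ccs h}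
    (hT : SupportedOn E hE (star (T : Op μ) * (T : Op μ))) (r : Rep (Ccs h)) :
    ‖r.ρ T‖ ≤ ‖(T : Op μ)‖ := by
  have h1 : SupportedOn E hE (algebraMap ℂ (Op μ) ((‖(T : Op μ)‖ ^ 2 : ℝ) : ℂ) -
      star (T : Op μ) * (T : Op μ)) := by
    rw [supportedOn_iff_commute hE hd hs ht] at hT ⊢
    exact fun W hW hEW => (Algebra.commute_algebraMap_left _ _).sub_left (hT W hW hEW)
  have hex := exists_star_mul_self_of_supportedOn hc hd hs ht
    (S := algebraMap ℂ (Ccs h) ((‖(T : Op μ)‖ ^ 2 : ℝ) : ℂ) - star T * T) h1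
    (star_mul_self_le_norm_sq _)
  obtain ⟨R, hR⟩ := hex
  exact r.norm_le_of_eq (norm_nonneg _) hR

end Positivity

end

end CoarseAmenable

namespace CoarseAmenable

noncomputable section

open CoarseSpace

/-! ### Finiteness of the maximal norm -/

section MaxNorm

variable {X : Type u} [CoarseSpace X] [MeasurableSpace X] {μ : Measure X} {b : X → ℕ}

/-- A coloring of the blocks by finitely many colors such that blocks with a common neighbour have
different colors. -/
theorem BlockMap.exists_coloring (h : Admissible μ) (hb : BlockMap μ b) {F : Set (X × X)}
    (hF : Controlled F) (hs : Symm F) :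
    ∃ (c : ℕ → ℕ) (N : ℕ), (∀ n, c n < N) ∧
      ∀ i j k, blockRel b F i k → blockRel b F j k → c i = c j → i = j := by
  obtain ⟨N, hN⟩ := hb.exists_degree_bound h
    (comp_mem _ _ hF (comp_mem _ _ hb.controlled hF))
  obtain ⟨c, hc, hcol⟩ := CoarseAmenable.exists_coloring
    (S := fun i j => ∃ k, blockRel b F i k ∧ blockRel b F j k)
    (fun i j ⟨k, h1, h2⟩ => ⟨k, h2, h1⟩) (N := N) fun i s hsub => hN i s fun j hj => by
      obtain ⟨k, ⟨x, z, hx, hz, hxz⟩, ⟨y, z', hy, hz', hyz⟩⟩ := hsub j hj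
      exact ⟨x, y, hx, hy, z, hxz, z', hz.trans hz'.symm, symm_mem hs hyz⟩
  exact ⟨c, N + 1, hc, fun i j k h1 h2 => hcol i j ⟨k, h1, h2⟩⟩

theorem sum_mulOp_ind {s : ℕ → Set X} (hs : ∀ n, MeasurableSet (s n)) (hd : Pairwise fun i j =>
    Disjoint (s i) (s j)) (N : ℕ) (hcov : ∀ x, ∃ n < N, x ∈ s n) :
    ∑ n ∈ Finset.range N, mulOp μ (ind μ (s n) (hs n)) = 1 := by
  have key : ∀ N, ∑ n ∈ Finset.range N, mulOp μ (ind μ (s n) (hs n)) =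
      mulOp μ (ind μ (⋃ n ∈ Finset.range N, s n)
        (Finset.measurableSet_biUnion _ fun n _ => hs n)) := by
    intro N
    induction N with
    | zero =>
      symm
      refine op_ext fun ξ => ?_
      filter_upwards [mulOp_ind_apply _ (Finset.measurableSet_biUnion (Finset.range 0)
        fun n _ => hs n) ξ, Lp.coeFn_zero ℂ 2 μ] with x h1 h2
      rw [h1]; simpa using h2.symm
    | succ N ih =>
      rw [Finset.sum_range_succ, ih, ← mulOp_add]
      refine op_ext fun ξ => ?_
      filter_upwards [mulOp_apply (ind μ (⋃ n ∈ Finset.range N, s n)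
          (Finset.measurableSet_biUnion _ fun n _ => hs n) + ind μ (s N) (hs N)) ξ,
        mulOp_ind_apply _ (Finset.measurableSet_biUnion (Finset.range (N + 1)) fun n _ => hs n) ξ,
        Lp.coeFn_add (ind μ (⋃ n ∈ Finset.range N, s n)
          (Finset.measurableSet_biUnion _ fun n _ => hs n)) (ind μ (s N) (hs N)),
        coeFn_ind (μ := μ) (⋃ n ∈ Finset.range N, s n)
          (Finset.measurableSet_biUnion _ fun n _ => hs n),
        coeFn_ind (μ := μ) (s N) (hs N)] with x h1 h2 h3 h4 h5
      rw [h1, h2, h3, Pi.add_apply, h4, h5]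
      have hsub : (⋃ n ∈ Finset.range (N + 1), s n) = (⋃ n ∈ Finset.range N, s n) ∪ s N := by
        ext y
        simp only [Set.mem_iUnion, Set.mem_union, Finset.mem_range, exists_prop]
        constructor
        · rintro ⟨n, hn, hy⟩
          rcases Nat.lt_succ_iff_lt_or_eq.1 hn with h | rfl
          · exact Or.inl ⟨n, h, hy⟩
          · exact Or.inr hy
        · rintro (⟨n, hn, hy⟩ | hy)
          · exact ⟨n, hn.trans (Nat.lt_succ_self N), hy⟩
          · exact ⟨N, Nat.lt_succ_self N, hy⟩
      have hdis : Disjoint (⋃ n ∈ Finset.range N, s n) (s N) := by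
        refine Set.disjoint_iUnion₂_left.2 fun n hn => hd ?_
        exact (Finset.mem_range.1 hn).ne
      rw [hsub]
      by_cases hx : x ∈ s N
      · have : x ∉ ⋃ n ∈ Finset.range N, s n := fun h => Set.disjoint_left.1 hdis h hx
        rw [Set.indicator_of_notMem this, Set.indicator_of_mem hx,
          Set.indicator_of_mem (Set.mem_union_right _ hx), zero_add, one_mul]
      · by_cases hx' : x ∈ ⋃ n ∈ Finset.range N, s n
        · rw [Set.indicator_of_mem hx', Set.indicator_of_notMem hx,
            Set.indicator_of_mem (Set.mem_union_left _ hx'), add_zero, one_mul]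
        · rw [Set.indicator_of_notMem hx', Set.indicator_of_notMem hx,
            Set.indicator_of_notMem (fun h => h.elim hx' hx), add_zero, zero_mul]
  rw [key]
  refine mulOp_eq_one ?_
  filter_upwards [coeFn_ind (μ := μ) (⋃ n ∈ Finset.range N, s n)
    (Finset.measurableSet_biUnion _ fun n _ => hs n)] with x h1
  obtain ⟨n, hn, hx⟩ := hcov x
  rw [h1, Set.indicator_of_mem]
  exact Set.mem_biUnion (Finset.mem_range.2 hn) hx

theorem maxNorm_lt_top_of_bound {A : Type u} [Ring A] [StarRing A] [Algebra ℂ A] {a : A} {C : ℝ}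
    (hC : ∀ r : Rep A, ‖r.ρ a‖ ≤ C) : maxNorm a < ∞ := by
  refine lt_of_le_of_lt (iSup_le fun r => ?_) (ENNReal.ofReal_lt_top (r := C))
  rw [← ofReal_norm]
  exact ENNReal.ofReal_le_ofReal (hC r)

theorem Rep.norm_le_maxNorm {A : Type u} [Ring A] [StarRing A] [Algebra ℂ A] {a : A}
    (ha : maxNorm a < ∞) (r : Rep A) : ‖r.ρ a‖ ≤ (maxNorm a).toReal := by
  rw [← toReal_enorm]
  exact ENNReal.toReal_mono ha.ne (le_iSup (fun r : Rep A => ‖r.ρ a‖ₑ) r)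

/-- Cut T into the finitely many pieces T P_a, where P_a projects onto the blocks of color a. The
operator (T P_a)*(T P_a) connects only blocks of color a with a common neighbour; such blocks
coincide, so it is block diagonal and `Rep.norm_le_of_supportedOn` applies to T P_a. -/
theorem Ccs.maxNorm_lt_top [MeasurableSingletonClass X] {h : Admissible μ} (T : Ccs h) :
    maxNorm T < ∞ := by
  obtain ⟨b, hb⟩ := h.exists_blockMap
  obtain ⟨E, hE, hEc, hT⟩ := T.2
  obtain ⟨F, hFc, hFs, hFm, hEF⟩ := h.exists_symm hEc
  replace hT := hT.mono hFm hEF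
  obtain ⟨c, N, hcN, hc⟩ := hb.exists_coloring h hFc hFs
  have hm : ∀ a, MeasurableSet (b ⁻¹' (c ⁻¹' {a})) := fun a => hb.measurableSet_fiber _
  have hsum : ∑ a ∈ Finset.range N, mulOp μ (ind μ _ (hm a)) = 1 := by
    refine sum_mulOp_ind hm (fun i j hij => ?_) N fun x => ⟨c (b x), hcN _, rfl⟩
    exact Disjoint.preimage _ (Disjoint.preimage _ (by simpa using hij))
  have hsum' : T = ∑ a ∈ Finset.range N, T * mulCs h (ind μ _ (hm a)) := by
    rw [← Finset.mul_sum]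
    have : ∑ a ∈ Finset.range N, mulCs h (ind μ _ (hm a)) = 1 :=
      Subtype.ext (by rw [AddSubmonoidClass.coe_finsetSum]; exact hsum)
    rw [this, mul_one]
  suffices hsuff : ∀ a, maxNorm (T * mulCs h (ind μ _ (hm a))) < ∞ by
    have : T ∈ finiteMax (Ccs h) := by
      rw [hsum']
      exact Subalgebra.sum_mem _ fun a _ => hsuff a
    exact this
  intro a
  let D : Set (X × X) := {p | b p.1 = b p.2 ∧ c (b p.2) = a}
  have hD : MeasRel D := hb.measRel fun i j => i = j ∧ c j = a
  have hP : SupportedOn D hD (mulOp μ (ind μ _ (hm a))) := by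
    rw [supportedOn_iff]
    intro U hU η hη
    filter_upwards [hη, mulOp_ind_apply _ (hm a) η] with x h1 h2 hx
    rw [h2]
    by_cases hxa : x ∈ b ⁻¹' (c ⁻¹' {a})
    · rw [Set.indicator_of_mem hxa, h1 ⟨x, hx, rfl, hxa⟩]
    · rw [Set.indicator_of_notMem hxa]
  have hFi : MeasRel (inv F) := by
    have : inv F = F := hFs
    rw [this]; exact hFm
  have hc1 : MeasRel (comp D F) := fun U hU => by rw [nhd_comp]; exact hD _ (hFm U hU)
  have hc2 : MeasRel (comp (inv F) D) := fun U hU => by rw [nhd_comp]; exact hFi _ (hD U hU)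
  have hc3 : MeasRel (comp (comp D F) (comp (inv F) D)) := fun U hU => by
    rw [nhd_comp]; exact hc1 _ (hc2 U hU)
  have h1 := hT.mul hP hc1
  have h2 := hP.mul (hT.star hFi) hc2
  have h3 := h2.mul h1 hc3
  have hE' : MeasRel {p : X × X | b p.1 = b p.2} := hb.measRel fun i j => i = j
  -- Both ends are blocks of color `a` adjacent to the block of `z`, hence the same block.
  have h4 := h3.mono hE' (by
    rintro ⟨x, y⟩ ⟨z, ⟨x', ⟨hx, hxa⟩, hxz⟩, ⟨y', hzy, ⟨hy, hya⟩⟩⟩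
    have hx : b x = b x' := hx
    have hy : b y' = b y := hy
    have hxa : c (b x') = a := hxa
    have hya : c (b y) = a := hya
    have hzy : (y', z) ∈ F := hzy
    show b x = b y
    rw [hx]
    refine hc _ _ (b z) ⟨x', z, rfl, rfl, hxz⟩ ⟨y', z, hy, rfl, hzy⟩ ?_
    rw [hxa, hya])
  refine maxNorm_lt_top_of_bound
    (C := ‖((T * mulCs h (ind μ _ (hm a)) : Ccs h) : Op μ)‖) fun r => ?_
  refine Rep.norm_le_of_supportedOn (T := T * mulCs h (ind μ _ (hm a))) (hE := hE')
    hb.controlled (fun p hp => congrArg b hp) ?_ ?_ ?_ r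
  · ext p; exact eq_comm
  · rintro ⟨x, y⟩ ⟨z, h1, h2⟩; exact Eq.trans h1 h2
  · have : star ((T * mulCs h (ind μ _ (hm a)) : Ccs h) : Op μ) =
        mulOp μ (ind μ _ (hm a)) * star (T : Op μ) := by
      show star ((T : Op μ) * mulOp μ (ind μ _ (hm a))) = _
      rw [star_mul, star_mulOp_ind]
    rw [this]
    exact h4

end MaxNorm

end

end CoarseAmenable

namespace CoarseAmenable

noncomputable section

open CoarseSpace

/-! ### Bounded sets, locally square integrable functions and the map Φ -/

section Local

variable {X : Type u} [CoarseSpace X] [MeasurableSpace X] {μ : Measure X}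

theorem Bounded.nhd {F : Set (X × X)} (hF : Controlled F) {U : Set X} (hU : Bounded U) :
    Bounded (nhd F U) := by
  refine subset_mem _ _ (comp_mem _ _ (comp_mem _ _ hF hU) (inv_mem _ hF)) ?_
  rintro ⟨x, y⟩ ⟨⟨x', hx', hxx'⟩, ⟨y', hy', hyy'⟩⟩
  exact ⟨y', ⟨x', hxx', hx', hy'⟩, hyy'⟩

/-- Connectedness of X is used only here: a single controlled pair (u, v) links the two sets. -/
theorem Bounded.union (hX : Connected X) {U V : Set X} (hU : Bounded U) (hV : Bounded V) :
    Bounded (U ∪ V) := by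
  rcases U.eq_empty_or_nonempty with rfl | ⟨u, hu⟩
  · rwa [Set.empty_union]
  rcases V.eq_empty_or_nonempty with rfl | ⟨v, hv⟩
  · rwa [Set.union_empty]
  have h1 : Controlled (comp (U ×ˢ U) (comp {(u, v)} (V ×ˢ V))) :=
    comp_mem _ _ hU (comp_mem _ _ (hX u v) hV)
  refine subset_mem _ _ (union_mem _ _ (union_mem _ _ hU hV) (union_mem _ _ h1 (inv_mem _ h1))) ?_
  rintro ⟨x, y⟩ ⟨hx | hx, hy | hy⟩
  · exact Or.inl (Or.inl ⟨hx, hy⟩)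
  · exact Or.inr (Or.inl ⟨u, ⟨hx, hu⟩, v, rfl, ⟨hv, hy⟩⟩)
  · exact Or.inr (Or.inr ⟨u, ⟨hy, hu⟩, v, rfl, ⟨hv, hx⟩⟩)
  · exact Or.inl (Or.inr ⟨hx, hy⟩)

theorem LocL2.memLp_indicator {f : X → ℂ} (hf : LocL2 μ f) {U : Set X} (hU : MeasurableSet U)
    (hb : Bounded U) : MemLp (U.indicator f) 2 μ :=
  (memLp_indicator_iff_restrict hU).2 (hf.2 U hU hb)

theorem locL2_of_memLp_top (h : Admissible μ) {f : X → ℂ} (hf : MemLp f ∞ μ) : LocL2 μ f := by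
  refine ⟨hf.1, fun U hU hb => ?_⟩
  have : IsFiniteMeasure (μ.restrict U) := ⟨by
    rw [Measure.restrict_apply_univ]; exact h.measure_lt_top hU hb⟩
  exact (hf.restrict U).mono_exponent le_top

theorem integral_inner_eq {U : Set X} {ξ η : Lp ℂ 2 μ} {f : X → ℂ}
    (hξ : ∀ᵐ x ∂μ, x ∉ U → ξ x = 0) (hη : ∀ᵐ x ∂μ, x ∈ U → η x = f x) :
    ∫ x, inner ℂ (ξ x) (f x) ∂μ = inner ℂ ξ η := by
  rw [inner_eq_integral]
  refine integral_congr_ae ?_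
  filter_upwards [hξ, hη] with x h1 h2
  by_cases hx : x ∈ U
  · rw [h2 hx]
  · rw [h1 hx, inner_zero_left, inner_zero_left]

theorem integrable_inner {ξ : Lp ℂ 2 μ} (hξ : BddSupport ξ) {f : X → ℂ} (hf : LocL2 μ f) :
    Integrable (fun x => inner ℂ (ξ x) (f x)) μ := by
  obtain ⟨U, hU, hb, hξ⟩ := hξ
  have h1 := L2.integrable_inner (𝕜 := ℂ) ξ ((hf.memLp_indicator hU hb).toLp)
  refine h1.congr ?_
  filter_upwards [hξ, (hf.memLp_indicator hU hb).coeFn_toLp] with x h1 h2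
  rw [h2]
  by_cases hx : x ∈ U
  · rw [Set.indicator_of_mem hx]
  · rw [h1 hx, inner_zero_left, inner_zero_left]

theorem ae_eq_zero_of_symm_support {F : Set (X × X)} {hFm : MeasRel F} (hFs : Symm F) {T : Op μ}
    (hT : SupportedOn F hFm T) {U : Set X} (hU : MeasurableSet U) {ξ : Lp ℂ 2 μ}
    (hξ : ∀ᵐ x ∂μ, x ∉ U → ξ x = 0) : ∀ᵐ x ∂μ, x ∉ nhd F U → T ξ x = 0 := by
  rw [supportedOn_iff] at hT
  refine hT (nhd F U)ᶜ (hFm U hU).compl ξ ?_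
  filter_upwards [hξ] with x hx
  rintro ⟨y, hy, hxy⟩
  exact hx fun hxU => hy ⟨x, hxU, symm_mem hFs hxy⟩

theorem star_supportedOn_symm {F : Set (X × X)} {hFm : MeasRel F} (hFs : Symm F) {T : Op μ}
    (hT : SupportedOn F hFm T) : SupportedOn F hFm (star T) := by
  have hi : MeasRel (inv F) := by rw [show inv F = F from hFs]; exact hFm
  exact (hT.star hi).mono hFm (by rw [show inv F = F from hFs])

variable [MeasurableSingletonClass X] {h : Admissible μ}

theorem exists_symm_support (T : Ccs h) : ∃ (F : Set (X × X)) (hFm : MeasRel F),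
    Controlled F ∧ Symm F ∧ SupportedOn F hFm (T : Op μ) := by
  obtain ⟨E, hE, hEc, hT⟩ := T.2
  obtain ⟨F, hFc, hFs, hFm, hEF⟩ := h.exists_symm hEc
  exact ⟨F, hFm, hFc, hFs, hT.mono hFm hEF⟩

theorem BddSupport.map (T : Ccs h) {ξ : Lp ℂ 2 μ} (hξ : BddSupport ξ) :
    BddSupport ((T : Op μ) ξ) := by
  obtain ⟨F, hFm, hFc, hFs, hT⟩ := exists_symm_support T
  obtain ⟨U, hU, hb, hξ⟩ := hξ
  exact ⟨nhd F U, hFm U hU, hb.nhd hFc, ae_eq_zero_of_symm_support hFs hT hU hξ⟩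

theorem LocMapsTo.comp {S T : Ccs h} {f g k : X → ℂ} (hT : LocMapsTo T f g)
    (hS : LocMapsTo S g k) : LocMapsTo (S * T) f k := by
  refine ⟨hT.1, hS.2.1, fun ξ hξ => ?_⟩
  have hξ' : BddSupport (star (S : Op μ) ξ) := hξ.map (star S)
  rw [hS.2.2 ξ hξ, hT.2.2 _ hξ']
  have : star ((S * T : Ccs h) : Op μ) = star (T : Op μ) * star (S : Op μ) := star_mul _ _
  rw [this]
  rfl

theorem LocMapsTo.add {S T : Ccs h} {f g k : X → ℂ} (hS : LocMapsTo S f g)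
    (hT : LocMapsTo T f k) : LocMapsTo (S + T) f (g + k) := by
  refine ⟨hT.1, ⟨hS.2.1.1.add hT.2.1.1, fun U hU hb => (hS.2.1.2 U hU hb).add (hT.2.1.2 U hU hb)⟩,
    fun ξ hξ => ?_⟩
  have hξS : BddSupport (star (S : Op μ) ξ) := hξ.map (star S)
  have hξT : BddSupport (star (T : Op μ) ξ) := hξ.map (star T)
  have : star ((S + T : Ccs h) : Op μ) ξ = star (S : Op μ) ξ + star (T : Op μ) ξ := by
    rw [show star ((S + T : Ccs h) : Op μ) = star (S : Op μ) + star (T : Op μ) from star_add _ _]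
    rfl
  rw [this]
  simp only [Pi.add_apply, inner_add_right]
  rw [integral_add (integrable_inner hξ hS.2.1) (integrable_inner hξ hT.2.1), hS.2.2 ξ hξ,
    hT.2.2 ξ hξ, ← integral_add (integrable_inner hξS hS.1)
      (integrable_inner hξT hS.1)]
  refine integral_congr_ae ?_
  filter_upwards [Lp.coeFn_add (star (S : Op μ) ξ) (star (T : Op μ) ξ)] with x hx
  rw [hx, Pi.add_apply, inner_add_left]

theorem LocMapsTo.congr {T : Ccs h} {f g k : X → ℂ} (hT : LocMapsTo T f g) (hk : g =ᵐ[μ] k) :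
    LocMapsTo T f k := by
  refine ⟨hT.1, ⟨hT.2.1.1.congr hk, fun U hU hb =>
    (memLp_congr_ae (ae_restrict_of_ae hk)).1 (hT.2.1.2 U hU hb)⟩, fun ξ hξ => ?_⟩
  rw [← hT.2.2 ξ hξ]
  refine integral_congr_ae ?_
  filter_upwards [hk] with x hx
  rw [hx]

theorem locL2_one (h : Admissible μ) : LocL2 μ fun _ => 1 :=
  locL2_of_memLp_top h (memLp_top_const 1)

/-- To verify `T f = g` it is enough to do it locally, with `f` cut off to large bounded sets. -/
theorem locMapsTo_of_local (hX : Connected X) {T : Ccs h} {f g : X → ℂ} (hf : LocL2 μ f)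
    (hg : LocL2 μ g)
    (hloc : ∀ U, MeasurableSet U → Bounded U → ∃ V₀, MeasurableSet V₀ ∧ Bounded V₀ ∧
      ∀ V, Bounded V → V₀ ⊆ V → ∀ η : Lp ℂ 2 μ, η =ᵐ[μ] V.indicator f →
        ∀ᵐ x ∂μ, x ∈ U → (T : Op μ) η x = g x) : LocMapsTo T f g := by
  refine ⟨hf, hg, fun ξ hξ => ?_⟩
  obtain ⟨F, hFm, hFc, hFs, hT⟩ := exists_symm_support T
  obtain ⟨U, hU, hb, hξ⟩ := hξ
  obtain ⟨V₀, hV₀, hV₀b, hV⟩ := hloc U hU hb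
  have hW := hFm U hU
  have hVm : MeasurableSet (V₀ ∪ nhd F U) := hV₀.union hW
  have hVb : Bounded (V₀ ∪ nhd F U) := hV₀b.union hX (hb.nhd hFc)
  set η := (hf.memLp_indicator hVm hVb).toLp with hη
  have hη' : η =ᵐ[μ] (V₀ ∪ nhd F U).indicator f := MemLp.coeFn_toLp _
  have h1 := hV _ hVb Set.subset_union_left η hη'
  rw [integral_inner_eq (η := (T : Op μ) η) hξ h1,
    integral_inner_eq (η := η)
      (ae_eq_zero_of_symm_support hFs (star_supportedOn_symm hFs hT) hU hξ)]
  · rw [ContinuousLinearMap.star_eq_adjoint, ContinuousLinearMap.adjoint_inner_left]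
  · filter_upwards [hη'] with x hx hxU
    rw [hx, Set.indicator_of_mem (Set.mem_union_right _ hxU)]

/-- If `T f = 0`, then `T` maps large cut-offs of `f` to functions that vanish locally. -/
theorem LocMapsTo.ae_eq_zero {T : Ccs h} {f : X → ℂ} (hT : LocMapsTo T f 0) {F : Set (X × X)}
    {hFm : MeasRel F} (hFs : Symm F) (hTF : SupportedOn F hFm (T : Op μ))
    {U : Set X} (hU : MeasurableSet U) (hb : Bounded U) {η : Lp ℂ 2 μ}
    (hη : ∀ᵐ x ∂μ, x ∈ nhd F U → η x = f x) : ∀ᵐ x ∂μ, x ∈ U → (T : Op μ) η x = 0 := by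
  -- The test vector is the part of Tη over U itself, so that the duality relation reads ⟨ξ, ξ⟩ = 0.
  set ξ := mulOp μ (ind μ U hU) ((T : Op μ) η) with hξ
  have hξU : ∀ᵐ x ∂μ, x ∉ U → ξ x = 0 := by
    filter_upwards [mulOp_ind_apply U hU ((T : Op μ) η)] with x h1 hx
    rw [hξ, h1, Set.indicator_of_notMem hx]
  have h1 := hT.2.2 ξ ⟨U, hU, hb, hξU⟩
  rw [integral_inner_eq (η := η) (ae_eq_zero_of_symm_support hFs (star_supportedOn_symm hFs hTF)
    hU hξU) hη, ContinuousLinearMap.star_eq_adjoint, ContinuousLinearMap.adjoint_inner_left] at h1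
  simp only [Pi.zero_apply, inner_zero_right, integral_zero] at h1
  have h2 : inner ℂ ξ ξ = 0 := by
    have h3 : inner ℂ (star (mulOp μ (ind μ U hU)) ξ) ((T : Op μ) η) = inner ℂ ξ ξ :=
      ContinuousLinearMap.adjoint_inner_left _ _ _
    rw [← h3, star_mulOp_ind, mulOp_ind_eq_self hU hξU, ← h1]
  exact ae_eq_zero_of_mulOp_ind hU (inner_self_eq_zero.1 h2)

theorem phiEq_mulCs (f : Lp ℂ ∞ μ) : PhiEq (mulCs h f) f := by
  refine ⟨locL2_one h, locL2_of_memLp_top h (Lp.memLp f), fun ξ _ => ?_⟩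
  have hs : star ((mulCs h f : Ccs h) : Op μ) = mulOp μ (star f) :=
    star_mulOp (f := f) (g := star f) (Lp.coeFn_star f)
  rw [hs]
  refine integral_congr_ae ?_
  filter_upwards [mulOp_apply (star f) ξ, Lp.coeFn_star f] with x h1 h2
  rw [h1, h2, Pi.star_apply]
  simp

/-- This reduces statements about bounded Φ(T) to operators that annihilate the constants. -/
theorem phiEq_sub_mulCs {T : Ccs h} {f : Lp ℂ ∞ μ} (hT : PhiEq T f) :
    PhiEq (T - mulCs h f) 0 := by
  have h1 : T - mulCs h f = T + mulCs h (-f) := by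
    rw [sub_eq_add_neg]
    congr 1
    refine Subtype.ext ?_
    show -mulOp μ f = mulOp μ (-f)
    rw [← neg_one_smul ℂ f, mulOp_smul, neg_one_smul]
  rw [h1]
  refine (LocMapsTo.add hT (phiEq_mulCs (-f))).congr ?_
  filter_upwards [Lp.coeFn_neg f] with x hx
  rw [Pi.add_apply, hx, Pi.neg_apply, add_neg_cancel]
  rfl

theorem locMapsTo_zero (T : Ccs h) : LocMapsTo T 0 0 := by
  have h0 : LocL2 μ (0 : X → ℂ) := locL2_of_memLp_top h MemLp.zero
  exact ⟨h0, h0, fun ξ _ => by simp⟩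

/-- The left ideal property; it is used for products of the form S*S, which turn several operators,
or one that is not self-adjoint, into a single positive operator. -/
theorem phiEq_mul_of_phiEq_zero (S : Ccs h) {T : Ccs h} (hT : PhiEq T 0) : PhiEq (S * T) 0 :=
  LocMapsTo.comp hT (locMapsTo_zero S)

/-- A Laplacian annihilates the constant functions. -/
theorem IsLaplacian.phiEq_zero (hX : Connected X) {E : Set (X × X)} (hE : Gordo μ E) {Δ : Ccs h}
    (hΔ : IsLaplacian E (Δ : Op μ)) : PhiEq Δ 0 := by
  refine locMapsTo_of_local hX (locL2_one h) (locL2_of_memLp_top h MemLp.zero) fun U hU hb => ?_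
  refine ⟨U ∪ nhd E U, hU.union (hE.meas U hU), hb.union hX (hb.nhd hE.controlled),
    fun V _ hV η hη => ?_⟩
  filter_upwards [hη, hΔ η] with x h1 h2 hx
  rw [h2, Pi.zero_apply]
  refine integral_eq_zero_of_ae ?_
  have hsl : MeasurableSet (slice E x) := by
    rw [← nhd_singleton]; exact hE.meas _ (measurableSet_singleton x)
  rw [Filter.EventuallyEq, ae_restrict_iff' hsl]
  filter_upwards [hη] with y h3 hy
  rw [h1, h3, Set.indicator_of_mem (hV (Or.inl hx)), Set.indicator_of_mem (hV (Or.inr ⟨x, hx, hy⟩)),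
    sub_self, Pi.zero_apply]

end Local

end

end CoarseAmenable

namespace CoarseAmenable

noncomputable section

open CoarseSpace

/-! ### Integral operators and Laplacians of symmetric kernels -/

section Kernel

variable {X : Type u} [CoarseSpace X] [MeasurableSpace X] {μ : Measure X}

/-- A symmetric measurable subset of the product whose slices have uniformly bounded measure. -/
structure IsKernel (μ : Measure X) (E : Set (X × X)) : Prop where
  meas : MeasurableSet E
  symm : Symm E
  bound : ∃ C : ℝ≥0, ∀ x, μ (slice E x) ≤ C

variable {E : Set (X × X)}

theorem IsKernel.slice_eq (hE : IsKernel μ E) (x : X) : slice E x = Prod.mk x ⁻¹' E := by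
  ext y
  exact ⟨fun h => symm_mem hE.symm h, fun h => symm_mem hE.symm h⟩

theorem IsKernel.measurableSet_slice (hE : IsKernel μ E) (x : X) : MeasurableSet (slice E x) := by
  rw [hE.slice_eq]; exact measurable_prodMk_left hE.meas

theorem IsKernel.mono (hE : IsKernel μ E) {F : Set (X × X)} (hF : MeasurableSet F) (hs : Symm F)
    (hFE : F ⊆ E) : IsKernel μ F := by
  obtain ⟨C, hC⟩ := hE.bound
  exact ⟨hF, hs, C, fun x =>
    (measure_mono (show slice F x ⊆ slice E x from fun y hy => hFE hy)).trans (hC x)⟩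

theorem IsKernel.integrableOn (hE : IsKernel μ E) (ξ : Lp ℂ 2 μ) (x : X) :
    IntegrableOn ξ (slice E x) μ := by
  obtain ⟨C, hC⟩ := hE.bound
  have : IsFiniteMeasure (μ.restrict (slice E x)) := ⟨by
    rw [Measure.restrict_apply_univ]; exact (hC x).trans_lt ENNReal.coe_lt_top⟩
  exact ((Lp.memLp ξ).restrict _).integrable one_le_two

theorem eLpNorm_two_sq (f : X → ℂ) : eLpNorm f 2 μ ^ 2 = ∫⁻ x, ‖f x‖ₑ ^ 2 ∂μ := by
  have := eLpNorm_nnreal_pow_eq_lintegral (f := f) (μ := μ) (p := 2) two_ne_zero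
  simpa using this

theorem enorm_sq_eq_lintegral (ξ : Lp ℂ 2 μ) : ‖ξ‖ₑ ^ 2 = ∫⁻ x, ‖ξ x‖ₑ ^ 2 ∂μ := by
  rw [Lp.enorm_def, eLpNorm_two_sq]

theorem measurable_enorm_Lp (ξ : Lp ℂ 2 μ) : Measurable fun x => ‖ξ x‖ₑ :=
  (Lp.stronglyMeasurable ξ).measurable.enorm

theorem sq_setLIntegral_le {f : X → ℝ≥0∞} (hf : Measurable f) (s : Set X) :
    (∫⁻ y in s, f y ∂μ) ^ 2 ≤ μ s * ∫⁻ y in s, f y ^ 2 ∂μ := by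
  have h := ENNReal.lintegral_mul_le_Lp_mul_Lq (μ.restrict s) Real.HolderConjugate.two_two
    (f := fun _ => 1) aemeasurable_const hf.aemeasurable
  have h2 := pow_le_pow_left' h 2
  rw [mul_pow, ← ENNReal.rpow_natCast, ← ENNReal.rpow_natCast, ← ENNReal.rpow_natCast,
    ← ENNReal.rpow_mul, ← ENNReal.rpow_mul] at h2
  simpa using h2

variable [SFinite μ]

theorem IsKernel.lintegral_swap (hE : IsKernel μ E) {F : X → X → ℝ≥0∞}
    (hF : Measurable (Function.uncurry F)) :
    ∫⁻ x, ∫⁻ y in slice E x, F x y ∂μ ∂μ = ∫⁻ y, ∫⁻ x in slice E y, F x y ∂μ ∂μ := by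
  have h1 : ∀ x, ∫⁻ y in slice E x, F x y ∂μ =
      ∫⁻ y, E.indicator (Function.uncurry F) (x, y) ∂μ := fun x => by
    rw [← lintegral_indicator (hE.measurableSet_slice x)]
    refine lintegral_congr fun y => ?_
    by_cases hy : y ∈ slice E x
    · rw [Set.indicator_of_mem hy, Set.indicator_of_mem (symm_mem hE.symm hy)]; rfl
    · rw [Set.indicator_of_notMem hy,
        Set.indicator_of_notMem fun h => hy (symm_mem hE.symm h)]
  have h2 : ∀ y, ∫⁻ x in slice E y, F x y ∂μ =
      ∫⁻ x, E.indicator (Function.uncurry F) (x, y) ∂μ := fun y => by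
    rw [← lintegral_indicator (hE.measurableSet_slice y)]
    refine lintegral_congr fun x => ?_
    by_cases hx : x ∈ slice E y
    · rw [Set.indicator_of_mem hx, Set.indicator_of_mem (show (x, y) ∈ E from hx)]; rfl
    · rw [Set.indicator_of_notMem hx, Set.indicator_of_notMem (show (x, y) ∉ E from hx)]
  simp_rw [h1, h2]
  exact lintegral_lintegral_swap (hF.indicator hE.meas).aemeasurable

theorem IsKernel.measurable_measure_slice (hE : IsKernel μ E) :
    Measurable fun x => μ (slice E x) :=
  measurable_measure_prodMk_right hE.meas

theorem IsKernel.lintegral_slice (hE : IsKernel μ E) {f : X → ℝ≥0∞} (hf : Measurable f) :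
    ∫⁻ x, ∫⁻ y in slice E x, f y ∂μ ∂μ = ∫⁻ y, μ (slice E y) * f y ∂μ := by
  rw [hE.lintegral_swap (F := fun _ y => f y) (hf.comp measurable_snd)]
  refine lintegral_congr fun y => ?_
  rw [setLIntegral_const, mul_comm]

/-- Integrate 2ab ≤ a² + b² over E and apply Tonelli with the symmetry of E. Keeping μ(E_x) as a
weight, rather than its upper bound, is what makes the Laplacian positive in `lap_nonneg`. -/
theorem IsKernel.lintegral_mul_le (hE : IsKernel μ E) {f g : X → ℝ≥0∞} (hf : Measurable f)
    (hg : Measurable g) :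
    2 * ∫⁻ x, ∫⁻ y in slice E x, f x * g y ∂μ ∂μ ≤
      (∫⁻ x, μ (slice E x) * f x ^ 2 ∂μ) + ∫⁻ x, μ (slice E x) * g x ^ 2 ∂μ := by
  have hle : ∀ a b : ℝ≥0∞, 2 * (a * b) ≤ a ^ 2 + b ^ 2 := fun a b => by
    induction a with
    | top => simp
    | coe a =>
      induction b with
      | top => simp
      | coe b =>
        rw [← mul_assoc]
        exact_mod_cast two_mul_le_add_sq a b
  rw [← lintegral_const_mul' _ _ (by simp)]
  calc _ ≤ ∫⁻ x, ∫⁻ y in slice E x, (f x ^ 2 + g y ^ 2) ∂μ ∂μ := by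
        refine lintegral_mono fun x => ?_
        rw [← lintegral_const_mul' _ _ (by simp)]
        exact lintegral_mono fun y => hle _ _
    _ = ∫⁻ x, (μ (slice E x) * f x ^ 2 + ∫⁻ y in slice E x, g y ^ 2 ∂μ) ∂μ := by
        refine lintegral_congr fun x => ?_
        rw [lintegral_add_left measurable_const, setLIntegral_const, mul_comm]
    _ = _ := by
        rw [lintegral_add_left (f := fun x => μ (slice E x) * f x ^ 2)
          (hE.measurable_measure_slice.mul (hf.pow_const 2)),
          hE.lintegral_slice (hg.pow_const 2)]

theorem IsKernel.stronglyMeasurable_integral (hE : IsKernel μ E) (ξ : Lp ℂ 2 μ) :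
    StronglyMeasurable fun x => ∫ y in slice E x, ξ y ∂μ := by
  have h1 : StronglyMeasurable (E.indicator fun p : X × X => ξ p.2) :=
    ((Lp.stronglyMeasurable ξ).comp_measurable measurable_snd).indicator hE.meas
  have h2 := h1.integral_prod_right' (ν := μ)
  convert h2 using 2 with x
  rw [← integral_indicator (hE.measurableSet_slice x)]
  congr 1
  ext y
  by_cases hy : y ∈ slice E x
  · rw [Set.indicator_of_mem hy, Set.indicator_of_mem (symm_mem hE.symm hy)]
  · rw [Set.indicator_of_notMem hy, Set.indicator_of_notMem fun h => hy (symm_mem hE.symm h)]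

theorem IsKernel.lintegral_degree_le (_hE : IsKernel μ E) {C : ℝ≥0} (hC : ∀ x, μ (slice E x) ≤ C)
    (ξ : Lp ℂ 2 μ) :
    ∫⁻ x, μ (slice E x) * ‖ξ x‖ₑ ^ 2 ∂μ ≤ C * ‖ξ‖ₑ ^ 2 := by
  rw [enorm_sq_eq_lintegral, ← lintegral_const_mul' _ _ ENNReal.coe_ne_top]
  exact lintegral_mono fun x => mul_le_mul_left (hC x) _

/-- Cauchy-Schwarz on each slice costs one factor C, and Tonelli with the symmetry of E costs the
other. -/
theorem IsKernel.eLpNorm_integral_le (hE : IsKernel μ E) {C : ℝ≥0} (hC : ∀ x, μ (slice E x) ≤ C)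
    (ξ : Lp ℂ 2 μ) :
    eLpNorm (fun x => ∫ y in slice E x, ξ y ∂μ) 2 μ ≤ C * ‖ξ‖ₑ := by
  rw [← ENNReal.pow_le_pow_left_iff two_ne_zero, eLpNorm_two_sq, mul_pow]
  calc ∫⁻ x, ‖∫ y in slice E x, ξ y ∂μ‖ₑ ^ 2 ∂μ
      ≤ ∫⁻ x, C * ∫⁻ y in slice E x, ‖ξ y‖ₑ ^ 2 ∂μ ∂μ := by
        refine lintegral_mono fun x => ?_
        refine (pow_le_pow_left' (enorm_integral_le_lintegral_enorm _) 2).trans ?_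
        exact (sq_setLIntegral_le (measurable_enorm_Lp ξ) _).trans (mul_le_mul_left (hC x) _)
    _ = C * ∫⁻ x, μ (slice E x) * ‖ξ x‖ₑ ^ 2 ∂μ := by
        rw [lintegral_const_mul' _ _ ENNReal.coe_ne_top,
          hE.lintegral_slice ((measurable_enorm_Lp ξ).pow_const 2)]
    _ ≤ C * (C * ‖ξ‖ₑ ^ 2) := mul_le_mul_right (hE.lintegral_degree_le hC ξ) _
    _ = _ := by rw [← mul_assoc, sq (C : ℝ≥0∞)]

theorem IsKernel.memLp_integral (hE : IsKernel μ E) (ξ : Lp ℂ 2 μ) :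
    MemLp (fun x => ∫ y in slice E x, ξ y ∂μ) 2 μ := by
  obtain ⟨C, hC⟩ := hE.bound
  refine ⟨(hE.stronglyMeasurable_integral ξ).aestronglyMeasurable,
    (hE.eLpNorm_integral_le hC ξ).trans_lt ?_⟩
  exact ENNReal.mul_lt_top ENNReal.coe_lt_top enorm_lt_top

/-- The operator `ξ ↦ (x ↦ ∫_{E_x} ξ)`. -/
def kerOp (hE : IsKernel μ E) : Op μ :=
  LinearMap.mkContinuous
    { toFun := fun ξ => (hE.memLp_integral ξ).toLp
      map_add' := fun ξ η => by
        rw [← MemLp.toLp_add]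
        refine MemLp.toLp_congr _ _ (Filter.Eventually.of_forall fun x => ?_)
        show _ = (∫ y in slice E x, ξ y ∂μ) + ∫ y in slice E x, η y ∂μ
        rw [← integral_add (hE.integrableOn ξ x) (hE.integrableOn η x)]
        exact integral_congr_ae (ae_restrict_of_ae (Lp.coeFn_add ξ η))
      map_smul' := fun c ξ => by
        rw [RingHom.id_apply, ← MemLp.toLp_const_smul]
        refine MemLp.toLp_congr _ _ (Filter.Eventually.of_forall fun x => ?_)
        show _ = c • ∫ y in slice E x, ξ y ∂μ
        rw [← integral_smul]
        exact integral_congr_ae (ae_restrict_of_ae (Lp.coeFn_smul c ξ)) }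
    ((Classical.choose hE.bound : ℝ≥0) : ℝ) fun ξ => by
      have h := hE.eLpNorm_integral_le (Classical.choose_spec hE.bound) ξ
      show ‖(hE.memLp_integral ξ).toLp‖ ≤ _
      rw [Lp.norm_toLp]
      have h2 := ENNReal.toReal_mono
        (ENNReal.mul_lt_top ENNReal.coe_lt_top enorm_lt_top).ne h
      rwa [ENNReal.toReal_mul, toReal_enorm] at h2

theorem kerOp_apply (hE : IsKernel μ E) (ξ : Lp ℂ 2 μ) :
    kerOp hE ξ =ᵐ[μ] fun x => ∫ y in slice E x, ξ y ∂μ :=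
  MemLp.coeFn_toLp (hE.memLp_integral ξ)

theorem IsKernel.memLp_degree (hE : IsKernel μ E) :
    MemLp (fun x => ((μ (slice E x)).toReal : ℂ)) ∞ μ := by
  obtain ⟨C, hC⟩ := hE.bound
  refine memLp_top_of_bound ?_ (C : ℝ) (Filter.Eventually.of_forall fun x => ?_)
  · exact (Complex.measurable_ofReal.comp
      hE.measurable_measure_slice.ennreal_toReal).aestronglyMeasurable
  · rw [Complex.norm_real, Real.norm_of_nonneg ENNReal.toReal_nonneg]
    exact ENNReal.toReal_mono ENNReal.coe_ne_top (hC x)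

/-- The function `x ↦ μ(E_x)`. -/
def degree (hE : IsKernel μ E) : Lp ℂ ∞ μ := hE.memLp_degree.toLp

theorem coeFn_degree (hE : IsKernel μ E) :
    degree hE =ᵐ[μ] fun x => ((μ (slice E x)).toReal : ℂ) := MemLp.coeFn_toLp _

/-- The Laplacian of a kernel. -/
def lap (hE : IsKernel μ E) : Op μ := mulOp μ (degree hE) - kerOp hE

theorem lap_apply (hE : IsKernel μ E) (ξ : Lp ℂ 2 μ) :
    lap hE ξ =ᵐ[μ] fun x => (μ (slice E x)).toReal * ξ x - ∫ y in slice E x, ξ y ∂μ := by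
  have h0 : lap hE ξ = mulOp μ (degree hE) ξ - kerOp hE ξ := rfl
  rw [h0]
  filter_upwards [Lp.coeFn_sub (mulOp μ (degree hE) ξ) (kerOp hE ξ), mulOp_apply (degree hE) ξ,
    coeFn_degree hE, kerOp_apply hE ξ] with x h1 h2 h3 h4
  rw [h1, Pi.sub_apply, h2, h3, h4]

theorem isLaplacian_lap (hE : IsKernel μ E) : IsLaplacian E (lap hE) := by
  obtain ⟨C, hC⟩ := hE.bound
  intro ξ
  filter_upwards [lap_apply hE ξ] with x hx
  have : IsFiniteMeasure (μ.restrict (slice E x)) := ⟨by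
    rw [Measure.restrict_apply_univ]; exact (hC x).trans_lt ENNReal.coe_lt_top⟩
  rw [hx, integral_sub (integrable_const _) (hE.integrableOn ξ x), setIntegral_const]
  simp [Measure.real]

/-- This absolute integrability justifies the exchange of integrals that proves `kerOp`
self-adjoint. -/
theorem IsKernel.integrable_prod (hE : IsKernel μ E) (ξ η : Lp ℂ 2 μ) :
    Integrable (E.indicator fun p : X × X => inner ℂ (ξ p.1) (η p.2)) (μ.prod μ) := by
  obtain ⟨C, hC⟩ := hE.bound
  have hm : StronglyMeasurable fun p : X × X => inner ℂ (ξ p.1) (η p.2) :=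
    ((Lp.stronglyMeasurable ξ).comp_measurable measurable_fst).inner
      ((Lp.stronglyMeasurable η).comp_measurable measurable_snd)
  have hm' := hm.indicator hE.meas
  refine ⟨hm'.aestronglyMeasurable, ?_⟩
  rw [hasFiniteIntegral_iff_enorm, lintegral_prod _ hm'.measurable.enorm.aemeasurable]
  have h1 : ∀ x, ∫⁻ y, ‖E.indicator (fun p : X × X => inner ℂ (ξ p.1) (η p.2)) (x, y)‖ₑ ∂μ ≤
      ∫⁻ y in slice E x, ‖ξ x‖ₑ * ‖η y‖ₑ ∂μ := fun x => by
    rw [← lintegral_indicator (hE.measurableSet_slice x)]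
    refine lintegral_mono fun y => ?_
    by_cases hy : y ∈ slice E x
    · rw [Set.indicator_of_mem hy, Set.indicator_of_mem (symm_mem hE.symm hy),
        RCLike.inner_apply, enorm_mul, mul_comm, RCLike.enorm_conj]
    · rw [Set.indicator_of_notMem fun h => hy (symm_mem hE.symm h), enorm_zero]
      exact zero_le
  have h2 := hE.lintegral_mul_le (measurable_enorm_Lp ξ) (measurable_enorm_Lp η)
  refine lt_of_le_of_lt (lintegral_mono h1) ?_
  have h3 : ∀ ζ : Lp ℂ 2 μ, ∫⁻ x, μ (slice E x) * ‖ζ x‖ₑ ^ 2 ∂μ < ∞ := fun ζ =>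
    (hE.lintegral_degree_le hC ζ).trans_lt
      (ENNReal.mul_lt_top ENNReal.coe_lt_top (ENNReal.pow_lt_top enorm_lt_top))
  have h4 := h2.trans_lt (ENNReal.add_lt_top.2 ⟨h3 ξ, h3 η⟩)
  refine lt_of_le_of_lt ?_ h4
  rw [two_mul]; exact le_self_add

theorem inner_kerOp (hE : IsKernel μ E) (ξ η : Lp ℂ 2 μ) :
    inner ℂ ξ (kerOp hE η) =
      ∫ x, ∫ y, E.indicator (fun p : X × X => inner ℂ (ξ p.1) (η p.2)) (x, y) ∂μ ∂μ := by
  rw [inner_eq_integral]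
  refine integral_congr_ae ?_
  filter_upwards [kerOp_apply hE η] with x hx
  rw [hx, ← integral_inner (hE.integrableOn η x), ← integral_indicator (hE.measurableSet_slice x)]
  refine integral_congr_ae (Filter.Eventually.of_forall fun y => ?_)
  by_cases hy : y ∈ slice E x
  · simp only [Set.indicator_of_mem hy, Set.indicator_of_mem (symm_mem hE.symm hy)]
  · simp only [Set.indicator_of_notMem hy,
      Set.indicator_of_notMem fun h : (x, y) ∈ E => hy (symm_mem hE.symm h)]

theorem star_kerOp (hE : IsKernel μ E) : star (kerOp hE) = kerOp hE := by
  rw [ContinuousLinearMap.star_eq_adjoint]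
  symm
  rw [ContinuousLinearMap.eq_adjoint_iff]
  intro ξ η
  rw [← inner_conj_symm, inner_kerOp, inner_kerOp, integral_integral_swap
    (f := fun x y => E.indicator (fun p : X × X => inner ℂ (ξ p.1) (η p.2)) (x, y))
    (hE.integrable_prod ξ η),
    ← integral_conj]
  refine integral_congr_ae (Filter.Eventually.of_forall fun x => ?_)
  simp only [← integral_conj]
  refine integral_congr_ae (Filter.Eventually.of_forall fun y => ?_)
  by_cases hy : (x, y) ∈ E
  · simp only [Set.indicator_of_mem hy, Set.indicator_of_mem (symm_mem hE.symm hy),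
      inner_conj_symm]
  · simp only [Set.indicator_of_notMem hy,
      Set.indicator_of_notMem fun h : (y, x) ∈ E => hy (symm_mem hE.symm h), map_zero]

theorem star_degree (hE : IsKernel μ E) : star (mulOp μ (degree hE)) = mulOp μ (degree hE) := by
  refine star_mulOp ?_
  filter_upwards [coeFn_degree hE] with x hx
  rw [hx]; simp

theorem star_lap (hE : IsKernel μ E) : star (lap hE) = lap hE := by
  rw [lap, star_sub, star_kerOp, star_degree]

/-- With A = ∫ μ(E_x)|ξ(x)|² dμ(x), the degree term contributes exactly A to ⟨ξ, Δξ⟩, while the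
kernel term is at most A in absolute value by `IsKernel.lintegral_mul_le`. -/
theorem lap_nonneg (hE : IsKernel μ E) : 0 ≤ lap hE := by
  obtain ⟨C, hC⟩ := hE.bound
  rw [ContinuousLinearMap.nonneg_iff_isPositive, ContinuousLinearMap.isPositive_def]
  refine ⟨?_, fun ξ => ?_⟩
  · have := star_lap hE
    rw [ContinuousLinearMap.star_eq_adjoint] at this
    intro ξ η
    show inner ℂ (lap hE ξ) η = inner ℂ ξ (lap hE η)
    conv_lhs => rw [← this]
    rw [ContinuousLinearMap.adjoint_inner_left]
  · set A := ∫⁻ x, μ (slice E x) * ‖ξ x‖ₑ ^ 2 ∂μ with hA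
    have hAfin : A < ∞ := (hE.lintegral_degree_le hC ξ).trans_lt
      (ENNReal.mul_lt_top ENNReal.coe_lt_top (ENNReal.pow_lt_top enorm_lt_top))
    have h1 : ‖inner ℂ ξ (kerOp hE ξ)‖ₑ ≤ A := by
      have h2 := hE.lintegral_mul_le (measurable_enorm_Lp ξ) (measurable_enorm_Lp ξ)
      rw [← hA, ← two_mul] at h2
      refine le_trans ?_ ((ENNReal.mul_le_mul_iff_right two_ne_zero ENNReal.ofNat_ne_top).1 h2)
      rw [inner_kerOp]
      refine (enorm_integral_le_lintegral_enorm _).trans (lintegral_mono fun x => ?_)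
      refine (enorm_integral_le_lintegral_enorm _).trans ?_
      rw [← lintegral_indicator (hE.measurableSet_slice x)]
      refine lintegral_mono fun y => ?_
      by_cases hy : y ∈ slice E x
      · rw [Set.indicator_of_mem hy, Set.indicator_of_mem (symm_mem hE.symm hy),
          RCLike.inner_apply, enorm_mul, mul_comm, RCLike.enorm_conj]
      · rw [Set.indicator_of_notMem fun h => hy (symm_mem hE.symm h), enorm_zero]
        exact zero_le
    have h2 : inner ℂ ξ (mulOp μ (degree hE) ξ) = (A.toReal : ℂ) := by
      rw [inner_eq_integral, hA, ← integral_toReal]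
      · rw [← integral_complex_ofReal]
        refine integral_congr_ae ?_
        filter_upwards [mulOp_apply (degree hE) ξ, coeFn_degree hE] with x h3 h4
        rw [h3, h4, ENNReal.toReal_mul, ENNReal.toReal_pow, toReal_enorm]
        rw [← smul_eq_mul, inner_smul_right, inner_self_eq_norm_sq_to_K]
        push_cast; rfl
      · exact (hE.measurable_measure_slice.mul ((measurable_enorm_Lp ξ).pow_const 2)).aemeasurable
      · exact Filter.Eventually.of_forall fun x => ENNReal.mul_lt_top
          ((hC x).trans_lt ENNReal.coe_lt_top) (ENNReal.pow_lt_top enorm_lt_top)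
    have h3 : ‖inner ℂ ξ (kerOp hE ξ)‖ ≤ A.toReal := by
      rw [← toReal_enorm]; exact ENNReal.toReal_mono hAfin.ne h1
    rw [ContinuousLinearMap.reApplyInnerSelf_apply, ← inner_conj_symm, RCLike.conj_re]
    have h0 : lap hE ξ = mulOp μ (degree hE) ξ - kerOp hE ξ := rfl
    rw [h0, inner_sub_right, h2, map_sub]
    have h4 := (RCLike.re_le_norm (inner ℂ ξ (kerOp hE ξ))).trans h3
    have h5 : RCLike.re ((A.toReal : ℝ) : ℂ) = A.toReal := Complex.ofReal_re _
    rw [h5]; linarith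

theorem lap_union {F G : Set (X × X)} (hE : IsKernel μ E) (hF : IsKernel μ F) (hG : IsKernel μ G)
    (hEFG : E = F ∪ G) (hd : Disjoint F G) : lap hE = lap hF + lap hG := by
  obtain ⟨C, hC⟩ := hE.bound
  refine op_ext fun ξ => ?_
  have h0 : (lap hF + lap hG) ξ = lap hF ξ + lap hG ξ := rfl
  rw [h0]
  filter_upwards [lap_apply hE ξ, lap_apply hF ξ, lap_apply hG ξ,
    Lp.coeFn_add (lap hF ξ) (lap hG ξ)] with x h1 h2 h3 h4
  have hsl : slice E x = slice F x ∪ slice G x := by rw [hEFG]; rfl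
  have hdis : Disjoint (slice F x) (slice G x) :=
    Set.disjoint_left.2 fun y h h' => Set.disjoint_left.1 hd h h'
  have hfin : ∀ {H : Set (X × X)}, H ⊆ E → μ (slice H x) ≠ ∞ := fun {H} hH =>
    ((measure_mono (show slice H x ⊆ slice E x from fun y hy => hH hy)).trans_lt
      ((hC x).trans_lt ENNReal.coe_lt_top)).ne
  rw [h4, Pi.add_apply, h1, h2, h3, hsl, measure_union hdis (hG.measurableSet_slice x),
    setIntegral_union hdis (hG.measurableSet_slice x) (hF.integrableOn ξ x) (hG.integrableOn ξ x),
    ENNReal.toReal_add (hfin (hEFG ▸ Set.subset_union_left))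
      (hfin (hEFG ▸ Set.subset_union_right))]
  push_cast; ring

theorem supportedOn_kerOp (hE : IsKernel μ E) {F : Set (X × X)} (hF : MeasRel F) (hEF : E ⊆ F) :
    SupportedOn F hF (kerOp hE) := by
  rw [supportedOn_iff]
  intro U hU η hη
  filter_upwards [kerOp_apply hE η] with x hx hxU
  rw [hx]
  refine integral_eq_zero_of_ae ?_
  rw [Filter.EventuallyEq, ae_restrict_iff' (hE.measurableSet_slice x)]
  filter_upwards [hη] with y hy hyx
  exact hy ⟨x, hxU, hEF hyx⟩

theorem supportedOn_lap (hE : IsKernel μ E) {F : Set (X × X)} (hF : MeasRel F) (hEF : E ⊆ F)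
    (hd : diag X ⊆ F) : SupportedOn F hF (lap hE) := by
  have h1 := supportedOn_kerOp hE hF hEF
  rw [supportedOn_iff] at h1 ⊢
  intro U hU η hη
  have h0 : lap hE η = mulOp μ (degree hE) η - kerOp hE η := rfl
  rw [h0]
  filter_upwards [h1 U hU η hη, mulOp_apply (degree hE) η, hη,
    Lp.coeFn_sub (mulOp μ (degree hE) η) (kerOp hE η)] with x h2 h3 h4 h5 hx
  rw [h5, Pi.sub_apply, h2 hx, h3, h4 ⟨x, hx, hd rfl⟩, mul_zero, sub_zero]

end Kernel

end

end CoarseAmenable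

namespace CoarseAmenable

noncomputable section

open CoarseSpace

/-! ### Ultralimits, and the spectrum in the maximal C*-algebra -/

section RepLemmas

/-- Pointwise limits of linear functionals along an ultrafilter. -/
theorem exists_ultralimit {ι V : Type*} [AddCommGroup V] [Module ℂ V] (U : Ultrafilter ι)
    (F : ι → V →ₗ[ℂ] ℂ) (hF : ∀ f, ∃ C, ∀ i, ‖F i f‖ ≤ C) :
    ∃ φ : V →ₗ[ℂ] ℂ, ∀ f, Tendsto (fun i => F i f) U (𝓝 (φ f)) := by
  have key : ∀ f, ∃ z, Tendsto (fun i => F i f) U (𝓝 z) := by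
    intro f
    obtain ⟨C, hC⟩ := hF f
    obtain ⟨z, -, hz⟩ := (isCompact_closedBall (0 : ℂ) C).ultrafilter_le_nhds
      (U.map fun i => F i f) (by
        rw [Filter.le_principal_iff, Ultrafilter.coe_map, Filter.mem_map]
        exact Filter.Eventually.of_forall fun i => mem_closedBall_zero_iff.2 (hC i))
    exact ⟨z, hz⟩
  choose φ hφ using key
  refine ⟨{ toFun := φ, map_add' := fun f g => ?_, map_smul' := fun c f => ?_ }, hφ⟩
  · refine tendsto_nhds_unique (hφ (f + g)) ?_
    simpa only [map_add] using (hφ f).add (hφ g)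
  · refine tendsto_nhds_unique (hφ (c • f)) ?_
    simpa only [map_smul, RingHom.id_apply] using (hφ f).const_smul c

variable {A : Type u} [Ring A] [StarRing A] [Algebra ℂ A]

theorem toMaxCStar_mul (a b : A) (ha : maxNorm a < ∞) (hb : maxNorm b < ∞)
    (hab : maxNorm (a * b) < ∞) :
    toMaxCStar (a * b) hab = toMaxCStar a ha * toMaxCStar b hb :=
  UniformSpace.Completion.coe_mul (α := MaxPre A) (⟨a, ha⟩ : finiteMax A) (⟨b, hb⟩ : finiteMax A)

theorem toMaxCStar_one_sub (a : A) (ha : maxNorm a < ∞) (ha' : maxNorm (1 - a) < ∞) :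
    toMaxCStar (1 - a) ha' = 1 - toMaxCStar a ha :=
  UniformSpace.Completion.coe_sub (α := MaxPre A) (1 : finiteMax A) (⟨a, ha⟩ : finiteMax A)

theorem norm_toMaxCStar (a : A) (ha : maxNorm a < ∞) :
    ‖toMaxCStar a ha‖ = (maxNorm a).toReal :=
  UniformSpace.Completion.norm_coe (E := MaxPre A) (⟨a, ha⟩ : finiteMax A)

theorem exists_toMaxCStar_near (x : MaxCStar A) {ε : ℝ} (hε : 0 < ε) :
    ∃ (a : A) (ha : maxNorm a < ∞), ‖x - toMaxCStar a ha‖ < ε := by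
  obtain ⟨y, hy⟩ := (UniformSpace.Completion.denseRange_coe (α := MaxPre A)).exists_dist_lt x hε
  refine ⟨y.1, y.2, ?_⟩
  rw [← dist_eq_norm]
  exact hy

/-- An element that annihilates a non-zero vector of some representation is not invertible in the
maximal C*-algebra. -/
theorem zero_mem_maxSpectrum {a : A} (ha : maxNorm a < ∞) (r : Rep A) {v : r.H} (hv : v ≠ 0)
    (hav : r.ρ a v = 0) : (0 : ℂ) ∈ maxSpectrum a := by
  refine ⟨ha, ?_⟩
  rw [spectrum.zero_mem_iff]
  intro hu
  obtain ⟨c, hc⟩ := hu.exists_left_inv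
  -- The left inverse lives only in the completion. An approximation `b` from the algebra with this
  -- tolerance gives 1 - ba maximal norm below 1, although ρ(1 - ba) fixes v.
  obtain ⟨b, hb, hbc⟩ := exists_toMaxCStar_near c (ε := 1 / (‖toMaxCStar a ha‖ + 1))
    (by positivity)
  have hba : maxNorm (b * a) < ∞ := (maxNorm_mul b a).trans_lt (ENNReal.mul_lt_top hb ha)
  have h1 : maxNorm (1 - b * a) < ∞ :=
    Subalgebra.sub_mem (finiteMax A) (one_mem _) (show b * a ∈ finiteMax A from hba)
  have h2 : ‖toMaxCStar (1 - b * a) h1‖ < 1 := by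
    rw [toMaxCStar_one_sub _ hba, toMaxCStar_mul b a hb ha, ← hc, ← sub_mul]
    refine (norm_mul_le _ _).trans_lt ?_
    have h3 : ‖c - toMaxCStar b hb‖ * ‖toMaxCStar a ha‖ ≤
        1 / (‖toMaxCStar a ha‖ + 1) * ‖toMaxCStar a ha‖ :=
      mul_le_mul_of_nonneg_right hbc.le (norm_nonneg _)
    refine h3.trans_lt ?_
    rw [one_div, inv_mul_lt_iff₀ (by positivity), mul_one]
    exact lt_add_one _
  rw [norm_toMaxCStar] at h2
  have h3 := (r.norm_le_maxNorm h1).trans_lt h2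
  have h4 : r.ρ (1 - b * a) v = v := by
    rw [r.map_sub_apply, r.map_one_apply, r.map_mul_apply, hav, map_zero, sub_zero]
  have h5 := (r.ρ (1 - b * a)).le_opNorm v
  rw [h4] at h5
  have h6 : 0 < ‖v‖ := norm_pos_iff.2 hv
  nlinarith

/-- If `0` is in the spectrum of `a` in the maximal C*-algebra, then `a` is not uniformly bounded
below in the representations. -/
theorem exists_re_inner_lt {a : A} (h0 : (0 : ℂ) ∈ maxSpectrum a) {δ : ℝ} (hδ : 0 < δ) :
    ∃ (r : Rep A) (v : r.H), ‖v‖ = 1 ∧ (inner ℂ v (r.ρ a v)).re < δ := by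
  obtain ⟨ha, h0⟩ := h0
  by_contra hcon
  push Not at hcon
  rw [spectrum.zero_mem_iff] at h0
  refine h0 ?_
  set c : ℝ := (maxNorm a).toReal + δ + 1 with hc
  have hc0 : 0 < c := by positivity
  have hδc : δ < c := by
    have : 0 ≤ (maxNorm a).toReal := ENNReal.toReal_nonneg
    rw [hc]; linarith
  -- If Re⟨v, av⟩ ≥ δ‖v‖² and ‖av‖ ≤ c‖v‖, then ‖(1 - ta)v‖² ≤ (1 - 2tδ + t²c²)‖v‖². The choice t =
  -- δ/c² minimizes the factor, and its value is q < 1.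
  set t : ℝ := δ / c ^ 2 with ht
  have ht0 : 0 < t := by positivity
  set q : ℝ := 1 - δ ^ 2 / c ^ 2 with hq
  have hq1 : q < 1 := by
    have : 0 < δ ^ 2 / c ^ 2 := by positivity
    rw [hq]; linarith
  have hq0 : 0 ≤ q := by
    have : δ ^ 2 / c ^ 2 ≤ 1 := by
      rw [div_le_one (by positivity)]
      exact pow_le_pow_left₀ hδ.le hδc.le 2
    rw [hq]; linarith
  have hlow : ∀ (r : Rep A) (v : r.H), δ * ‖v‖ ^ 2 ≤ (inner ℂ v (r.ρ a v)).re := by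
    intro r v
    by_cases hv : v = 0
    · simp [hv]
    have hv0 : ‖v‖ ≠ 0 := norm_ne_zero_iff.2 hv
    set u : r.H := ((‖v‖⁻¹ : ℝ) : ℂ) • v with hu
    have hu1 : ‖u‖ = 1 := by
      rw [hu, norm_smul, Complex.norm_real, norm_inv, norm_norm, inv_mul_cancel₀ hv0]
    have h1 := hcon r u hu1
    rw [hu, map_smul, inner_smul_left, inner_smul_right, Complex.conj_ofReal, ← mul_assoc,
      ← Complex.ofReal_mul, Complex.re_ofReal_mul] at h1
    have h2 := mul_le_mul_of_nonneg_right h1 (sq_nonneg ‖v‖)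
    refine h2.trans (le_of_eq ?_)
    field_simp
  have hbound : ∀ r : Rep A, ‖r.ρ (1 - (t : ℂ) • a)‖ ≤ √q := by
    intro r
    refine ContinuousLinearMap.opNorm_le_bound _ (Real.sqrt_nonneg _) fun v => ?_
    have h1 : r.ρ (1 - (t : ℂ) • a) v = v - (t : ℂ) • r.ρ a v := by
      rw [r.map_sub_apply, r.map_one_apply, r.map_smul_apply]
    have h2 : ‖v - (t : ℂ) • r.ρ a v‖ ^ 2 ≤ q * ‖v‖ ^ 2 := by
      rw [norm_sub_sq (𝕜 := ℂ), inner_smul_right, norm_smul, Complex.norm_real,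
        Real.norm_of_nonneg ht0.le]
      have h3 : RCLike.re ((t : ℂ) * inner ℂ v (r.ρ a v)) = t * (inner ℂ v (r.ρ a v)).re :=
        Complex.re_ofReal_mul _ _
      rw [h3]
      have h4 := mul_le_mul_of_nonneg_left (hlow r v) ht0.le
      have h5 : ‖r.ρ a v‖ ≤ c * ‖v‖ := by
        refine ((r.ρ a).le_opNorm v).trans (mul_le_mul_of_nonneg_right ?_ (norm_nonneg _))
        refine (r.norm_le_maxNorm ha).trans ?_
        rw [hc]; linarith
      have h6 : (t * ‖r.ρ a v‖) ^ 2 ≤ (t * (c * ‖v‖)) ^ 2 :=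
        pow_le_pow_left₀ (by positivity) (mul_le_mul_of_nonneg_left h5 ht0.le) 2
      have h7 : (t * (c * ‖v‖)) ^ 2 = δ ^ 2 / c ^ 2 * ‖v‖ ^ 2 := by
        rw [ht]; field_simp
      have h8 : t * (δ * ‖v‖ ^ 2) = δ ^ 2 / c ^ 2 * ‖v‖ ^ 2 := by
        rw [ht]; field_simp
      rw [hq]; linarith
    rw [h1]
    refine abs_le_of_sq_le_sq' ?_ (by positivity) |>.2
    rw [mul_pow, Real.sq_sqrt hq0]; exact h2
  have hta : maxNorm ((t : ℂ) • a) < ∞ := Subalgebra.smul_mem (finiteMax A) (show a ∈ finiteMax A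
    from ha) _
  have h1 : maxNorm (1 - (t : ℂ) • a) < ∞ := maxNorm_lt_top_of_bound hbound
  have h2 : ‖toMaxCStar (1 - (t : ℂ) • a) h1‖ < 1 := by
    rw [norm_toMaxCStar]
    have h3 : maxNorm (1 - (t : ℂ) • a) ≤ ENNReal.ofReal √q := iSup_le fun r => by
      rw [← ofReal_norm]; exact ENNReal.ofReal_le_ofReal (hbound r)
    have h4 := ENNReal.toReal_mono ENNReal.ofReal_ne_top h3
    rw [ENNReal.toReal_ofReal (Real.sqrt_nonneg _)] at h4
    exact h4.trans_lt ((Real.sqrt_lt' one_pos).2 (by rw [one_pow]; exact hq1))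
  -- The Neumann series inverts ta in the completion; it remains to divide by the scalar t.
  have h3 := isUnit_one_sub_of_norm_lt_one h2
  rw [toMaxCStar_one_sub _ hta, sub_sub_cancel] at h3
  have hinv : maxNorm (algebraMap ℂ A (t : ℂ)⁻¹) < ∞ := maxNorm_algebraMap _
  have hinv' : maxNorm (algebraMap ℂ A (t : ℂ)) < ∞ := maxNorm_algebraMap _
  have hone : maxNorm (1 : A) < ∞ := by simpa using maxNorm_algebraMap (A := A) 1
  have ht' : (t : ℂ) ≠ 0 := by exact_mod_cast ht0.ne'
  have hunit : IsUnit (toMaxCStar (algebraMap ℂ A (t : ℂ)⁻¹) hinv) := by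
    refine ⟨⟨toMaxCStar _ hinv, toMaxCStar _ hinv', ?_, ?_⟩, rfl⟩
    · rw [← toMaxCStar_mul _ _ hinv hinv' (by rw [← map_mul, inv_mul_cancel₀ ht', map_one]; exact hone)]
      simp only [← map_mul, inv_mul_cancel₀ ht', map_one]
      rfl
    · rw [← toMaxCStar_mul _ _ hinv' hinv (by rw [← map_mul, mul_inv_cancel₀ ht', map_one]; exact hone)]
      simp only [← map_mul, mul_inv_cancel₀ ht', map_one]
      rfl
  have h4 := hunit.mul h3
  have h5 : algebraMap ℂ A (t : ℂ)⁻¹ * (t : ℂ) • a = a := by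
    rw [← Algebra.smul_def, smul_smul, inv_mul_cancel₀ ht', one_smul]
  rw [← toMaxCStar_mul _ _ hinv hta (by rw [h5]; exact ha)] at h4
  simpa only [h5] using h4

end RepLemmas

end

end CoarseAmenable

namespace CoarseAmenable

noncomputable section

open CoarseSpace

/-! ### Blocking collections and functions with integral zero over the blocks -/

section BlockSets

variable {X : Type u} [CoarseSpace X] [MeasurableSpace X] {μ : Measure X}

/-- The union of the squares of the members of a family of sets. -/
def blockSet {X : Type*} (𝒜 : Set (Set X)) : Set (X × X) := {p | ∃ A ∈ 𝒜, p.1 ∈ A ∧ p.2 ∈ A}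

theorem symm_blockSet (𝒜 : Set (Set X)) : Symm (blockSet 𝒜) := by
  ext ⟨x, y⟩
  exact ⟨fun ⟨A, hA, h1, h2⟩ => ⟨A, hA, h2, h1⟩, fun ⟨A, hA, h1, h2⟩ => ⟨A, hA, h2, h1⟩⟩

variable {𝒜 : Set (Set X)}

theorem slice_blockSet (hd : 𝒜.PairwiseDisjoint id) {A : Set X} (hA : A ∈ 𝒜) {x : X}
    (hx : x ∈ A) : slice (blockSet 𝒜) x = A := by
  ext y
  constructor
  · rintro ⟨B, hB, h1, h2⟩
    rwa [hd.elim_set hA hB x hx h2]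
  · intro hy; exact ⟨A, hA, hy, hx⟩

theorem slice_blockSet_eq_empty {x : X} (hx : x ∉ ⋃₀ 𝒜) : slice (blockSet 𝒜) x = ∅ := by
  rw [Set.eq_empty_iff_forall_notMem]
  rintro y ⟨B, hB, -, h2⟩
  exact hx ⟨B, hB, h2⟩

theorem measurableSet_blockSet (hc : 𝒜.Countable) (hm : ∀ A ∈ 𝒜, MeasurableSet A) :
    MeasurableSet (blockSet 𝒜) := by
  have : blockSet 𝒜 = ⋃ A ∈ 𝒜, A ×ˢ A := by
    ext ⟨x, y⟩
    simp only [Set.mem_iUnion, exists_prop]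
    exact Iff.rfl
  rw [this]
  exact MeasurableSet.biUnion hc fun A hA => (hm A hA).prod (hm A hA)

theorem measRel_blockSet (hc : 𝒜.Countable) (hm : ∀ A ∈ 𝒜, MeasurableSet A) :
    MeasRel (blockSet 𝒜) := by
  intro U _
  have : nhd (blockSet 𝒜) U = ⋃ A ∈ {A ∈ 𝒜 | (A ∩ U).Nonempty}, A := by
    ext y
    simp only [Set.mem_iUnion]
    constructor
    · rintro ⟨x, hx, A, hA, h1, h2⟩; exact ⟨A, ⟨hA, x, h2, hx⟩, h1⟩
    · rintro ⟨A, ⟨hA, x, h2, hx⟩, h1⟩; exact ⟨x, hx, A, hA, h1, h2⟩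
  rw [this]
  exact MeasurableSet.biUnion (hc.mono fun A hA => hA.1) fun A hA => hm A hA.1

theorem Admissible.sigmaFinite [MeasurableSingletonClass X] (h : Admissible μ) :
    SigmaFinite μ := by
  obtain ⟨b, hb⟩ := h.exists_blockMap
  exact hb.sigmaFinite h

theorem Blocking.measurableSet (h𝒜 : Blocking μ 𝒜) : ∀ A ∈ 𝒜, MeasurableSet A := by
  obtain ⟨-, E, -, ε, -, h⟩ := h𝒜
  exact fun A hA => (h A hA).1

theorem Blocking.countable [SFinite μ] (h𝒜 : Blocking μ 𝒜) : 𝒜.Countable := by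
  obtain ⟨hd, E, -, ε, hε, h⟩ := h𝒜
  have h1 := Measure.countable_meas_pos_of_disjoint_iUnion (μ := μ) (As := fun A : 𝒜 => (A : Set X))
    (fun A => (h A A.2).1) (fun A B hAB => hd A.2 B.2 fun h => hAB (Subtype.ext h))
  have h2 : {A : 𝒜 | 0 < μ (A : Set X)} = Set.univ := Set.eq_univ_of_forall fun A =>
    (ENNReal.coe_pos.2 hε).trans_le (h A A.2).2.2
  rw [h2] at h1
  exact Set.countable_coe_iff.1 (Set.countable_univ_iff.1 h1)

theorem Blocking.controlled (h𝒜 : Blocking μ 𝒜) : Controlled (blockSet 𝒜) := by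
  obtain ⟨-, E, hE, ε, -, h⟩ := h𝒜
  refine subset_mem _ _ hE ?_
  rintro ⟨x, y⟩ ⟨A, hA, hx, hy⟩
  exact (h A hA).2.1 ⟨hx, hy⟩

theorem Admissible.isKernel (h : Admissible μ) {E : Set (X × X)} (hm : MeasurableSet E)
    (hs : Symm E) (hc : Controlled E) : IsKernel μ E := by
  obtain ⟨C, hC⟩ := h.uniformlyBounded _ (comp_mem _ _ hc (inv_mem _ hc))
  refine ⟨hm, hs, C, fun x => hC _ (measurable_prodMk_right hm) ?_⟩
  rintro ⟨y, z⟩ ⟨hy, hz⟩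
  exact ⟨x, hy, hz⟩

theorem Blocking.isKernel [SFinite μ] (h : Admissible μ) (h𝒜 : Blocking μ 𝒜) :
    IsKernel μ (blockSet 𝒜) :=
  h.isKernel (measurableSet_blockSet h𝒜.countable h𝒜.measurableSet) (symm_blockSet 𝒜) h𝒜.controlled

theorem measRel_union_diag {E : Set (X × X)} (hE : MeasRel E) : MeasRel (E ∪ diag X) :=
  fun U hU => by rw [nhd_union, nhd_diag]; exact (hE U hU).union hU

theorem Blocking.toReal_measure_slice_ne_zero (h : Admissible μ) (h𝒜 : Blocking μ 𝒜) {A : Set X}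
    (hA : A ∈ 𝒜) {x : X} (hx : x ∈ A) : (μ (slice (blockSet 𝒜) x)).toReal ≠ 0 := by
  rw [slice_blockSet h𝒜.1 hA hx]
  obtain ⟨-, E, hE, ε, hε, hlow⟩ := h𝒜
  obtain ⟨C, hC⟩ := h.uniformlyBounded E hE
  obtain ⟨hAm, hAE, hAε⟩ := hlow A hA
  intro h0
  rcases (ENNReal.toReal_eq_zero_iff _).1 h0 with h0 | h0
  · rw [h0] at hAε
    exact hε.ne' (by simpa using hAε)
  · exact ENNReal.coe_ne_top (top_le_iff.1 (h0 ▸ hC A hAm hAE))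

section Functions

variable [SFinite μ]

/-- The function that equals `μ(A)⁻¹` on the members `A` of a blocking collection. -/
theorem Blocking.exists_weight (h : Admissible μ) (h𝒜 : Blocking μ 𝒜) :
    ∃ w : Lp ℂ ∞ μ, w =ᵐ[μ] fun x => ((μ (slice (blockSet 𝒜) x)).toReal : ℂ)⁻¹ := by
  have hk := h𝒜.isKernel h
  have hd := h𝒜.1
  obtain ⟨C, hC⟩ := hk.bound
  obtain ⟨ε, hε, hlow⟩ : ∃ ε : ℝ≥0, 0 < ε ∧ ∀ A ∈ 𝒜, (ε : ℝ≥0∞) ≤ μ A := by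
    obtain ⟨-, E, -, ε, hε, h⟩ := h𝒜
    exact ⟨ε, hε, fun A hA => (h A hA).2.2⟩
  have hmem : MemLp (fun x => ((μ (slice (blockSet 𝒜) x)).toReal : ℂ)⁻¹) ∞ μ := by
    refine memLp_top_of_bound ?_ (ε : ℝ)⁻¹ (Filter.Eventually.of_forall fun x => ?_)
    · exact ((Complex.measurable_ofReal.comp
        hk.measurable_measure_slice.ennreal_toReal).inv).aestronglyMeasurable
    · rw [norm_inv, Complex.norm_real, Real.norm_of_nonneg ENNReal.toReal_nonneg]
      by_cases hx : x ∈ ⋃₀ 𝒜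
      · obtain ⟨A, hA, hxA⟩ := hx
        rw [slice_blockSet hd hA hxA]
        refine inv_anti₀ (by exact_mod_cast hε) ?_
        have hfin : μ A ≠ ∞ := by
          rw [← slice_blockSet hd hA hxA]; exact ((hC x).trans_lt ENNReal.coe_lt_top).ne
        exact ENNReal.toReal_mono hfin (hlow A hA)
      · rw [slice_blockSet_eq_empty hx]
        simp
  exact ⟨hmem.toLp, hmem.coeFn_toLp⟩

theorem exists_mul (f g : Lp ℂ ∞ μ) : ∃ k : Lp ℂ ∞ μ, k =ᵐ[μ] fun x => f x * g x := by
  refine ⟨(f • g : Lp ℂ ∞ μ), ?_⟩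
  filter_upwards [Lp.coeFn_lpSMul (r := ∞) f g] with x hx
  rw [hx]; rfl

theorem Blocking.setIntegral_weight_mul {w f g : Lp ℂ ∞ μ}
    (hw : w =ᵐ[μ] fun x => ((μ (slice (blockSet 𝒜) x)).toReal : ℂ)⁻¹)
    (hg : g =ᵐ[μ] fun x => w x * f x) (h𝒜 : Blocking μ 𝒜)
    (hint : ∀ A ∈ 𝒜, ∫ x in A, f x ∂μ = 0) : ∀ A ∈ 𝒜, ∫ x in A, g x ∂μ = 0 := by
  intro A hA
  have h1 : ∫ x in A, g x ∂μ = ∫ x in A, ((μ A).toReal : ℂ)⁻¹ * f x ∂μ := by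
    refine setIntegral_congr_ae (h𝒜.measurableSet A hA) ?_
    filter_upwards [hg, hw] with x h1 h2 hx
    rw [h1, h2, slice_blockSet h𝒜.1 hA hx]
  rw [h1, integral_const_mul, hint A hA, mul_zero]

theorem Blocking.setIntegral_slice_eq_zero {g : Lp ℂ ∞ μ} (h𝒜 : Blocking μ 𝒜)
    (hint : ∀ A ∈ 𝒜, ∫ x in A, g x ∂μ = 0) (x : X) :
    ∫ y in slice (blockSet 𝒜) x, g y ∂μ = 0 := by
  by_cases hx : x ∈ ⋃₀ 𝒜
  · obtain ⟨A, hA, hxA⟩ := hx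
    rw [slice_blockSet h𝒜.1 hA hxA]
    exact hint A hA
  · rw [slice_blockSet_eq_empty hx]; simp

/-- Multiplication by a function with integral zero over the members of a blocking collection
vanishes between the integral operators. -/
theorem Blocking.kerOp_mul_kerOp {g : Lp ℂ ∞ μ} (h𝒜 : Blocking μ 𝒜)
    (hk : IsKernel μ (blockSet 𝒜)) (hint : ∀ A ∈ 𝒜, ∫ x in A, g x ∂μ = 0) :
    kerOp hk * (mulOp μ g * kerOp hk) = 0 := by
  refine op_ext fun ξ => ?_
  have h0 : (kerOp hk * (mulOp μ g * kerOp hk)) ξ = kerOp hk (mulOp μ g (kerOp hk ξ)) := rfl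
  have h0' : (0 : Op μ) ξ = 0 := rfl
  rw [h0, h0']
  filter_upwards [kerOp_apply hk (mulOp μ g (kerOp hk ξ)), Lp.coeFn_zero ℂ 2 μ] with x h1 h2
  rw [h1, h2, Pi.zero_apply]
  -- The image of the integral operator is constant on each block, so it leaves the integral and
  -- only the block integral of `g` remains.
  have h3 : ∫ y in slice (blockSet 𝒜) x, (mulOp μ g (kerOp hk ξ)) y ∂μ =
      ∫ y in slice (blockSet 𝒜) x, g y * ∫ z in slice (blockSet 𝒜) x, ξ z ∂μ ∂μ := by
    refine setIntegral_congr_ae (hk.measurableSet_slice x) ?_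
    filter_upwards [mulOp_apply g (kerOp hk ξ), kerOp_apply hk ξ] with y h4 h5 hy
    rw [h4, h5]
    obtain ⟨A, hA, hyA, hxA⟩ := hy
    rw [slice_blockSet h𝒜.1 hA hyA, slice_blockSet h𝒜.1 hA hxA]
  rw [h3, integral_mul_const, h𝒜.setIntegral_slice_eq_zero hint, zero_mul]

/-- A function with integral zero over the members of a blocking collection is a combination of
left and right multiples of the Laplacian. -/
theorem Blocking.exists_mulOp_eq (h : Admissible μ) (h𝒜 : Blocking μ 𝒜)
    (hk : IsKernel μ (blockSet 𝒜)) {f : Lp ℂ ∞ μ} (hint : ∀ A ∈ 𝒜, ∫ x in A, f x ∂μ = 0)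
    (hsupp : ∀ᵐ x ∂μ, x ∉ ⋃₀ 𝒜 → f x = 0) :
    ∃ g q : Lp ℂ ∞ μ, mulOp μ f = mulOp μ g * lap hk + lap hk * (mulOp μ q * kerOp hk) := by
  obtain ⟨w, hw⟩ := h𝒜.exists_weight h
  obtain ⟨g, hg⟩ := exists_mul w f
  obtain ⟨q, hq⟩ := exists_mul w g
  -- Write D for the degree, K for the integral operator and Δ = D - K. On the blocks f = gD and g =
  -- Dq, so gΔ = f - gK and Δ(qK) = gK - KqK. The last term vanishes because q has integral zero
  -- over the blocks, and the sum is f.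
  refine ⟨g, q, ?_⟩
  have hgint := Blocking.setIntegral_weight_mul hw hg h𝒜 hint
  have hqint := Blocking.setIntegral_weight_mul hw hq h𝒜 hgint
  have h1 : mulOp μ g * mulOp μ (degree hk) = mulOp μ f := by
    refine mulOp_mul ?_
    filter_upwards [hg, hw, coeFn_degree hk, hsupp] with x h1 h2 h3 h4
    rw [h1, h2, h3]
    by_cases hx : (μ (slice (blockSet 𝒜) x)).toReal = 0
    · rw [hx]
      simp only [Complex.ofReal_zero, mul_zero]
      exact h4 fun ⟨A, hA, hxA⟩ => h𝒜.toReal_measure_slice_ne_zero h hA hxA hx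
    · have : ((μ (slice (blockSet 𝒜) x)).toReal : ℂ) ≠ 0 := by exact_mod_cast hx
      field_simp
  have h2 : mulOp μ (degree hk) * mulOp μ q = mulOp μ g := by
    refine mulOp_mul ?_
    filter_upwards [hg, hq, hw, coeFn_degree hk] with x h1 h2 h3 h4
    rw [h2, h1, h3, h4]
    by_cases hx : (μ (slice (blockSet 𝒜) x)).toReal = 0
    · rw [hx]; simp
    · have : ((μ (slice (blockSet 𝒜) x)).toReal : ℂ) ≠ 0 := by exact_mod_cast hx
      field_simp
  have h3 := h𝒜.kerOp_mul_kerOp hk hqint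
  rw [lap, mul_sub, sub_mul, h1, h3, sub_zero, ← mul_assoc, h2]
  abel

end Functions

end BlockSets

end

end CoarseAmenable

namespace CoarseAmenable

noncomputable section

open CoarseSpace

/-! ### Estimates for vectors in a representation -/

section RepLemmas

variable {A : Type u} [Ring A] [StarRing A] [Algebra ℂ A]

theorem Rep.re_inner_add (r : Rep A) {S T U : A} (hS : S = T + U) (v : r.H) :
    (inner ℂ v (r.ρ S v)).re = (inner ℂ v (r.ρ T v)).re + (inner ℂ v (r.ρ U v)).re := by
  rw [hS, r.map_add_apply, inner_add_right, Complex.add_re]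

theorem Rep.inner_star_mul_self (r : Rep A) (R : A) (v : r.H) :
    inner ℂ v (r.ρ (star R * R) v) = ((‖r.ρ R v‖ ^ 2 : ℝ) : ℂ) := by
  rw [r.map_mul_apply, r.inner_map_star, inner_self_eq_norm_sq_to_K]
  push_cast; rfl

theorem Rep.inner_nonneg_of_eq (r : Rep A) {S R : A} (hS : S = star R * R) (v : r.H) :
    0 ≤ inner ℂ v (r.ρ S v) := by
  rw [hS, r.inner_star_mul_self]
  exact Complex.zero_le_real.2 (sq_nonneg _)

theorem Rep.re_inner_nonneg_of_eq (r : Rep A) {S R : A} (hS : S = star R * R) (v : r.H) :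
    0 ≤ (inner ℂ v (r.ρ S v)).re :=
  (Complex.nonneg_iff.1 (r.inner_nonneg_of_eq hS v)).1

theorem Rep.inner_eq_one (r : Rep A) {S : A} (hS : S = 1) {v : r.H} (hv : ‖v‖ = 1) :
    inner ℂ v (r.ρ S v) = 1 := by
  rw [hS, r.map_one_apply, inner_self_eq_norm_sq_to_K, hv]
  simp

theorem Rep.norm_inner_le_maxNorm (r : Rep A) {S : A} (hS : maxNorm S < ∞) {v : r.H}
    (hv : ‖v‖ = 1) : ‖inner ℂ v (r.ρ S v)‖ ≤ (maxNorm S).toReal := by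
  refine (norm_inner_le_norm _ _).trans ?_
  rw [hv, one_mul]
  refine ((r.ρ S).le_opNorm v).trans ?_
  rw [hv, mul_one]
  exact r.norm_le_maxNorm hS

theorem Rep.apply_eq_zero (r : Rep A) {S T : A} {v : r.H} (h : r.ρ S v = r.ρ T v) (hT : T = 0) :
    r.ρ S v = 0 := by
  rw [h, hT, map_zero]; rfl

theorem Rep.apply_smul_eq (r : Rep A) {S T : A} {v : r.H} (h : r.ρ S v = r.ρ T v) (c : ℂ) :
    r.ρ S (c • v) = r.ρ T (c • v) := by
  rw [map_smul, map_smul, h]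

/-- The algebra behind invariance of the mean: ⟨u, Gu⟩ = ⟨u, TFu⟩ = ⟨T*u, Fu⟩ = ⟨Ku, Fu⟩ = ⟨u,
K*Fu⟩. -/
theorem Rep.inner_eq_of_apply_eq (r : Rep A) {u : r.H} {T F G K P Q : A} (hP : P = T * F)
    (hQ : Q = star K * F) (h1 : r.ρ P u = r.ρ G u) (h2 : r.ρ (star T) u = r.ρ K u) :
    inner ℂ u (r.ρ G u) = inner ℂ u (r.ρ Q u) := by
  rw [← h1, hP, hQ, r.map_mul_apply, r.map_mul_apply, r.inner_map_star, ← h2, ← r.inner_map_star,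
    star_star]

/-- Small energy ⟨v, Dv⟩ = ‖Rv‖² forces Dv = R*Rv to be of order √δ. In GD + DS the factor D can be
applied to one of the two copies of v in either term, so the matrix coefficient is of order √δ. -/
theorem Rep.norm_inner_le_of_eq (r : Rep A) {v : r.H} (hv : ‖v‖ = 1) {F G D S R : A}
    (hF : F = G * D + D * S) (hR : D = star R * R) (hs : star D = D) (hGm : maxNorm G < ∞)
    (hSm : maxNorm S < ∞) (hRm : maxNorm (star R) < ∞) {δ : ℝ}
    (hδ : (inner ℂ v (r.ρ D v)).re ≤ δ) :
    ‖inner ℂ v (r.ρ F v)‖ ≤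
      ((maxNorm G).toReal + (maxNorm S).toReal) * ((maxNorm (star R)).toReal * √δ) := by
  have h1 : ‖r.ρ R v‖ ≤ √δ := by
    rw [hR, r.inner_star_mul_self, Complex.ofReal_re] at hδ
    exact Real.le_sqrt_of_sq_le hδ
  have h2 : ‖r.ρ D v‖ ≤ (maxNorm (star R)).toReal * √δ := by
    rw [hR, r.map_mul_apply]
    refine (r.ρ (star R)).le_opNorm_of_le h1 |>.trans ?_
    exact mul_le_mul_of_nonneg_right (r.norm_le_maxNorm hRm) (Real.sqrt_nonneg _)
  have h3 : inner ℂ v (r.ρ (D * S) v) = inner ℂ (r.ρ D v) (r.ρ S v) := by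
    rw [r.map_mul_apply, ← hs, r.inner_map_star, hs]
  have h4 : ‖r.ρ S v‖ ≤ (maxNorm S).toReal := by
    have := (r.ρ S).le_opNorm v
    rw [hv, mul_one] at this
    exact this.trans (r.norm_le_maxNorm hSm)
  have h5 : ‖r.ρ (G * D) v‖ ≤ (maxNorm G).toReal * ((maxNorm (star R)).toReal * √δ) := by
    rw [r.map_mul_apply]
    refine (r.ρ G).le_opNorm_of_le h2 |>.trans ?_
    exact mul_le_mul_of_nonneg_right (r.norm_le_maxNorm hGm) (by positivity)
  rw [hF, r.map_add_apply, inner_add_right, h3]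
  refine (norm_add_le _ _).trans ?_
  have h6 := norm_inner_le_norm (𝕜 := ℂ) v (r.ρ (G * D) v)
  rw [hv, one_mul] at h6
  have h7 := norm_inner_le_norm (𝕜 := ℂ) (r.ρ D v) (r.ρ S v)
  have h8 := mul_le_mul h2 h4 (norm_nonneg _) (by positivity)
  linarith

/-- The vector functional of a representation, pulled back along a linear map. -/
def Rep.vecFunctional {V : Type*} [AddCommGroup V] [Module ℂ V] (r : Rep A) (m : V →ₗ[ℂ] A)
    (v : r.H) : V →ₗ[ℂ] ℂ where
  toFun f := inner ℂ v (r.ρ (m f) v)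
  map_add' f g := by rw [map_add, r.map_add_apply, inner_add_right]
  map_smul' c f := by rw [map_smul, r.map_smul_apply, inner_smul_right]; rfl

end RepLemmas

/-! ### Laplacians that are positive in all representations -/

section Laplacians

variable {X : Type u} [CoarseSpace X] [MeasurableSpace X] [MeasurableSingletonClass X]
  {μ : Measure X} [SFinite μ] (h : Admissible μ)

/-- The Laplacian of a controlled kernel, as an element of `ℂ_cs[X]`. -/
def lapCs {E : Set (X × X)} (hE : IsKernel μ E) (hc : Controlled E) : Ccs h :=
  ⟨lap hE, by
    obtain ⟨F, hFc, -, hFm, hEF⟩ := h.exists_symm (union_mem _ _ hc (diag_mem (X := X)))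
    exact ⟨F, hFm, hFc, supportedOn_lap hE hFm (Set.subset_union_left.trans hEF)
      (Set.subset_union_right.trans hEF)⟩⟩

/-- The integral operator of a controlled kernel, as an element of `ℂ_cs[X]`. -/
def kerCs {E : Set (X × X)} (hE : IsKernel μ E) (hc : Controlled E) : Ccs h :=
  ⟨kerOp hE, by
    obtain ⟨F, hFc, -, hFm, hEF⟩ := h.exists_symm hc
    exact ⟨F, hFm, hFc, supportedOn_kerOp hE hFm hEF⟩⟩

/-- The Laplacians of all subkernels of `E` are positive in all representations. -/
def RepPositive (E : Set (X × X)) : Prop :=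
  ∀ (G : Set (X × X)) (hG : IsKernel μ G) (hGc : Controlled G), G ⊆ E →
    ∀ (r : Rep (Ccs h)) (v : r.H), 0 ≤ (inner ℂ v (r.ρ (lapCs h hG hGc) v)).re

variable {h}

theorem re_inner_lapCs_union {E F G : Set (X × X)} (hE : IsKernel μ E) (hEc : Controlled E)
    (hF : IsKernel μ F) (hFc : Controlled F) (hG : IsKernel μ G) (hGc : Controlled G)
    (hEFG : E = F ∪ G) (hd : Disjoint F G) (r : Rep (Ccs h)) (v : r.H) :
    (inner ℂ v (r.ρ (lapCs h hE hEc) v)).re =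
      (inner ℂ v (r.ρ (lapCs h hF hFc) v)).re + (inner ℂ v (r.ρ (lapCs h hG hGc) v)).re :=
  r.re_inner_add (Subtype.ext (lap_union hE hF hG hEFG hd)) v

theorem symm_inter {E F : Set (X × X)} (hE : Symm E) (hF : Symm F) : Symm (E ∩ F) := by
  ext p
  exact ⟨fun hp => ⟨symm_mem hE hp.1, symm_mem hF hp.2⟩,
    fun hp => ⟨symm_mem hE hp.1, symm_mem hF hp.2⟩⟩

theorem symm_diff {E F : Set (X × X)} (hE : Symm E) (hF : Symm F) : Symm (E \ F) := by
  ext p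
  exact ⟨fun hp => ⟨symm_mem hE hp.1, fun h => hp.2 (symm_mem hF h)⟩,
    fun hp => ⟨symm_mem hE hp.1, fun h => hp.2 (symm_mem hF h)⟩⟩

theorem symm_union {E F : Set (X × X)} (hE : Symm E) (hF : Symm F) : Symm (E ∪ F) := by
  ext p
  exact ⟨fun hp => hp.imp (symm_mem hE) (symm_mem hF), fun hp => hp.imp (symm_mem hE) (symm_mem hF)⟩

/-- A subkernel G is the disjoint union of G ∩ E and G \ E, and Laplacians are additive over
disjoint unions. This splitting is the reason why `RepPositive` speaks of all subkernels. -/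
theorem RepPositive.union {E F : Set (X × X)} (hE : RepPositive h E) (hF : RepPositive h F)
    (hEm : MeasurableSet E) (hEs : Symm E) : RepPositive h (E ∪ F) := by
  intro G hG hGc hGE r v
  have h1 : IsKernel μ (G ∩ E) :=
    hG.mono (hG.meas.inter hEm) (symm_inter hG.symm hEs) Set.inter_subset_left
  have h2 : IsKernel μ (G \ E) :=
    hG.mono (hG.meas.diff hEm) (symm_diff hG.symm hEs) Set.sdiff_subset
  refine le_of_le_of_eq ?_ (re_inner_lapCs_union hG hGc h1
    (subset_mem _ _ hGc Set.inter_subset_left) h2 (subset_mem _ _ hGc Set.sdiff_subset)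
    (Set.inter_union_sdiff G E).symm (Set.disjoint_left.2 fun p h h' => h'.2 h.2) r v).symm
  refine add_nonneg (hE _ h1 _ Set.inter_subset_right r v) (hF _ h2 _ ?_ r v)
  exact fun p hp => (hGE hp.1).resolve_left hp.2

/-- The difference of the two Laplacians is that of the subkernel E \ F of E, which is positive by
hypothesis. -/
theorem RepPositive.re_inner_mono {E F : Set (X × X)} (hE : RepPositive h E) (hEk : IsKernel μ E)
    (hEc : Controlled E) (hF : IsKernel μ F) (hFc : Controlled F) (hFE : F ⊆ E)
    (r : Rep (Ccs h)) (v : r.H) :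
    (inner ℂ v (r.ρ (lapCs h hF hFc) v)).re ≤ (inner ℂ v (r.ρ (lapCs h hEk hEc) v)).re := by
  have h1 : IsKernel μ (E \ F) :=
    hEk.mono (hEk.meas.diff hF.meas) (symm_diff hEk.symm hF.symm) Set.sdiff_subset
  refine le_of_le_of_eq ?_ (re_inner_lapCs_union hEk hEc hF hFc h1
    (subset_mem _ _ hEc Set.sdiff_subset) (Set.union_sdiff_cancel hFE).symm
    (Set.disjoint_left.2 fun p h h' => h'.2 h) r v).symm
  exact le_add_of_nonneg_right (hE _ h1 _ Set.sdiff_subset r v)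

theorem exists_star_mul_self_lapCs {F : Set (X × X)} (hFm : MeasRel F) (hc : Controlled F)
    (hd : diag X ⊆ F) (hs : Symm F) (ht : comp F F ⊆ F) {G : Set (X × X)} (hG : IsKernel μ G)
    (hGc : Controlled G) (hGF : G ⊆ F) : ∃ R : Ccs h, lapCs h hG hGc = star R * R :=
  exists_star_mul_self_of_supportedOn hc hd hs ht (S := lapCs h hG hGc)
    (supportedOn_lap hG hFm hGF hd) (lap_nonneg hG)

theorem repPositive_of_equiv {F : Set (X × X)} (hFm : MeasRel F) (hc : Controlled F)
    (hd : diag X ⊆ F) (hs : Symm F) (ht : comp F F ⊆ F) {E : Set (X × X)} (hEF : E ⊆ F) :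
    RepPositive h E := by
  intro G hG hGc hGE r v
  have hex := exists_star_mul_self_lapCs (h := h) hFm hc hd hs ht hG hGc (hGE.trans hEF)
  obtain ⟨R, hR⟩ := hex
  exact r.re_inner_nonneg_of_eq hR v

section Blocks

variable {𝒜 : Set (Set X)}

theorem Blocking.comp_subset (h𝒜 : Blocking μ 𝒜) :
    comp (blockSet 𝒜 ∪ diag X) (blockSet 𝒜 ∪ diag X) ⊆ blockSet 𝒜 ∪ diag X := by
  rintro ⟨x, z⟩ ⟨y, hxy, hyz⟩
  rcases hxy with hxy | hxy
  · rcases hyz with hyz | hyz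
    · obtain ⟨A, hA, hxA, hyA⟩ := hxy
      obtain ⟨B, hB, hyB, hzB⟩ := hyz
      obtain rfl := h𝒜.1.elim_set hA hB y hyA hyB
      exact Or.inl ⟨A, hA, hxA, hzB⟩
    · obtain rfl : y = z := hyz
      exact Or.inl hxy
  · obtain rfl : x = y := hxy
    exact hyz

theorem symm_diag : Symm (diag X) := by
  ext p; exact eq_comm

theorem Blocking.exists_star_mul_self (h𝒜 : Blocking μ 𝒜) {G : Set (X × X)} (hG : IsKernel μ G)
    (hGc : Controlled G) (hGF : G ⊆ blockSet 𝒜) : ∃ R : Ccs h, lapCs h hG hGc = star R * R :=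
  exists_star_mul_self_lapCs (measRel_union_diag (measRel_blockSet h𝒜.countable h𝒜.measurableSet))
    (union_mem _ _ h𝒜.controlled diag_mem) Set.subset_union_right
    (symm_union (symm_blockSet 𝒜) symm_diag) h𝒜.comp_subset hG hGc
    (hGF.trans Set.subset_union_left)

theorem Blocking.repPositive (h𝒜 : Blocking μ 𝒜) : RepPositive h (blockSet 𝒜) :=
  repPositive_of_equiv (measRel_union_diag (measRel_blockSet h𝒜.countable h𝒜.measurableSet))
    (union_mem _ _ h𝒜.controlled diag_mem) Set.subset_union_right
    (symm_union (symm_blockSet 𝒜) symm_diag) h𝒜.comp_subset Set.subset_union_left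

/-- Finitely many blocking collections are contained in a common gordo set whose Laplacian is
positive in all representations. -/
theorem exists_gordo_repPositive (s : Finset (Set (Set X))) (hs : ∀ 𝒜 ∈ s, Blocking μ 𝒜) :
    ∃ E, Gordo μ E ∧ MeasurableSet E ∧ RepPositive h E ∧ ∀ 𝒜 ∈ s, blockSet 𝒜 ⊆ E := by
  classical
  induction s using Finset.induction_on with
  | empty =>
    -- The members of a blocking collection need not cover X; starting from the full block partition
    -- ensures the lower bound on all slices.
    obtain ⟨b, hb⟩ := h.exists_blockMap
    obtain ⟨ε, hε, hlow⟩ := hb.lower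
    have hsymm : Symm {p : X × X | b p.1 = b p.2} := by ext p; exact eq_comm
    have hm : MeasRel {p : X × X | b p.1 = b p.2} := hb.measRel fun i j => i = j
    refine ⟨{p | b p.1 = b p.2}, ⟨hb.controlled, hsymm, hm, ε, hε, hlow⟩, ?_, ?_, by simp⟩
    · exact measurableSet_eq_fun (hb.meas.comp measurable_fst) (hb.meas.comp measurable_snd)
    · refine repPositive_of_equiv hm hb.controlled (fun p hp => congrArg b hp) hsymm ?_ le_rfl
      rintro ⟨x, y⟩ ⟨z, h1, h2⟩; exact Eq.trans h1 h2
  | insert 𝒜 s _ ih =>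
    obtain ⟨E, hE, hEm, hEp, hEs⟩ := ih fun ℬ hℬ => hs ℬ (Finset.mem_insert_of_mem hℬ)
    have h𝒜 := hs 𝒜 (Finset.mem_insert_self _ _)
    obtain ⟨ε, hε, hlow⟩ := hE.lower
    refine ⟨E ∪ blockSet 𝒜, ⟨union_mem _ _ hE.controlled h𝒜.controlled,
      symm_union hE.symm (symm_blockSet 𝒜), fun U hU => ?_, ε, hε, fun x => ?_⟩, ?_, ?_, ?_⟩
    · rw [nhd_union]
      exact (hE.meas U hU).union (measRel_blockSet h𝒜.countable h𝒜.measurableSet U hU)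
    · exact (hlow x).trans (measure_mono fun y hy => Or.inl hy)
    · exact hEm.union (measurableSet_blockSet h𝒜.countable h𝒜.measurableSet)
    · exact hEp.union h𝒜.repPositive hEm hE.symm
    · intro ℬ hℬ
      rcases Finset.mem_insert.1 hℬ with rfl | hℬ
      · exact Set.subset_union_right
      · exact (hEs ℬ hℬ).trans Set.subset_union_left

end Blocks

end Laplacians

/-! ### From constant vectors to means and spectra, and from means or spectra to amenability -/

section Implications

variable {X : Type u} [CoarseSpace X] [MeasurableSpace X] [MeasurableSingletonClass X]
  {μ : Measure X} {h : Admissible μ}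

theorem exists_mulCs_eq_star_mul_self {f : Lp ℂ ∞ μ} (hf : ∀ᵐ x ∂μ, 0 ≤ f x) :
    ∃ g : Lp ℂ ∞ μ, mulCs h f = star (mulCs h g) * mulCs h g := by
  have hmeas : AEStronglyMeasurable (fun x => ((√(f x).re : ℝ) : ℂ)) μ :=
    (Complex.measurable_ofReal.comp (Real.continuous_sqrt.measurable.comp
      (Complex.measurable_re.comp (Lp.stronglyMeasurable f).measurable))).aestronglyMeasurable
  have hmem : MemLp (fun x => ((√(f x).re : ℝ) : ℂ)) ∞ μ := by
    refine memLp_top_of_bound hmeas √‖f‖ ?_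
    filter_upwards [ae_le_eLpNormEssSup (f := f) (μ := μ)] with x hx
    replace hx : ‖f x‖ ≤ ‖f‖ := by
      rw [Lp.norm_def, eLpNorm_exponent_top, ← toReal_enorm]
      refine ENNReal.toReal_mono ?_ hx
      rw [← eLpNorm_exponent_top]
      exact (Lp.memLp f).2.ne
    rw [Complex.norm_real, Real.norm_of_nonneg (Real.sqrt_nonneg _)]
    exact Real.sqrt_le_sqrt (((Complex.re_le_norm _)).trans hx)
  have hco := hmem.coeFn_toLp
  refine ⟨hmem.toLp, Subtype.ext ?_⟩
  show mulOp μ f = star (mulOp μ hmem.toLp) * mulOp μ hmem.toLp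
  rw [star_mulOp (g := hmem.toLp), mulOp_mul (k := f)]
  · filter_upwards [hf, hco] with x hx h1
    rw [h1, ← Complex.ofReal_mul, Real.mul_self_sqrt (Complex.nonneg_iff.1 hx).1]
    exact Complex.ext rfl (by simpa using (Complex.nonneg_iff.1 hx).2.symm)
  · filter_upwards [hco] with x h1
    rw [h1]; simp

/-- The multiplication operators, as a linear map. -/
def mulLin (h : Admissible μ) : Lp ℂ ∞ μ →ₗ[ℂ] Ccs h where
  toFun f := mulCs h f
  map_add' f g := Subtype.ext (mulOp_add f g)
  map_smul' c f := Subtype.ext (mulOp_smul c f)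

theorem isMean_vecFunctional (r : Rep (Ccs h)) {v : r.H} (hv : ‖v‖ = 1) :
    IsMean μ (r.vecFunctional (mulLin h) v) := by
  refine ⟨fun f hf => ?_, ?_⟩
  · have hex := exists_mulCs_eq_star_mul_self (h := h) hf
    obtain ⟨g, hg⟩ := hex
    exact r.inner_nonneg_of_eq hg v
  · exact r.inner_eq_one (Subtype.ext (mulOp_eq_one (MemLp.coeFn_toLp _))) hv

theorem norm_vecFunctional_le (r : Rep (Ccs h)) {v : r.H} (hv : ‖v‖ = 1) (f : Lp ℂ ∞ μ) :
    ‖r.vecFunctional (mulLin h) v f‖ ≤ (maxNorm (mulCs h f)).toReal :=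
  r.norm_inner_le_maxNorm (Ccs.maxNorm_lt_top _) hv

/-- A constant vector yields an invariant mean. -/
theorem ConstantVector.exists_mean {r : Rep (Ccs h)} {v : r.H} (hv : v ≠ 0)
    (hc : ConstantVector r v) :
    ∃ φ : Lp ℂ ∞ μ →ₗ[ℂ] ℂ, IsMean μ φ ∧
      ∀ (T : Ccs h) (k f g : Lp ℂ ∞ μ), PhiEq (star T) k →
        LocMapsTo T f g → φ g = φ ((star k) • f : Lp ℂ ∞ μ) := by
  have hv0 : ‖v‖ ≠ 0 := norm_ne_zero_iff.2 hv
  have hu1 : ‖((‖v‖⁻¹ : ℝ) : ℂ) • v‖ = 1 := by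
    rw [norm_smul, Complex.norm_real, norm_inv, norm_norm, inv_mul_cancel₀ hv0]
  refine ⟨r.vecFunctional (mulLin h) (((‖v‖⁻¹ : ℝ) : ℂ) • v), isMean_vecFunctional r hu1,
    fun T k f g hk hg => ?_⟩
  have h3 : mulCs h (star k • f) = star (mulCs h k) * mulCs h f := by
    refine Subtype.ext ?_
    show mulOp μ (star k • f) = star (mulOp μ k) * mulOp μ f
    rw [star_mulOp (g := star k) (Lp.coeFn_star k)]
    exact Eq.symm <| mulOp_mul (Lp.coeFn_lpSMul (r := ∞) (star k) f)
  -- The constant vector is used twice: Φ(T M_f) = T f = g, so T M_f acts on it as M_g, and T* acts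
  -- on it as M_k.
  exact r.inner_eq_of_apply_eq rfl h3
    (r.apply_smul_eq (hc _ g (LocMapsTo.comp (phiEq_mulCs f) hg)) _)
    (r.apply_smul_eq (hc _ k hk) _)

/-- A constant vector forces `0` to be in the maximal spectrum of the Laplacians. -/
theorem ConstantVector.zero_mem_maxSpectrum (hX : Connected X) {r : Rep (Ccs h)} {v : r.H}
    (hv : v ≠ 0) (hc : ConstantVector r v) {E : Set (X × X)} (hE : Gordo μ E) {Δ : Ccs h}
    (hΔ : IsLaplacian E (Δ : Op μ)) : (0 : ℂ) ∈ maxSpectrum Δ := by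
  refine CoarseAmenable.zero_mem_maxSpectrum (Ccs.maxNorm_lt_top Δ) r hv ?_
  have h0 : PhiEq Δ (0 : Lp ℂ ∞ μ) := (hΔ.phiEq_zero hX hE).congr (Lp.coeFn_zero ℂ ∞ μ).symm
  exact r.apply_eq_zero (hc Δ 0 h0) (Subtype.ext mulOp_zero)

theorem locMapsTo_kerCs [SFinite μ] (hX : Connected X) {E : Set (X × X)} (hE : IsKernel μ E)
    (hEc : Controlled E) (hEm : MeasRel E) {f g : X → ℂ} (hf : LocL2 μ f) (hg : LocL2 μ g)
    (hfg : ∀ᵐ x ∂μ, g x = ∫ y in slice E x, f y ∂μ) : LocMapsTo (kerCs h hE hEc) f g := by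
  refine locMapsTo_of_local hX hf hg fun U hU hb => ⟨nhd E U, hEm U hU, hb.nhd hEc,
    fun V _ hV η hη => ?_⟩
  filter_upwards [kerOp_apply hE η, hfg] with x h1 h2 hx
  rw [h2]
  refine h1.trans ?_
  refine setIntegral_congr_ae (hE.measurableSet_slice x) ?_
  filter_upwards [hη] with y hy hyx
  rw [hy, Set.indicator_of_mem (hV ⟨x, hx, hyx⟩)]

/-- An invariant mean witnesses amenability. -/
theorem amenable_of_mean (h : Admissible μ) (hX : Connected X) {φ : Lp ℂ ∞ μ →ₗ[ℂ] ℂ}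
    (hφ : IsMean μ φ)
    (hinv : ∀ (T : Ccs h) (k f g : Lp ℂ ∞ μ), PhiEq (star T) k →
      LocMapsTo T f g → φ g = φ ((star k) • f : Lp ℂ ∞ μ)) : Amenable μ := by
  have := h.sigmaFinite
  refine ⟨φ, hφ, fun 𝒜 h𝒜 f hint hsupp => ?_⟩
  have hk := h𝒜.isKernel h
  obtain ⟨w, hw⟩ := h𝒜.exists_weight h
  obtain ⟨g, hg⟩ := exists_mul w f
  have hgint := Blocking.setIntegral_weight_mul hw hg h𝒜 hint
  have hEm := measRel_blockSet h𝒜.countable h𝒜.measurableSet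
  -- For T the integral operator of the blocks, with wf = f/μ(A) on each block A, one has T(wf) = 0,
  -- while Φ(T*) is the degree μ(A). Invariance gives 0 = φ(T(wf)) = φ(μ(A)·wf) = φ(f).
  have h1 : LocMapsTo (kerCs h hk h𝒜.controlled) g (0 : Lp ℂ ∞ μ) := by
    refine locMapsTo_kerCs hX hk h𝒜.controlled hEm (locL2_of_memLp_top h (Lp.memLp g))
      (locL2_of_memLp_top h (Lp.memLp _)) ?_
    filter_upwards [Lp.coeFn_zero ℂ ∞ μ] with x hx
    rw [hx, h𝒜.setIntegral_slice_eq_zero hgint]; rfl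
  have h2 : PhiEq (star (kerCs h hk h𝒜.controlled)) (degree hk) := by
    have h3 : star (kerCs h hk h𝒜.controlled) = kerCs h hk h𝒜.controlled :=
      Subtype.ext (star_kerOp hk)
    rw [h3]
    refine locMapsTo_kerCs hX hk h𝒜.controlled hEm (locL2_one h)
      (locL2_of_memLp_top h (Lp.memLp _)) ?_
    filter_upwards [coeFn_degree hk] with x hx
    rw [hx, setIntegral_const]
    simp [Measure.real]
  have h3 := hinv _ _ _ _ h2 h1
  rw [map_zero] at h3
  rw [h3]
  congr 1
  refine Lp.ext ?_
  filter_upwards [hg, hw, coeFn_degree hk, hsupp, Lp.coeFn_star (degree hk),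
    Lp.coeFn_lpSMul (r := ∞) (star (degree hk)) g] with x h1 h2 h3 h4 h5 h6
  rw [h6]
  show f x = (star (degree hk) : Lp ℂ ∞ μ) x • g x
  rw [h5, h1, h2, Pi.star_apply, h3]
  by_cases hx : (μ (slice (blockSet 𝒜) x)).toReal = 0
  · rw [hx]
    simp only [Complex.ofReal_zero, star_zero, zero_smul]
    exact h4 fun ⟨A, hA, hxA⟩ => h𝒜.toReal_measure_slice_ne_zero h hA hxA hx
  · have : ((μ (slice (blockSet 𝒜) x)).toReal : ℂ) ≠ 0 := by exact_mod_cast hx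
    simp only [RCLike.star_def, Complex.conj_ofReal, smul_eq_mul]
    field_simp

/-- Combines the factorization of M_f through the block Laplacian with `Rep.norm_inner_le_of_eq`.
The constant is built from maximal norms, hence does not depend on the representation, which will
vary along a net. -/
theorem Blocking.exists_norm_vecFunctional_le {𝒜 : Set (Set X)} (h𝒜 : Blocking μ 𝒜) [SFinite μ]
    {f : Lp ℂ ∞ μ} (hint : ∀ A ∈ 𝒜, ∫ x in A, f x ∂μ = 0)
    (hsupp : ∀ᵐ x ∂μ, x ∉ ⋃₀ 𝒜 → f x = 0) :
    ∃ C : ℝ, ∀ (r : Rep (Ccs h)) (v : r.H), ‖v‖ = 1 → ∀ δ : ℝ,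
      (inner ℂ v (r.ρ (lapCs h (h𝒜.isKernel h) h𝒜.controlled) v)).re ≤ δ →
        ‖r.vecFunctional (mulLin h) v f‖ ≤ C * √δ := by
  have hk := h𝒜.isKernel h
  have hex := h𝒜.exists_mulOp_eq h hk hint hsupp
  obtain ⟨g, q, hgq⟩ := hex
  have hex := h𝒜.exists_star_mul_self (h := h) hk h𝒜.controlled le_rfl
  obtain ⟨R, hR⟩ := hex
  refine ⟨((maxNorm (mulCs h g)).toReal + (maxNorm (mulCs h q * kerCs h hk h𝒜.controlled)).toReal) *
    (maxNorm (star R)).toReal, fun r v hv δ hδ => ?_⟩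
  rw [mul_assoc]
  exact r.norm_inner_le_of_eq hv (Subtype.ext hgq) hR (Subtype.ext (star_lap hk))
    (Ccs.maxNorm_lt_top _) (Ccs.maxNorm_lt_top _) (Ccs.maxNorm_lt_top _) hδ

/-- A gordo set containing all block sets of `s` has a Laplacian with a unit vector of energy below
δ in some representation, and by monotonicity the energy of each block Laplacian is smaller still.
The bound by `maxNorm` is there to make the ultralimit exist. -/
theorem exists_mean_of_zero_mem_maxSpectrum [SFinite μ]
    (hspec : ∀ E : Set (X × X), Gordo μ E → ∀ Δ : Ccs h, IsLaplacian E (Δ : Op μ) →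
      (0 : ℂ) ∈ maxSpectrum Δ) (s : Finset {𝒜 : Set (Set X) // Blocking μ 𝒜}) {δ : ℝ}
    (hδ : 0 < δ) :
    ∃ φ : Lp ℂ ∞ μ →ₗ[ℂ] ℂ, IsMean μ φ ∧ (∀ f, ‖φ f‖ ≤ (maxNorm (mulCs h f)).toReal) ∧
      ∀ 𝒜 ∈ s, ∀ (f : Lp ℂ ∞ μ) (C : ℝ), (∀ (r : Rep (Ccs h)) (v : r.H), ‖v‖ = 1 → ∀ δ : ℝ,
        (inner ℂ v (r.ρ (lapCs h (𝒜.2.isKernel h) 𝒜.2.controlled) v)).re ≤ δ →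
          ‖r.vecFunctional (mulLin h) v f‖ ≤ C * √δ) → ‖φ f‖ ≤ C * √δ := by
  classical
  have hex := exists_gordo_repPositive (h := h) (s.image Subtype.val) (by
    intro 𝒜 h𝒜
    obtain ⟨ℬ, -, rfl⟩ := Finset.mem_image.1 h𝒜
    exact ℬ.2)
  obtain ⟨E, hE, hEm, hEp, hEs⟩ := hex
  have hEk := h.isKernel hEm hE.symm hE.controlled
  have h0 := hspec E hE (lapCs h hEk hE.controlled) (isLaplacian_lap hEk)
  have hex := exists_re_inner_lt h0 hδ
  obtain ⟨r, v, hv, hlt⟩ := hex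
  refine ⟨r.vecFunctional (mulLin h) v, isMean_vecFunctional r hv, norm_vecFunctional_le r hv,
    fun 𝒜 h𝒜 f C hC => hC r v hv δ (le_trans ?_ hlt.le)⟩
  exact hEp.re_inner_mono hEk hE.controlled _ _ (hEs _ (Finset.mem_image_of_mem _ h𝒜)) r v

/-- If `0` is in the maximal spectrum of all Laplacians, then the space is amenable. -/
theorem amenable_of_zero_mem_maxSpectrum (h : Admissible μ)
    (hspec : ∀ E : Set (X × X), Gordo μ E → ∀ Δ : Ccs h, IsLaplacian E (Δ : Op μ) →
      (0 : ℂ) ∈ maxSpectrum Δ) : Amenable μ := by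
  classical
  have := h.sigmaFinite
  let ι := Finset {𝒜 : Set (Set X) // Blocking μ 𝒜} × ℕ
  have hpos : ∀ n : ℕ, 0 < 1 / ((n : ℝ) + 1) := fun n => by positivity
  -- The representations vary with the index, so only the induced functionals on L^∞ are kept and
  -- passed to the limit.
  choose F hF hFb hF0 using fun i : ι =>
    exists_mean_of_zero_mem_maxSpectrum (h := h) hspec i.1 (hpos i.2)
  have : Nonempty ι := ⟨(∅, 0)⟩
  obtain ⟨φ, hφ⟩ := exists_ultralimit (Ultrafilter.of (atTop : Filter ι)) F
    fun f => ⟨_, fun i => hFb i f⟩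
  refine ⟨φ, ⟨fun f hf => ?_, ?_⟩, fun 𝒜 h𝒜 f hint hsupp => ?_⟩
  · exact ge_of_tendsto' (hφ f) fun i => (hF i).1 f hf
  · refine tendsto_nhds_unique (hφ _) ?_
    simp only [(hF _).2]
    exact tendsto_const_nhds
  · refine tendsto_nhds_unique (hφ f) ?_
    have hex := h𝒜.exists_norm_vecFunctional_le (h := h) hint hsupp
    obtain ⟨C, hC⟩ := hex
    have hlim : Tendsto (fun n : ℕ => C * √(1 / ((n : ℝ) + 1))) atTop (𝓝 0) := by
      have h2 := (Real.continuous_sqrt.tendsto 0).comp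
        (tendsto_one_div_add_atTop_nhds_zero_nat (𝕜 := ℝ))
      rw [Real.sqrt_zero] at h2
      simpa using h2.const_mul C
    have hsnd : Tendsto (fun i : ι => i.2) atTop atTop := by
      rw [← prod_atTop_atTop_eq]; exact tendsto_snd
    refine squeeze_zero_norm' ?_ ((hlim.comp hsnd).mono_left (Ultrafilter.of_le _))
    refine (Ultrafilter.of_le (atTop : Filter ι)) ?_
    filter_upwards [eventually_ge_atTop (({⟨𝒜, h𝒜⟩}, 0) : ι)] with i hi
    exact hF0 i _ (hi.1 (Finset.mem_singleton_self _)) f C hC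

end Implications

end

end CoarseAmenable

namespace CoarseAmenable

noncomputable section

open CoarseSpace

/-! ### Hahn-Banach dichotomy and divergences of edge functions -/

section Edges

/-- Either `0` is a limit of convex combinations of the vectors, or the vectors are separated
from `0`. -/
theorem exists_small_combination_or_functional {V : Type*} [NormedAddCommGroup V] [NormedSpace ℝ V]
    (v : ℕ → V) (I : Set ℕ) :
    (∀ δ > 0, ∃ p : ℕ →₀ ℝ, (∀ i, 0 ≤ p i) ∧ ∑ i ∈ p.support, p i = 1 ∧ (∀ i ∉ I, p i = 0) ∧
      ‖Finsupp.linearCombination ℝ v p‖ < δ) ∨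
    ∃ (G : V →L[ℝ] ℝ) (u : ℝ), 0 < u ∧ ∀ i ∈ I, u ≤ G (v i) := by
  set ℓ := Finsupp.linearCombination ℝ fun _ : ℕ => (1 : ℝ) with hℓ
  -- The convex hull is the linear image of this simplex of weights, so that an approximating point
  -- comes with its coefficients.
  set K : Set (ℕ →₀ ℝ) := {p | (∀ i, 0 ≤ p i) ∧ ℓ p = 1 ∧ ∀ i ∉ I, p i = 0} with hK
  have hconv : Convex ℝ K := by
    intro p hp q hq a b ha hb hab
    refine ⟨fun i => ?_, ?_, fun i hi => ?_⟩
    · simpa using add_nonneg (mul_nonneg ha (hp.1 i)) (mul_nonneg hb (hq.1 i))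
    · rw [map_add, map_smul, map_smul, hp.2.1, hq.2.1]; simpa using hab
    · simp [hp.2.2 i hi, hq.2.2 i hi]
  set S : Set V := closure (Finsupp.linearCombination ℝ v '' K) with hS
  by_cases h0 : (0 : V) ∈ S
  · left
    intro δ hδ
    obtain ⟨_, ⟨p, hp, rfl⟩, hd⟩ := Metric.mem_closure_iff.1 h0 δ hδ
    refine ⟨p, hp.1, ?_, hp.2.2, by simpa [dist_eq_norm] using hd⟩
    rw [← hp.2.1, hℓ, Finsupp.linearCombination_apply, Finsupp.sum]
    simp
  · right
    obtain ⟨G, u, h1, h2⟩ := geometric_hahn_banach_point_closed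
      ((hconv.linear_image (Finsupp.linearCombination ℝ v)).closure) isClosed_closure h0
    rw [map_zero] at h1
    refine ⟨G, u, h1, fun i hi => (h2 _ (subset_closure ⟨Finsupp.single i 1, ?_, ?_⟩)).le⟩
    · refine ⟨fun j => ?_, by simp [hℓ], fun j hj => ?_⟩
      · rw [Finsupp.single_apply]; split_ifs <;> simp
      · rw [Finsupp.single_apply, if_neg]
        rintro rfl; exact hj hi
    · simp

variable (m : ℕ → ℝ) (nb : ℕ → Finset ℕ)

/-- The vector of the differences of the indicator of `i`, scaled by the weight of `i`, along all
edges. -/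
def edgeVec (i : ℕ) : lp (fun _ : ℕ × ℕ => ℝ) 1 :=
  (m i)⁻¹ • ∑ j ∈ nb i, (lp.single 1 (i, j) 1 - lp.single 1 (j, i) 1)

variable {m nb}

theorem edgeVec_apply (i a b : ℕ) (hab : b ∈ nb a) (hba : a ∈ nb b) :
    edgeVec m nb i (a, b) = (if a = i then (m a)⁻¹ else 0) - (if b = i then (m b)⁻¹ else 0) := by
  have h1 : (edgeVec m nb i : ℕ × ℕ → ℝ) (a, b) = (m i)⁻¹ * ∑ j ∈ nb i,
      ((if (a, b) = (i, j) then 1 else 0) - (if (a, b) = (j, i) then 1 else 0)) := by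
    simp only [edgeVec, lp.coeFn_smul, lp.coeFn_sum, lp.coeFn_sub, Pi.smul_apply,
      Finset.sum_apply, Pi.sub_apply, lp.single_apply, smul_eq_mul, Pi.single_apply]
  rw [h1, Finset.sum_sub_distrib, mul_sub]
  congr 1
  · by_cases h : a = i
    · subst h; simp [hab]
    · simp [h]
  · by_cases h : b = i
    · subst h; simp [hba]
    · simp [h]

theorem linearCombination_edgeVec_apply (hnb : ∀ i j, j ∈ nb i → i ∈ nb j) (p : ℕ →₀ ℝ) {a b : ℕ}
    (hab : b ∈ nb a) :
    Finsupp.linearCombination ℝ (edgeVec m nb) p (a, b) = p a / m a - p b / m b := by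
  have h1 : (Finsupp.linearCombination ℝ (edgeVec m nb) p : ℕ × ℕ → ℝ) (a, b) =
      ∑ i ∈ p.support, p i * edgeVec m nb i (a, b) := by
    simp only [Finsupp.linearCombination_apply, Finsupp.sum, lp.coeFn_smul, lp.coeFn_sum,
      Pi.smul_apply, Finset.sum_apply, smul_eq_mul]
  rw [h1]
  simp only [edgeVec_apply _ a b hab (hnb a b hab), mul_sub, Finset.sum_sub_distrib, mul_ite,
    mul_zero, Finset.sum_ite_eq, Finsupp.mem_support_iff, div_eq_mul_inv]
  congr 1
  · split_ifs with h
    · rfl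
    · push Not at h; simp [h]
  · split_ifs with h
    · rfl
    · push Not at h; simp [h]

theorem tsum_enorm_eq_enorm (f : lp (fun _ : ℕ × ℕ => ℝ) 1) : ∑' q, ‖f q‖ₑ = ‖f‖ₑ := by
  have h1 := lp.hasSum_norm (p := 1) (by simp) f
  simp only [ENNReal.toReal_one, Real.rpow_one] at h1
  rw [← ofReal_norm, ← h1.tsum_eq, ENNReal.ofReal_tsum_of_nonneg (fun _ => norm_nonneg _)
    h1.summable]
  simp only [ofReal_norm]

/-- A functional on ℓ¹ is thereby read as the edge function (i, j) ↦ G(δ_{(i,j)}), bounded by ‖G‖,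
and its value on `edgeVec` as a normalized divergence. -/
theorem apply_edgeVec (G : lp (fun _ : ℕ × ℕ => ℝ) 1 →L[ℝ] ℝ) (i : ℕ) :
    G (edgeVec m nb i) =
      (m i)⁻¹ * ∑ j ∈ nb i, (G (lp.single 1 (i, j) 1) - G (lp.single 1 (j, i) 1)) := by
  simp only [edgeVec, map_smul, map_sum, map_sub, smul_eq_mul]

/-- The part of the divergence of the edge function `g` that belongs to the stars of the centers of
color `a`. -/
def starPart (m : ℕ → ℝ) (nb : ℕ → Finset ℕ) (c : ℕ → ℕ) (g : ℕ → ℕ → ℝ) (a k : ℕ) : ℝ :=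
  (m k)⁻¹ * ∑ i ∈ nb k with c i = a, ((if k = i then ∑ j ∈ nb i, g i j else 0) - g i k)

theorem sum_starPart {c : ℕ → ℕ} {N : ℕ} (hc : ∀ n, c n < N) (g : ℕ → ℕ → ℝ) {k : ℕ}
    (hk : k ∈ nb k) :
    ∑ a ∈ Finset.range N, starPart m nb c g a k = (m k)⁻¹ * ∑ j ∈ nb k, (g k j - g j k) := by
  simp only [starPart]
  rw [← Finset.mul_sum, Finset.sum_fiberwise_of_maps_to (fun i _ => Finset.mem_range.2 (hc i)),
    Finset.sum_sub_distrib, Finset.sum_sub_distrib, Finset.sum_ite_eq, if_pos hk]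

theorem starPart_eq_zero {c : ℕ → ℕ} {g : ℕ → ℕ → ℝ} {a k : ℕ} (h : ∀ i ∈ nb k, c i ≠ a) :
    starPart m nb c g a k = 0 := by
  rw [starPart, Finset.filter_false_of_mem h]; simp

/-- The flow along the edges leaving `i` is counted positively at `i` and negatively at the other
end, so it cancels over the star. The coloring ensures that no other center of the same color
contributes at a point of this star. -/
theorem sum_mul_starPart {c : ℕ → ℕ} (g : ℕ → ℕ → ℝ) (hnb : ∀ i j, j ∈ nb i → i ∈ nb j)
    (hc : ∀ i j k, k ∈ nb i → k ∈ nb j → c i = c j → i = j) {i : ℕ} (hi : i ∈ nb i)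
    (hm : ∀ k ∈ nb i, m k ≠ 0) : ∑ k ∈ nb i, m k * starPart m nb c g (c i) k = 0 := by
  have h1 : ∀ k ∈ nb i, m k * starPart m nb c g (c i) k =
      (if k = i then ∑ j ∈ nb i, g i j else 0) - g i k := by
    intro k hk
    have h2 : (nb k).filter (fun j => c j = c i) = {i} := by
      ext j
      simp only [Finset.mem_filter, Finset.mem_singleton]
      refine ⟨fun h => hc _ _ k (hnb _ _ h.1) hk h.2, ?_⟩
      rintro rfl
      exact ⟨hnb _ _ hk, rfl⟩
    rw [starPart, h2, Finset.sum_singleton, mul_inv_cancel_left₀ (hm k hk)]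
  rw [Finset.sum_congr rfl h1, Finset.sum_sub_distrib, Finset.sum_ite_eq', if_pos hi, sub_self]

/-- The bound on `m` is asked only where `nb k` is nonempty, since labels of empty blocks have mass
zero; there the sum is empty. -/
theorem abs_starPart_le {c : ℕ → ℕ} {g : ℕ → ℕ → ℝ} {N : ℕ} {C ε : ℝ} (hC : ∀ i j, |g i j| ≤ C)
    (hN : ∀ i, (nb i).card ≤ N) (hε : 0 < ε) {a k : ℕ} (hm : (nb k).Nonempty → ε ≤ m k) :
    |starPart m nb c g a k| ≤ ε⁻¹ * (N * (N * C + C)) := by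
  have hC0 : 0 ≤ C := (abs_nonneg _).trans (hC 0 0)
  rcases (nb k).eq_empty_or_nonempty with hk | hk
  · simp only [starPart, hk, Finset.filter_empty, Finset.sum_empty, mul_zero, abs_zero]
    positivity
  rw [starPart, abs_mul, abs_inv, abs_of_pos (hε.trans_le (hm hk))]
  refine mul_le_mul (inv_anti₀ hε (hm hk)) ?_ (abs_nonneg _) (by positivity)
  have hsum : ∀ (s : Finset ℕ) (f : ℕ → ℝ) (B : ℝ), 0 ≤ B → s.card ≤ N → (∀ i ∈ s, |f i| ≤ B) →
      |∑ i ∈ s, f i| ≤ N * B := fun s f B hB hs hf =>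
    (Finset.abs_sum_le_sum_abs _ _).trans ((Finset.sum_le_card_nsmul _ _ _ hf).trans (by
      rw [nsmul_eq_mul]; exact mul_le_mul_of_nonneg_right (by exact_mod_cast hs) hB))
  refine hsum _ _ _ (by positivity) ((Finset.card_filter_le _ _).trans (hN k)) fun i _ => ?_
  refine (abs_sub _ _).trans (add_le_add ?_ (hC _ _))
  split_ifs
  · exact hsum _ _ _ hC0 (hN i) fun j _ => hC i j
  · simpa using by positivity

end Edges

end

end CoarseAmenable

namespace CoarseAmenable

noncomputable section

open CoarseSpace

/-! ### Functions that are constant on the blocks -/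

section StepFunctions

variable {X : Type u} [CoarseSpace X] [MeasurableSpace X] {μ : Measure X} {b : X → ℕ}

theorem lintegral_comp_nat (hb : Measurable b) (F : ℕ → ℝ≥0∞) :
    ∫⁻ x, F (b x) ∂μ = ∑' i, F i * μ (b ⁻¹' {i}) := by
  rw [← lintegral_map (f := F) measurable_from_nat hb, lintegral_countable']
  simp only [Measure.map_apply hb (MeasurableSet.singleton _)]

theorem lintegral_eq_tsum_fiber (hb : Measurable b) (F : X → ℝ≥0∞) :
    ∫⁻ x, F x ∂μ = ∑' i, ∫⁻ x in b ⁻¹' {i}, F x ∂μ := by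
  rw [← lintegral_iUnion (fun i => hb (MeasurableSet.singleton i))
    fun i j hij => Disjoint.preimage _ (by simpa using hij), ← Set.preimage_iUnion,
    Set.iUnion_of_singleton, Set.preimage_univ, Measure.restrict_univ]

/-- Finitely supported functions of the blocks are square integrable. -/
theorem memLp_step (h : Admissible μ) (hb : BlockMap μ b) (t : ℕ →₀ ℝ) :
    MemLp (fun x => ((t (b x) : ℝ) : ℂ)) 2 μ := by
  refine ⟨(Complex.measurable_ofReal.comp
    (measurable_from_nat.comp hb.meas)).aestronglyMeasurable, ?_⟩
  have h1 : (eLpNorm (fun x => ((t (b x) : ℝ) : ℂ)) 2 μ) ^ 2 < ∞ := by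
    rw [eLpNorm_two_sq, lintegral_comp_nat hb.meas fun i => ‖((t i : ℝ) : ℂ)‖ₑ ^ 2,
      tsum_eq_sum (s := t.support) fun i hi => by simp [Finsupp.notMem_support_iff.1 hi]]
    refine ENNReal.sum_lt_top.2 fun i _ => ENNReal.mul_lt_top (by simp) ?_
    exact h.measure_lt_top (hb.measurableSet_fiber _) (hb.bounded_fiber i)
  exact (ENNReal.pow_lt_top_iff.1 h1).resolve_right two_ne_zero

/-- A finitely supported function of the blocks, as an element of `L²`. -/
def stepLp (h : Admissible μ) (hb : BlockMap μ b) (t : ℕ →₀ ℝ) : Lp ℂ 2 μ := (memLp_step h hb t).toLp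

theorem coeFn_stepLp (h : Admissible μ) (hb : BlockMap μ b) (t : ℕ →₀ ℝ) :
    stepLp h hb t =ᵐ[μ] fun x => ((t (b x) : ℝ) : ℂ) := MemLp.coeFn_toLp _

theorem enorm_stepLp_sq (h : Admissible μ) (hb : BlockMap μ b) (t : ℕ →₀ ℝ) :
    ‖stepLp h hb t‖ₑ ^ 2 = ∑' i, ‖t i‖ₑ ^ 2 * μ (b ⁻¹' {i}) := by
  rw [enorm_sq_eq_lintegral, ← lintegral_comp_nat hb.meas fun i => ‖t i‖ₑ ^ 2]
  refine lintegral_congr_ae ?_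
  filter_upwards [coeFn_stepLp h hb t] with x hx
  rw [hx, ← ofReal_norm, Complex.norm_real, ofReal_norm]

/-- A bounded function of the blocks, as an element of `L^∞`. -/
def stepTop (hb : BlockMap μ b) {t : ℕ → ℝ} {C : ℝ} (ht : ∀ i, |t i| ≤ C) : Lp ℂ ∞ μ :=
  (memLp_top_of_bound (Complex.measurable_ofReal.comp
    (measurable_from_nat.comp hb.meas)).aestronglyMeasurable C
    (Eventually.of_forall fun x => by rw [Complex.norm_real]; exact ht (b x)) :
      MemLp (fun x => ((t (b x) : ℝ) : ℂ)) ∞ μ).toLp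

theorem coeFn_stepTop (hb : BlockMap μ b) {t : ℕ → ℝ} {C : ℝ} (ht : ∀ i, |t i| ≤ C) :
    stepTop hb ht =ᵐ[μ] fun x => ((t (b x) : ℝ) : ℂ) := MemLp.coeFn_toLp _

theorem setIntegral_stepTop (h : Admissible μ) (hb : BlockMap μ b) {t : ℕ → ℝ} {C : ℝ}
    (ht : ∀ i, |t i| ≤ C) (s : Finset ℕ) :
    ∫ x in b ⁻¹' s, stepTop hb ht x ∂μ = ((∑ i ∈ s, μ.real (b ⁻¹' {i}) * t i : ℝ) : ℂ) := by
  have h1 : ∫ x in b ⁻¹' s, stepTop hb ht x ∂μ = ∫ x in b ⁻¹' s, ((t (b x) : ℝ) : ℂ) ∂μ :=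
    integral_congr_ae (ae_restrict_of_ae (coeFn_stepTop hb ht))
  have h2 : (b ⁻¹' s : Set X) = ⋃ i ∈ s, b ⁻¹' {i} := by ext x; simp
  have h3 : ∀ i, Set.EqOn (fun x => ((t (b x) : ℝ) : ℂ)) (fun _ => ((t i : ℝ) : ℂ))
      (b ⁻¹' {i}) := fun i x hx => by
    show ((t (b x) : ℝ) : ℂ) = _
    rw [show b x = i from hx]
  rw [h1, h2, integral_biUnion_finset]
  · push_cast
    refine Finset.sum_congr rfl fun i _ => ?_
    rw [setIntegral_congr_fun (hb.measurableSet_fiber _) (h3 i), setIntegral_const]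
    simp
  · exact fun i _ => hb.measurableSet_fiber _
  · exact fun i _ j _ hij => Disjoint.preimage _ (by simpa using hij)
  · intro i _
    rw [integrableOn_congr_fun (h3 i) (hb.measurableSet_fiber _)]
    exact integrableOn_const (h.measure_lt_top (hb.measurableSet_fiber _) (hb.bounded_fiber i)).ne

end StepFunctions

end

end CoarseAmenable

namespace CoarseAmenable

noncomputable section

open CoarseSpace

/-! ### From amenability to almost invariant vectors -/

section AlmostInvariant

variable {X : Type u} [CoarseSpace X] [MeasurableSpace X] {μ : Measure X} {b : X → ℕ}

theorem BlockMap.exists_neighbors (h : Admissible μ) (hb : BlockMap μ b) {F : Set (X × X)}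
    (hF : Controlled F) : ∃ (nb : ℕ → Finset ℕ) (N : ℕ), (∀ i, (nb i).card ≤ N) ∧
      ∀ i j, j ∈ nb i ↔ blockRel b F i j := by
  obtain ⟨N, hN⟩ := hb.exists_degree_bound h hF
  have hfin : ∀ i, {j | blockRel b F i j}.Finite := by
    intro i
    by_contra hinf
    obtain ⟨s, hs, hcard⟩ := Set.Infinite.exists_subset_card_eq hinf (N + 1)
    have := hN i s fun j hj => hs hj
    omega
  refine ⟨fun i => (hfin i).toFinset, N, fun i => hN i _ fun j hj => ?_, fun i j => ?_⟩
  · simpa using hj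
  · simp

/-- The stars of the centers of one color form a blocking collection. -/
theorem BlockMap.blocking_stars (hb : BlockMap μ b) {F : Set (X × X)} (hF : Controlled F)
    (hFs : Symm F) (hFd : diag X ⊆ F) {nb : ℕ → Finset ℕ} (hnb : ∀ i j, j ∈ nb i ↔ blockRel b F i j)
    {c : ℕ → ℕ} (hc : ∀ i j k, k ∈ nb i → k ∈ nb j → c i = c j → i = j) (a : ℕ) :
    Blocking μ {A | ∃ i ∈ Set.range b, c i = a ∧ A = b ⁻¹' (nb i : Set ℕ)} := by
  obtain ⟨ε, hε, hlow⟩ := hb.lower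
  have hR := hb.controlled_blockRel hF
  refine ⟨?_, _, comp_mem _ _ hR hR, ε, hε, ?_⟩
  · rintro _ ⟨i, -, hi, rfl⟩ _ ⟨j, -, hj, rfl⟩ hij
    refine Set.disjoint_left.2 fun x hxi hxj => hij ?_
    rw [hc i j (b x) hxi hxj (hi.trans hj.symm)]
  · rintro _ ⟨_, ⟨x₀, rfl⟩, -, rfl⟩
    refine ⟨hb.measurableSet_fiber _, ?_, (hlow x₀).trans (measure_mono ?_)⟩
    · rintro ⟨x, y⟩ ⟨hx, hy⟩
      exact ⟨x₀, blockRel_symm hFs ((hnb _ _).1 hx), (hnb _ _).1 hy⟩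
    · intro x hx
      refine (hnb _ _).2 ⟨x₀, x₀, rfl, ?_, hFd rfl⟩
      exact (show b x = b x₀ from hx).symm

/-- On an amenable space, the normalized divergence of a bounded edge function is not bounded
below by a positive constant. -/
theorem Amenable.not_le_edgeVec (hA : Amenable μ) (h : Admissible μ) (hb : BlockMap μ b)
    {F : Set (X × X)} (hF : Controlled F) (hFs : Symm F) (hFd : diag X ⊆ F) {nb : ℕ → Finset ℕ}
    {N : ℕ} (hN : ∀ i, (nb i).card ≤ N) (hnb : ∀ i j, j ∈ nb i ↔ blockRel b F i j)
    (G : lp (fun _ : ℕ × ℕ => ℝ) 1 →L[ℝ] ℝ) {u : ℝ} (hu : 0 < u) :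
    ¬ ∀ i ∈ Set.range b, u ≤ G (edgeVec (fun i => μ.real (b ⁻¹' {i})) nb i) := by
  intro hG
  obtain ⟨φ, ⟨hpos, hone⟩, hφ⟩ := hA
  obtain ⟨ε, hε, hlow⟩ := hb.lower
  obtain ⟨c, M, hcM, hc⟩ := hb.exists_coloring h hF hFs
  replace hc : ∀ i j k, k ∈ nb i → k ∈ nb j → c i = c j → i = j := fun i j k hi hj =>
    hc i j k ((hnb _ _).1 hi) ((hnb _ _).1 hj)
  have hsymm : ∀ i j, j ∈ nb i → i ∈ nb j := fun i j hij =>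
    (hnb _ _).2 (blockRel_symm hFs ((hnb _ _).1 hij))
  have hself : ∀ x, b x ∈ nb (b x) := fun x => (hnb _ _).2 ⟨x, x, rfl, rfl, hFd rfl⟩
  set m : ℕ → ℝ := fun i => μ.real (b ⁻¹' {i}) with hm
  set g : ℕ → ℕ → ℝ := fun i j => G (lp.single 1 (i, j) 1) with hg
  have hgb : ∀ i j, |g i j| ≤ ‖G‖ := fun i j => by
    have h1 := G.le_opNorm (lp.single 1 (i, j) (1 : ℝ))
    rw [lp.norm_single (by simp), norm_one, mul_one] at h1
    exact h1
  have hmlow : ∀ x, (ε : ℝ) ≤ m (b x) := fun x => by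
    have h1 := ENNReal.toReal_mono (h.measure_lt_top (hb.measurableSet_fiber _)
      (hb.bounded_fiber (b x))).ne (hlow x)
    exact h1
  have hrange : ∀ i, (nb i).Nonempty → i ∈ Set.range b := by
    rintro i ⟨j, hj⟩
    obtain ⟨x, -, hx, -⟩ := (hnb _ _).1 hj
    exact ⟨x, hx⟩
  have hml : ∀ k, (nb k).Nonempty → (ε : ℝ) ≤ m k := fun k hk => by
    obtain ⟨x, rfl⟩ := hrange k hk
    exact hmlow x
  have hε' : (0 : ℝ) < ε := hε
  have hbd : ∀ a k, |starPart m nb c g a k| ≤ (ε : ℝ)⁻¹ * (N * (N * ‖G‖ + ‖G‖)) := fun a k =>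
    abs_starPart_le hgb hN hε' (hml k)
  -- The part of color `a` lives on the stars with centers of color `a`, which form a blocking
  -- collection, and integrates to zero over each star.
  have hzero : ∀ a, φ (stepTop hb (hbd a)) = 0 := by
    intro a
    refine hφ _ (hb.blocking_stars hF hFs hFd hnb hc a) _ ?_ ?_
    · rintro _ ⟨i, ⟨x, rfl⟩, rfl, rfl⟩
      rw [setIntegral_stepTop h hb, Complex.ofReal_eq_zero]
      refine sum_mul_starPart g hsymm hc (hself x) fun k hk => ?_
      exact (hε'.trans_le (hml k ⟨_, hsymm _ _ hk⟩)).ne'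
    · filter_upwards [coeFn_stepTop hb (hbd a)] with x hx hxA
      rw [hx, starPart_eq_zero, Complex.ofReal_zero]
      intro i hi hia
      exact hxA ⟨_, ⟨i, hrange i ⟨_, hsymm _ _ hi⟩, hia, rfl⟩, hsymm _ _ hi⟩
  set one : Lp ℂ ∞ μ := (memLp_top_const (1 : ℂ)).toLp with hone'
  set f : Lp ℂ ∞ μ := ∑ a ∈ Finset.range M, stepTop hb (hbd a) with hf
  have hφf : φ f = 0 := by
    rw [hf, map_sum]; exact Finset.sum_eq_zero fun a _ => hzero a
  have hcoe : f =ᵐ[μ] fun x => ((G (edgeVec m nb (b x)) : ℝ) : ℂ) := by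
    have h1 : ∀ᵐ x ∂μ, ∀ a, stepTop hb (hbd a) x = ((starPart m nb c g a (b x) : ℝ) : ℂ) :=
      ae_all_iff.2 fun a => coeFn_stepTop hb (hbd a)
    filter_upwards [Lp.coeFn_finsetSum (Finset.range M) fun a => stepTop hb (hbd a), h1]
      with x h2 h3
    rw [h2, Finset.sum_apply, Finset.sum_congr rfl fun a _ => h3 a, ← Complex.ofReal_sum,
      sum_starPart hcM g (hself x), apply_edgeVec]
  -- The color parts add up to the divergence `f`, which is at least u, while φ(f) = 0. Positivity
  -- of φ on f - u then says -u ≥ 0.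
  have h0 := hpos (f - (u : ℂ) • one) (by
    filter_upwards [hcoe, Lp.coeFn_sub f ((u : ℂ) • one), Lp.coeFn_smul (u : ℂ) one,
      MemLp.coeFn_toLp (memLp_top_const (μ := μ) (1 : ℂ))] with x h1 h2 h3 h4
    rw [h2, Pi.sub_apply, h1, h3, Pi.smul_apply, hone', h4, smul_eq_mul, mul_one,
      ← Complex.ofReal_sub]
    exact Complex.zero_le_real.2 (sub_nonneg.2 (hG _ ⟨x, rfl⟩)))
  rw [map_sub, map_smul, hφf, hone, smul_eq_mul, mul_one, zero_sub, ← Complex.ofReal_neg,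
    Complex.zero_le_real] at h0
  linarith

variable [MeasurableSingletonClass X] {h : Admissible μ}

/-- It passes from the ℓ¹ variation of a density to the L² variation of its square root. -/
theorem sq_sqrt_sub_sqrt_le {x y : ℝ} (hx : 0 ≤ x) (hy : 0 ≤ y) :
    (√x - √y) ^ 2 ≤ |x - y| := by
  have h1 : |x - y| = |√x - √y| * (√x + √y) := by
    rw [← abs_of_nonneg (add_nonneg (Real.sqrt_nonneg x) (Real.sqrt_nonneg y)), ← abs_mul]
    congr 1
    nlinarith [Real.mul_self_sqrt hx, Real.mul_self_sqrt hy]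
  rw [h1, ← sq_abs, sq]
  refine mul_le_mul_of_nonneg_left ?_ (abs_nonneg _)
  exact abs_le.2 ⟨by linarith [Real.sqrt_nonneg x, Real.sqrt_nonneg y],
    by linarith [Real.sqrt_nonneg x, Real.sqrt_nonneg y]⟩

/-- Over a block, an operator that annihilates the constants only sees the variation of a step
function over the star of the block. -/
theorem setLIntegral_stepLp_le {hb : BlockMap μ b} {T : Ccs h} (hT : PhiEq T 0) {F : Set (X × X)}
    {hFm : MeasRel F} (hFs : Symm F) (hTF : SupportedOn F hFm (T : Op μ)) {nb : ℕ → Finset ℕ}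
    (hnb : ∀ i j, j ∈ nb i ↔ blockRel b F i j) (s : ℕ →₀ ℝ) (i : ℕ) :
    ∫⁻ x in b ⁻¹' {i}, ‖(T : Op μ) (stepLp h hb s) x‖ₑ ^ 2 ∂μ ≤
      ‖(T : Op μ)‖ₑ ^ 2 * ∑' j, (if j ∈ nb i then ‖s j - s i‖ₑ ^ 2 else 0) * μ (b ⁻¹' {j}) := by
  classical
  -- Over the star of block `i` one has s = s_i·e + t with `e` the indicator of the star. There `e`
  -- agrees with the constant 1, so Te vanishes on block `i` and only Tt survives.
  set t : ℕ →₀ ℝ := Finsupp.onFinset (nb i) (fun j => if j ∈ nb i then s j - s i else 0)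
    (by intro j; simp +contextual) with ht
  set e : ℕ →₀ ℝ := Finsupp.onFinset (nb i) (fun j => if j ∈ nb i then 1 else 0)
    (by intro j; simp) with he
  have hU : MeasurableSet (b ⁻¹' {i}) := hb.measurableSet_fiber _
  have hnhd : ∀ x ∈ nhd F (b ⁻¹' {i}), b x ∈ nb i := by
    rintro x ⟨y, hy, hxy⟩
    exact (hnb _ _).2 ⟨y, x, hy, rfl, symm_mem hFs hxy⟩
  have h1 := hT.ae_eq_zero hFs hTF hU (hb.bounded_fiber i) (η := stepLp h hb e) (by
    filter_upwards [coeFn_stepLp h hb e] with x hx hxU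
    rw [hx, he, Finsupp.onFinset_apply, if_pos (hnhd x hxU), Complex.ofReal_one])
  have h2 := (supportedOn_iff _ _ _).1 hTF _ hU
    (stepLp h hb s - ((s i : ℝ) : ℂ) • stepLp h hb e - stepLp h hb t) (by
      filter_upwards [coeFn_stepLp h hb e, coeFn_stepLp h hb s, coeFn_stepLp h hb t,
        Lp.coeFn_sub (stepLp h hb s - ((s i : ℝ) : ℂ) • stepLp h hb e) (stepLp h hb t),
        Lp.coeFn_sub (stepLp h hb s) (((s i : ℝ) : ℂ) • stepLp h hb e),
        Lp.coeFn_smul ((s i : ℝ) : ℂ) (stepLp h hb e)] with x h3 h4 h5 h6 h7 h8 hx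
      rw [h6, Pi.sub_apply, h7, Pi.sub_apply, h8, Pi.smul_apply, h3, h4, h5, he, ht,
        Finsupp.onFinset_apply, Finsupp.onFinset_apply, if_pos (hnhd x hx), if_pos (hnhd x hx)]
      simp)
  have h3 : ∀ᵐ x ∂μ, x ∈ b ⁻¹' {i} →
      (T : Op μ) (stepLp h hb s) x = (T : Op μ) (stepLp h hb t) x := by
    rw [map_sub, map_sub, map_smul] at h2
    filter_upwards [h1, h2, Lp.coeFn_sub ((T : Op μ) (stepLp h hb s) - ((s i : ℝ) : ℂ) •
        (T : Op μ) (stepLp h hb e)) ((T : Op μ) (stepLp h hb t)),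
      Lp.coeFn_sub ((T : Op μ) (stepLp h hb s)) (((s i : ℝ) : ℂ) • (T : Op μ) (stepLp h hb e)),
      Lp.coeFn_smul ((s i : ℝ) : ℂ) ((T : Op μ) (stepLp h hb e))] with x h4 h5 h6 h7 h8 hx
    have h9 := h5 hx
    rw [h6, Pi.sub_apply, h7, Pi.sub_apply, h8, Pi.smul_apply, h4 hx, smul_zero, sub_zero] at h9
    exact sub_eq_zero.1 h9
  calc ∫⁻ x in b ⁻¹' {i}, ‖(T : Op μ) (stepLp h hb s) x‖ₑ ^ 2 ∂μ
      = ∫⁻ x in b ⁻¹' {i}, ‖(T : Op μ) (stepLp h hb t) x‖ₑ ^ 2 ∂μ := by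
        refine setLIntegral_congr_fun_ae hU ?_
        filter_upwards [h3] with x hx hxU
        rw [hx hxU]
    _ ≤ ‖(T : Op μ) (stepLp h hb t)‖ₑ ^ 2 := by
        rw [enorm_sq_eq_lintegral]; exact setLIntegral_le_lintegral _ _
    _ ≤ (‖(T : Op μ)‖ₑ * ‖stepLp h hb t‖ₑ) ^ 2 :=
        pow_le_pow_left₀ bot_le (ContinuousLinearMap.le_opENorm _ _) 2
    _ = _ := by
        rw [mul_pow, enorm_stepLp_sq]
        congr 1
        refine tsum_congr fun j => ?_
        rw [ht, Finsupp.onFinset_apply]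
        split_ifs <;> simp

/-- On an amenable space, operators that annihilate the constants are not bounded below. -/
theorem Amenable.exists_norm_lt (hA : Amenable μ) {T : Ccs h} (hT : PhiEq T 0) {η : ℝ}
    (hη : 0 < η) : ∃ ξ : Lp ℂ 2 μ, ‖ξ‖ = 1 ∧ ‖(T : Op μ) ξ‖ < η := by
  classical
  obtain ⟨b, hb⟩ := h.exists_blockMap
  obtain ⟨E, hE, hEc, hTE⟩ := T.2
  obtain ⟨F, hFc, hFs, hFm, hEF⟩ := h.exists_symm (union_mem _ _ hEc (diag_mem (X := X)))
  replace hTF := hTE.mono hFm (Set.subset_union_left.trans hEF)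
  have hFd : diag X ⊆ F := Set.subset_union_right.trans hEF
  obtain ⟨nb, N, hN, hnb⟩ := hb.exists_neighbors h hFc
  obtain ⟨C, hC⟩ := h.uniformlyBounded _ hb.controlled
  obtain ⟨ε, hε, hlow⟩ := hb.lower
  have hCi : ∀ i, μ (b ⁻¹' {i}) ≤ C := fun i => hC _ (hb.measurableSet_fiber _) fun p hp =>
    (show b p.1 = i from hp.1).trans (show b p.2 = i from hp.2).symm
  set m : ℕ → ℝ := fun i => μ.real (b ⁻¹' {i}) with hm
  set L : ℝ := ‖(T : Op μ)‖ ^ 2 * C with hL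
  have hL0 : 0 ≤ L := by positivity
  rcases exists_small_combination_or_functional (edgeVec m nb) (Set.range b) with hsmall | hfun
  swap
  · obtain ⟨G, u, hu, hG⟩ := hfun
    exact absurd hG (hA.not_le_edgeVec h hb hFc hFs hFd hN hnb G hu)
  -- The final estimate is ‖Tξ‖² ≤ L‖P‖, so this tolerance gives less than η²; the summand 1 covers
  -- L = 0.
  obtain ⟨p, hp0, hp1, hpI, hpδ⟩ := hsmall (η ^ 2 / (L + 1)) (by positivity)
  set P := Finsupp.linearCombination ℝ (edgeVec m nb) p with hP
  have hd0 : ∀ i, 0 ≤ p i / m i := fun i => div_nonneg (hp0 i) measureReal_nonneg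
  -- The weights p are the masses of a probability measure on the blocks and p/m is its density, so
  -- the square root is a unit vector of L².
  set s : ℕ →₀ ℝ := Finsupp.onFinset p.support (fun i => √(p i / m i)) (by
    intro i hi
    rw [Finsupp.mem_support_iff]
    rintro h0
    exact hi (by simp [h0])) with hs
  have hsi : ∀ i, s i = √(p i / m i) := fun i => rfl
  have hmfin : ∀ i, μ (b ⁻¹' {i}) ≠ ∞ := fun i => ((hCi i).trans_lt ENNReal.coe_lt_top).ne
  have henorm : ∀ x : ℝ, ‖x‖ₑ ^ 2 = ENNReal.ofReal (x ^ 2) := fun x => by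
    rw [← ofReal_norm, ← ENNReal.ofReal_pow (norm_nonneg _), Real.norm_eq_abs, sq_abs]
  refine ⟨stepLp h hb s, ?_, ?_⟩
  · have h1 : ‖stepLp h hb s‖ₑ ^ 2 = 1 := by
      rw [enorm_stepLp_sq, tsum_eq_sum (s := p.support) fun i hi => by
        rw [hsi, Finsupp.notMem_support_iff.1 hi]; simp]
      have h2 : ∀ i ∈ p.support, ‖s i‖ₑ ^ 2 * μ (b ⁻¹' {i}) = ENNReal.ofReal (p i) := by
        intro i hi
        have hI : i ∈ Set.range b := by
          by_contra hI
          exact Finsupp.mem_support_iff.1 hi (hpI i hI)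
        obtain ⟨x, rfl⟩ := hI
        have hmx : m (b x) ≠ 0 := by
          have h3 := ENNReal.toReal_mono (hmfin (b x)) (hlow x)
          exact (lt_of_lt_of_le (show (0 : ℝ) < ε from hε) h3).ne'
        rw [henorm, hsi, Real.sq_sqrt (hd0 _), ← ENNReal.ofReal_toReal (hmfin (b x)),
          ← ENNReal.ofReal_mul (hd0 _)]
        congr 1
        exact div_mul_cancel₀ _ hmx
      rw [Finset.sum_congr rfl h2, ← ENNReal.ofReal_sum_of_nonneg fun i _ => hp0 i, hp1,
        ENNReal.ofReal_one]
    rw [← ofReal_norm, ← ENNReal.ofReal_pow (norm_nonneg _), ENNReal.ofReal_eq_one] at h1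
    exact (pow_eq_one_iff_of_nonneg (norm_nonneg _) two_ne_zero).1 h1
  · have hPt : ‖P‖ₑ = ∑' i, ∑' j, ‖(P : ℕ × ℕ → ℝ) (i, j)‖ₑ :=
      (tsum_enorm_eq_enorm P).symm.trans (ENNReal.tsum_prod (f := fun i j => ‖P (i, j)‖ₑ))
    -- Summing the local estimate over all blocks yields the squared differences of s along edges;
    -- these are at most the differences of p/m, which are the entries of P.
    have h1 : ‖(T : Op μ) (stepLp h hb s)‖ₑ ^ 2 ≤ ‖(T : Op μ)‖ₑ ^ 2 * C * ‖P‖ₑ := by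
      rw [enorm_sq_eq_lintegral, lintegral_eq_tsum_fiber hb.meas, hPt,
        ← ENNReal.tsum_mul_left]
      refine ENNReal.tsum_le_tsum fun i => ?_
      refine (setLIntegral_stepLp_le hT hFs hTF hnb s i).trans ?_
      rw [mul_assoc, ← ENNReal.tsum_mul_left (a := (C : ℝ≥0∞))]
      refine mul_le_mul_right (ENNReal.tsum_le_tsum fun j => ?_) _
      split_ifs with hij
      · rw [mul_comm]
        refine mul_le_mul' (hCi j) ?_
        rw [hP, linearCombination_edgeVec_apply (fun i j hij =>
          (hnb _ _).2 (blockRel_symm hFs ((hnb _ _).1 hij))) p hij, henorm, ← ofReal_norm]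
        refine ENNReal.ofReal_le_ofReal ?_
        rw [hsi, hsi, Real.norm_eq_abs, abs_sub_comm]
        exact sq_sqrt_sub_sqrt_le (hd0 j) (hd0 i)
      · simp
    have h2 : ‖(T : Op μ) (stepLp h hb s)‖ ^ 2 ≤ L * ‖P‖ := by
      rw [← ofReal_norm, ← ofReal_norm, ← ofReal_norm, ← ENNReal.ofReal_pow (norm_nonneg _),
        ← ENNReal.ofReal_pow (norm_nonneg _), ← ENNReal.ofReal_coe_nnreal,
        ← ENNReal.ofReal_mul (by positivity), ← ENNReal.ofReal_mul (by positivity)] at h1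
      exact (ENNReal.ofReal_le_ofReal_iff (by positivity)).1 h1
    refine lt_of_pow_lt_pow_left₀ 2 hη.le (h2.trans_lt ?_)
    have h3 : L * ‖P‖ ≤ L * (η ^ 2 / (L + 1)) := mul_le_mul_of_nonneg_left hpδ.le hL0
    refine h3.trans_lt ?_
    rw [mul_div_assoc', div_lt_iff₀ (by positivity)]
    nlinarith [pow_pos hη 2]

end AlmostInvariant

end

end CoarseAmenable

namespace CoarseAmenable

noncomputable section

open CoarseSpace

/-! ### Spectra, nets of unit vectors and the GNS construction -/

section HilbertSpace

variable {H : Type u} [NormedAddCommGroup H] [InnerProductSpace ℂ H] [CompleteSpace H]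

/-- An operator that is bounded below can fail to be surjective, but T*T is invertible once T is
bounded below. Hence the hypothesis concerns T*T instead of T. -/
theorem exists_norm_lt_of_zero_mem_spectrum {T : H →L[ℂ] H}
    (h0 : (0 : ℂ) ∈ spectrum ℂ (star T * T)) {η : ℝ} (hη : 0 < η) : ∃ ξ, ‖ξ‖ = 1 ∧ ‖T ξ‖ < η := by
  by_contra hcon
  push Not at hcon
  rw [spectrum.zero_mem_iff] at h0
  refine h0 (ContinuousLinearMap.isUnit_of_forall_le_norm_inner_map (star T * T)
    (c := (η ^ 2).toNNReal) (Real.toNNReal_pos.2 (pow_pos hη 2)) fun x => ?_)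
  rw [Real.coe_toNNReal _ (sq_nonneg η)]
  have h1 : inner ℂ ((star T * T) x) x = inner ℂ (T x) (T x) := by
    rw [ContinuousLinearMap.star_eq_adjoint]
    exact ContinuousLinearMap.adjoint_inner_left T x (T x)
  rw [h1, inner_self_eq_norm_sq_to_K, ← RCLike.ofReal_pow, RCLike.norm_ofReal, abs_of_nonneg
    (by positivity), ← mul_pow]
  refine pow_le_pow_left₀ (by positivity) ?_ 2
  rcases eq_or_ne x 0 with rfl | hx
  · simp
  have hx0 : ‖x‖ ≠ 0 := norm_ne_zero_iff.2 hx
  have h2 := hcon (((‖x‖⁻¹ : ℝ) : ℂ) • x) (by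
    rw [norm_smul, Complex.norm_real, norm_inv, norm_norm, inv_mul_cancel₀ hx0])
  rw [map_smul, norm_smul, Complex.norm_real, norm_inv, norm_norm,
    le_inv_mul_iff₀ (norm_pos_iff.2 hx)] at h2
  exact h2

theorem zero_mem_spectrum_of_tendsto {ι : Type*} {l : Filter ι} [l.NeBot] {T : H →L[ℂ] H}
    {ξ : ι → H} (hξ : ∀ i, ‖ξ i‖ = 1) (hT : Tendsto (fun i => ‖T (ξ i)‖) l (𝓝 0)) :
    (0 : ℂ) ∈ spectrum ℂ T := by
  rw [spectrum.zero_mem_iff]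
  intro hu
  obtain ⟨S, hS⟩ := hu.exists_left_inv
  have h1 : ∀ i, 1 ≤ ‖S‖ * ‖T (ξ i)‖ := fun i => by
    have h2 : S (T (ξ i)) = ξ i := congrArg (fun R : H →L[ℂ] H => R (ξ i)) hS
    calc (1 : ℝ) = ‖S (T (ξ i))‖ := by rw [h2, hξ]
      _ ≤ _ := S.le_opNorm _
  have h2 := ge_of_tendsto' (hT.const_mul ‖S‖) h1
  rw [mul_zero] at h2
  linarith

/-- Finitely many operators that are simultaneously small on unit vectors give rise to a net. -/
theorem exists_net {κ : Type u} (S : κ → H →L[ℂ] H)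
    (hS : ∀ (s : Finset κ) (η : ℝ), 0 < η → ∃ ξ, ‖ξ‖ = 1 ∧ ∀ k ∈ s, ‖S k ξ‖ < η) :
    ∃ (ι : Type u) (_ : Preorder ι) (_ : IsDirectedOrder ι) (_ : Nonempty ι) (ξ : ι → H),
      (∀ i, ‖ξ i‖ = 1) ∧ ∀ k, Tendsto (fun i => ‖S k (ξ i)‖) atTop (𝓝 0) := by
  classical
  have hpos : ∀ n : ℕ, 0 < 1 / ((n : ℝ) + 1) := fun n => by positivity
  choose ξ hξ hξS using fun i : Finset κ × ℕ => hS i.1 _ (hpos i.2)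
  refine ⟨Finset κ × ℕ, inferInstance, inferInstance, ⟨(∅, 0)⟩, ξ, hξ, fun k => ?_⟩
  have hsnd : Tendsto (fun i : Finset κ × ℕ => i.2) atTop atTop := by
    rw [← prod_atTop_atTop_eq]; exact tendsto_snd
  refine squeeze_zero' (Eventually.of_forall fun _ => norm_nonneg _) ?_
    ((tendsto_one_div_add_atTop_nhds_zero_nat (𝕜 := ℝ)).comp hsnd)
  filter_upwards [eventually_ge_atTop (({k}, 0) : Finset κ × ℕ)] with i hi
  exact (hξS i k (hi.1 (Finset.mem_singleton_self k))).le

/-- The state that is a limit of the vector states of a family of unit vectors. -/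
theorem exists_limit_state {ι : Type*} (U : Ultrafilter ι) {ξ : ι → H} (hξ : ∀ i, ‖ξ i‖ = 1) :
    ∃ φ : (H →L[ℂ] H) →ₚ[ℂ] ℂ, φ 1 = 1 ∧ ∀ S : H →L[ℂ] H,
      Tendsto (fun i => ‖S (ξ i)‖) U (𝓝 0) → φ (star S * S) = 0 := by
  let F : ι → (H →L[ℂ] H) →ₗ[ℂ] ℂ := fun i =>
    { toFun := fun S => inner ℂ (ξ i) (S (ξ i))
      map_add' := fun S T => inner_add_right _ _ _
      map_smul' := fun c S => inner_smul_right _ _ _ }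
  obtain ⟨φ, hφ⟩ := exists_ultralimit U F fun S => ⟨‖S‖, fun i => by
    have h1 := (norm_inner_le_norm (𝕜 := ℂ) (ξ i) (S (ξ i))).trans
      (mul_le_mul_of_nonneg_left (S.le_opNorm (ξ i)) (norm_nonneg _))
    rwa [hξ, one_mul, mul_one] at h1⟩
  refine ⟨PositiveLinearMap.mk₀ φ fun S hS => ?_, ?_, fun S hS => ?_⟩
  · refine ge_of_tendsto' (hφ S) fun i => ?_
    have h1 : S.IsPositive := ContinuousLinearMap.nonneg_iff_isPositive S |>.1 hS
    exact h1.inner_nonneg_right (ξ i)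
  · refine tendsto_nhds_unique (hφ 1) ?_
    have h1 : ∀ i, F i 1 = 1 := fun i => by
      show inner ℂ (ξ i) (ξ i) = 1
      rw [inner_self_eq_norm_sq_to_K, hξ]; simp
    simp only [h1]
    exact tendsto_const_nhds
  · refine tendsto_nhds_unique (hφ (star S * S)) ?_
    have h1 : ∀ i, F i (star S * S) = ((‖S (ξ i)‖ ^ 2 : ℝ) : ℂ) := fun i => by
      show inner ℂ (ξ i) ((star S) (S (ξ i))) = _
      rw [ContinuousLinearMap.star_eq_adjoint, ContinuousLinearMap.adjoint_inner_right,
        inner_self_eq_norm_sq_to_K]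
      push_cast; rfl
    simp only [h1]
    have h2 := (Complex.continuous_ofReal.tendsto _).comp (hS.pow 2)
    simpa [Function.comp_def] using h2

/-- The vectors of a family that become annihilated in the limit yield a vector of a representation
that is annihilated. -/
theorem exists_rep_of_tendsto {A : Type u} [Ring A] [StarRing A] [Algebra ℂ A]
    (j : A →⋆ₐ[ℂ] (H →L[ℂ] H)) {ι : Type*} (U : Ultrafilter ι) {ξ : ι → H} (hξ : ∀ i, ‖ξ i‖ = 1) :
    ∃ (r : Rep A) (v : r.H), v ≠ 0 ∧ ∀ a b : A,
      Tendsto (fun i => ‖j a (ξ i) - j b (ξ i)‖) U (𝓝 0) → r.ρ a v = r.ρ b v := by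
  obtain ⟨φ, hφ1, hφ⟩ := exists_limit_state U hξ
  -- In the GNS space the class of S has squared norm φ(S*S). So the class of 1 is a unit vector,
  -- and operators whose difference tends to zero on the net have the same class.
  have hn : ∀ S : H →L[ℂ] H, ‖φ.toPreGNS S‖ ^ 2 = (φ (star S * S)).re := fun S => by
    have h1 := φ.preGNS_norm_sq (φ.toPreGNS S)
    rw [PositiveLinearMap.ofPreGNS_toPreGNS] at h1
    rw [← h1, ← Complex.ofReal_pow, Complex.ofReal_re]
  refine ⟨⟨φ.GNS, φ.gnsStarAlgHom.comp j⟩, ((φ.toPreGNS 1 : φ.PreGNS) : φ.GNS), ?_, ?_⟩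
  · rw [← norm_ne_zero_iff]
    show ‖((φ.toPreGNS 1 : φ.PreGNS) : φ.GNS)‖ ≠ 0
    rw [UniformSpace.Completion.norm_coe]
    have h1 := hn 1
    rw [star_one, one_mul, hφ1, Complex.one_re] at h1
    intro h2
    rw [h2] at h1
    norm_num at h1
  · intro a b hab
    have happ : ∀ S : H →L[ℂ] H, φ.gnsStarAlgHom S ((φ.toPreGNS 1 : φ.PreGNS) : φ.GNS) =
        ((φ.toPreGNS S : φ.PreGNS) : φ.GNS) := fun S => by
      refine (φ.gnsNonUnitalStarAlgHom_apply_coe (a := S) (b := φ.toPreGNS 1)).trans ?_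
      simp
    refine (happ (j a)).trans (Eq.trans ?_ (happ (j b)).symm)
    rw [← sub_eq_zero, ← UniformSpace.Completion.coe_sub, ← map_sub, ← norm_eq_zero,
      UniformSpace.Completion.norm_coe]
    have h1 := hn (j a - j b)
    rw [hφ (j a - j b) hab, Complex.zero_re] at h1
    exact pow_eq_zero_iff two_ne_zero |>.1 h1

end HilbertSpace

/-! ### Simultaneous smallness, and passage to nets and constant vectors -/

section MainTheorem

variable {X : Type u} [CoarseSpace X] [MeasurableSpace X] [MeasurableSingletonClass X]
  {μ : Measure X} {h : Admissible μ}

theorem phiEq_zero_iff {T : Ccs h} : PhiEq T (0 : Lp ℂ ∞ μ) ↔ PhiEq T 0 :=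
  ⟨fun hT => hT.congr (Lp.coeFn_zero ℂ ∞ μ), fun hT => hT.congr (Lp.coeFn_zero ℂ ∞ μ).symm⟩

theorem phiEq_zero_zero : PhiEq (0 : Ccs h) 0 := by
  have h1 := phiEq_sub_mulCs (phiEq_mulCs (h := h) 0)
  rwa [sub_self] at h1

/-- Finitely many operators that annihilate the constants are dominated by a single one. -/
theorem exists_sum_norm_sq {κ : Type*} {S : κ → Ccs h} (hS : ∀ k, PhiEq (S k) 0) (s : Finset κ) :
    ∃ T : Ccs h, PhiEq T 0 ∧ ∀ ξ : Lp ℂ 2 μ,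
      (inner ℂ ξ ((T : Op μ) ξ)).re = ∑ k ∈ s, ‖(S k : Op μ) ξ‖ ^ 2 := by
  classical
  induction s using Finset.induction_on with
  | empty =>
    refine ⟨0, phiEq_zero_zero, fun ξ => ?_⟩
    show (inner ℂ ξ (0 : Lp ℂ 2 μ)).re = _
    simp
  | insert k s hk ih =>
    obtain ⟨T, hT, hTs⟩ := ih
    refine ⟨star (S k) * S k + T, ?_, fun ξ => ?_⟩
    · have h1 := (phiEq_mul_of_phiEq_zero (star (S k)) (hS k)).add hT
      rwa [add_zero] at h1
    · show (inner ℂ ξ ((star (S k : Op μ)) ((S k : Op μ) ξ) + (T : Op μ) ξ)).re = _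
      rw [inner_add_right, Complex.add_re, hTs, Finset.sum_insert hk,
        ContinuousLinearMap.star_eq_adjoint, ContinuousLinearMap.adjoint_inner_right,
        inner_self_eq_norm_sq_to_K]
      congr 1
      norm_cast

/-- Apply the hypothesis to T = ∑ S_k*S_k: then ∑‖S_kξ‖² = ⟨ξ, Tξ⟩ ≤ ‖Tξ‖, which is why the
tolerance for T is η². -/
theorem exists_forall_norm_lt
    (hT : ∀ T : Ccs h, PhiEq T 0 → ∀ η : ℝ, 0 < η → ∃ ξ : Lp ℂ 2 μ, ‖ξ‖ = 1 ∧ ‖(T : Op μ) ξ‖ < η)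
    {κ : Type*} {S : κ → Ccs h} (hS : ∀ k, PhiEq (S k) 0) (s : Finset κ) {η : ℝ} (hη : 0 < η) :
    ∃ ξ : Lp ℂ 2 μ, ‖ξ‖ = 1 ∧ ∀ k ∈ s, ‖(S k : Op μ) ξ‖ < η := by
  obtain ⟨T, hT0, hTs⟩ := exists_sum_norm_sq hS s
  obtain ⟨ξ, hξ, hlt⟩ := hT T hT0 (η ^ 2) (by positivity)
  refine ⟨ξ, hξ, fun k hk => lt_of_pow_lt_pow_left₀ 2 hη.le ?_⟩
  calc ‖(S k : Op μ) ξ‖ ^ 2 ≤ ∑ k ∈ s, ‖(S k : Op μ) ξ‖ ^ 2 :=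
        Finset.single_le_sum (f := fun k => ‖(S k : Op μ) ξ‖ ^ 2) (fun _ _ => sq_nonneg _) hk
    _ = (inner ℂ ξ ((T : Op μ) ξ)).re := (hTs ξ).symm
    _ ≤ ‖inner ℂ ξ ((T : Op μ) ξ)‖ := Complex.re_le_norm _
    _ ≤ ‖ξ‖ * ‖(T : Op μ) ξ‖ := norm_inner_le_norm _ _
    _ < η ^ 2 := by rwa [hξ, one_mul]

/-- If operators that annihilate the constants are not bounded below, then there is a net of almost
constant unit vectors. -/
theorem exists_net_of_forall_exists
    (hT : ∀ T : Ccs h, PhiEq T 0 → ∀ η : ℝ, 0 < η → ∃ ξ : Lp ℂ 2 μ, ‖ξ‖ = 1 ∧ ‖(T : Op μ) ξ‖ < η) :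
    ∃ (ι : Type u) (_ : Preorder ι) (_ : IsDirectedOrder ι) (_ : Nonempty ι) (ξ : ι → Lp ℂ 2 μ),
      (∀ i, ‖ξ i‖ = 1) ∧ ∀ (T : Ccs h) (f : Lp ℂ ∞ μ), PhiEq T f →
        Tendsto (fun i => ‖(T : Op μ) (ξ i) - mulOp μ f (ξ i)‖) atTop (𝓝 0) := by
  obtain ⟨ι, h1, h2, h3, ξ, hξ, hξT⟩ := exists_net
    (κ := {p : Ccs h × Lp ℂ ∞ μ // PhiEq p.1 p.2})
    (fun p => ((p.1.1 - mulCs h p.1.2 : Ccs h) : Op μ))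
    fun s η hη => exists_forall_norm_lt hT (fun p => phiEq_sub_mulCs p.2) s hη
  exact ⟨ι, h1, h2, h3, ξ, hξ, fun T f hTf => hξT ⟨(T, f), hTf⟩⟩

/-- A net of almost constant unit vectors yields a constant vector. -/
theorem exists_constantVector_of_net {ι : Type*} {l : Filter ι} [l.NeBot] {ξ : ι → Lp ℂ 2 μ}
    (hξ : ∀ i, ‖ξ i‖ = 1) (hT : ∀ (T : Ccs h) (f : Lp ℂ ∞ μ), PhiEq T f →
      Tendsto (fun i => ‖(T : Op μ) (ξ i) - mulOp μ f (ξ i)‖) l (𝓝 0)) :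
    ∃ (r : Rep (Ccs h)) (v : r.H), v ≠ 0 ∧ ConstantVector r v := by
  have hex := exists_rep_of_tendsto (Ccs h).subtype (Ultrafilter.of l) hξ
  obtain ⟨r, v, hv, hrv⟩ := hex
  exact ⟨r, v, hv, fun T f hTf => hrv T (mulCs h f) ((hT T f hTf).mono_left (Ultrafilter.of_le l))⟩

end MainTheorem

end

end CoarseAmenable

theorem mainTheorem7 {X : Type u} [CoarseAmenable.CoarseSpace X] [MeasurableSpace X]
    [MeasurableSingletonClass X] (μ : Measure X) (hX : CoarseAmenable.Connected X)
    (h : CoarseAmenable.Admissible μ) :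
    List.TFAE [
      CoarseAmenable.Amenable μ,
      ∃ (ι : Type u) (_ : Preorder ι) (_ : IsDirectedOrder ι) (_ : Nonempty ι)
        (ξ : ι → Lp ℂ 2 μ), (∀ i, ‖ξ i‖ = 1) ∧
        ∀ (T : CoarseAmenable.Ccs h) (f : Lp ℂ ∞ μ), CoarseAmenable.PhiEq T f →
          Tendsto (fun i => ‖(T : Lp ℂ 2 μ →L[ℂ] Lp ℂ 2 μ) (ξ i) - CoarseAmenable.mulOp μ f (ξ i)‖)
            atTop (𝓝 0),
      ∀ T : CoarseAmenable.Ccs h, CoarseAmenable.PhiEq T 0 →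
        (0 : ℂ) ∈ spectrum ℂ (T : Lp ℂ 2 μ →L[ℂ] Lp ℂ 2 μ),
      ∀ E : Set (X × X), CoarseAmenable.Gordo μ E → ∀ Δ : CoarseAmenable.Ccs h,
        CoarseAmenable.IsLaplacian E (Δ : Lp ℂ 2 μ →L[ℂ] Lp ℂ 2 μ) →
          (0 : ℂ) ∈ CoarseAmenable.maxSpectrum Δ,
      ∃ (r : CoarseAmenable.Rep (CoarseAmenable.Ccs h)) (v : r.H),
        v ≠ 0 ∧ CoarseAmenable.ConstantVector r v,
      ∃ φ : Lp ℂ ∞ μ →ₗ[ℂ] ℂ, CoarseAmenable.IsMean μ φ ∧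
        ∀ (T : CoarseAmenable.Ccs h) (k f g : Lp ℂ ∞ μ), CoarseAmenable.PhiEq (star T) k →
          CoarseAmenable.LocMapsTo T f g → φ g = φ ((star k) • f : Lp ℂ ∞ μ)] := by
  -- Condition (iii) is applied to T*T, which again annihilates the constants, because 0 in the
  -- spectrum of T alone gives no almost null vectors of T.
  have small_of_spectrum : (∀ T : CoarseAmenable.Ccs h, CoarseAmenable.PhiEq T 0 →
      (0 : ℂ) ∈ spectrum ℂ (T : Lp ℂ 2 μ →L[ℂ] Lp ℂ 2 μ)) →
      ∀ T : CoarseAmenable.Ccs h, CoarseAmenable.PhiEq T 0 → ∀ η : ℝ, 0 < η →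
        ∃ ξ : Lp ℂ 2 μ, ‖ξ‖ = 1 ∧ ‖(T : Lp ℂ 2 μ →L[ℂ] Lp ℂ 2 μ) ξ‖ < η :=
    fun hspec T hT η hη => CoarseAmenable.exists_norm_lt_of_zero_mem_spectrum
      (hspec (star T * T) (CoarseAmenable.phiEq_mul_of_phiEq_zero (star T) hT)) hη
  tfae_have 1 → 2 := fun hA =>
    CoarseAmenable.exists_net_of_forall_exists fun _ hT _ hη => hA.exists_norm_lt hT hη
  tfae_have 2 → 3 := by
    rintro ⟨ι, _, _, _, ξ, hξ, hlim⟩ T hT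
    refine CoarseAmenable.zero_mem_spectrum_of_tendsto (l := atTop) hξ ?_
    simpa only [CoarseAmenable.mulOp_zero, zero_apply, sub_zero] using
      hlim T 0 (CoarseAmenable.phiEq_zero_iff.2 hT)
  tfae_have 3 → 2 := fun hspec =>
    CoarseAmenable.exists_net_of_forall_exists (small_of_spectrum hspec)
  tfae_have 2 → 5 := by
    rintro ⟨ι, _, _, _, ξ, hξ, hlim⟩
    exact CoarseAmenable.exists_constantVector_of_net hξ hlim
  tfae_have 5 → 6 := by
    intro hex
    obtain ⟨r, v, hv, hc⟩ := hex
    exact hc.exists_mean hv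
  tfae_have 5 → 4 := by
    intro hex E hE Δ hΔ
    obtain ⟨r, v, hv, hc⟩ := hex
    exact hc.zero_mem_maxSpectrum hX hv hE hΔ
  tfae_have 6 → 1 := by
    rintro ⟨φ, hφ, hinv⟩
    exact CoarseAmenable.amenable_of_mean h hX hφ hinv
  tfae_have 4 → 1 := CoarseAmenable.amenable_of_zero_mem_maxSpectrum h
  tfae_finish
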